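/- Setting. Let $M$ be a compact connected smooth Riemannian manifold with distance $d_1$ and $\operatorname{diam}(M)=1$, let $(K,d_2)$ be a non-empty compact metric space, and let $\Sigma=M\times K$ carry the metric $d_1+d_2$. Fix $0<\zeta\le 1$. For a real function $h$ on a metric space $(X,d)$ put $H_\zeta(h)=\sup_{x\ne y}|h(x)-h(y)|/d(x,y)^\zeta$ and $|h|_\zeta=H_\zeta(h)+\sup|h|$; $h$ is $\zeta$-Hölder if $H_\zeta(h)<\infty$. Let $f:M\to M$ be a local diffeomorphism of degree $\deg f=\#f^{-1}(x)$, and let $m_1$ be an $f$-invariant Borel probability on $M$ that admits a Jacobian $J>0$, i.e. $m_1(f(E))=\int_E J\,dm_1$ for every Borel set $E$ on which $f$ is injective; put $\rho=1/J$. Suppose there is a continuous $L:M\to\mathbb R$ such that every $x\in M$ has a neighbourhood $U_x$ on which $f$ is injective, with $d_1(u,v)\le L(x)\,d_1(f(u),f(v))$ for $u,v\in U_x$, and that there are an open set $\mathcal A\subset M$, constants $\sigma>1$, $1\le L\le 2$, $\varepsilon_\rho>0$ and an integer $q<\deg f$ such that (f1) $L(x)\le L$ for $x\in\mathcal A$ and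 $L(x)<\sigma^{-1}$ for $x\notin\mathcal A$; (f2) $M$ has a finite covering by open sets on each of which $f$ is injective, $q$ of which cover $\mathcal A$; (f3) $\sup\log\rho-\inf\log\rho<\varepsilon_\rho$ and $H_\zeta(\rho)<\varepsilon_\rho\inf\rho$; and $$e^{\varepsilon_\rho}\cdot\frac{(\deg f-q)\,\sigma^{-\zeta}+q\,L^\zeta\,[1+(L-1)^\zeta]}{\deg f}<1 .$$ Let $G:\Sigma\to K$ be measurable and such that, for some $0<\alpha<1$ and for $m_1$-a.e. $x\in M$, (G1) $d_2(G(x,z_1),G(x,z_2))\le\alpha\, d_2(z_1,z_2)$ for all $z_1,z_2\in K$. Let $F(x,z)=(f(x),G(x,z))$ and $F_*\mu=\mu\circ F^{-1}$. Spaces. Let $\pi_x:\Sigma\to M$ be the projection. For finite measures $\mu,\nu$ on $K$ let $W_1^\zeta(\mu,\nu)=\sup\{|\int g\,d\mu-\int g\,d\nu| : H_\zeta(g)\le 1,\ \sup|g|\le 1\}$. If $\mu$ is a finite positive measure on $\Sigma$ with $\pi_{x*}\mu\ll m_1$, and $(\mu_\gamma)_{\gamma\in M}$ is its disintegration into probabilities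 on the fibres $\{\gamma\}\times K\cong K$, let $\mu|_\gamma=\frac{d\pi_{x*}\mu}{dm_1}(\gamma)\,\mu_\gamma$. For a signed Borel measure $\mu=\mu^+-\mu^-$ (Jordan decomposition) on $\Sigma$ with $\pi_{x*}\mu^\pm\ll m_1$, let $\phi_x=\frac{d\pi_{x*}\mu^+}{dm_1}-\frac{d\pi_{x*}\mu^-}{dm_1}$ and $\|\mu\|_\infty=\operatorname{ess\,sup}_{\gamma}W_1^\zeta(\mu^+|_\gamma,\mu^-|_\gamma)$ with respect to $m_1$. The space $S^\infty$ consists of those $\mu$ for which $\|\mu\|_\infty<\infty$ and $\phi_x$ coincides $m_1$-a.e. with a $\zeta$-Hölder function; its norm is $\|\mu\|_{S^\infty}=|\phi_x|_\zeta+\|\mu\|_\infty$, where $|\phi_x|_\zeta$ is the infimum of $|h|_\zeta$ over the functions $h$ equal to $\phi_x$ $m_1$-a.e. Theorem C. (i) There is a unique $F$-invariant probability $\mu_0\in S^\infty$. (ii) There are linear maps $P,N:S^\infty\to S^\infty$ and constants $0<\xi<1$, $K>0$ such that $F_*=P+N$ on $S^\infty$, $P^2=P$, $\dim P(S^\infty)=1$,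 $PN=NP=0$, and $$\|N^n\mu\|_{S^\infty}\le\|\mu\|_{S^\infty}\,\xi^n K\qquad\text{for all }\mu\in S^\infty,\ n\ge 1. \tag{$*$}$$ (iii) For all $P,N,\xi,K$ as in (ii), every $\zeta$-Hölder function $g:\Sigma\to\mathbb R$, every $\mu_0$-integrable $f_0:\Sigma\to\mathbb R$ with $f_0\mu_0\in S^\infty$, where $(f_0\mu_0)(E)=\int_E f_0\,d\mu_0$, and every $n\ge 1$, $$\left|\int (g\circ F^n)\,f_0\,d\mu_0-\int g\,d\mu_0\int f_0\,d\mu_0\right|\le\|f_0\mu_0\|_{S^\infty}\,K\,|g|_\zeta\,\xi^n .$$ -/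

import Mathlib

open MeasureTheory Manifold Bundle
open scoped ContDiff ENNReal NNReal

noncomputable section

namespace SkewGap

section Norms

variable {X M K : Type*}

/-- The Hölder norm `|h|_ζ = H_ζ(h) + |h|_∞` of a real function on a metric space, as an extended
nonnegative number; `eHolderNorm ζ h` is the best `ζ`-Hölder constant `H_ζ(h)`. -/
def fullHolderNorm [MetricSpace X] (ζ : ℝ≥0) (h : X → ℝ) : ℝ≥0∞ :=
  eHolderNorm ζ h + ⨆ x, ‖h x‖ₑ

/-- The Hölder norm of a class of functions modulo `m₁`-null sets: the infimum of `|h|_ζ` over the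
representatives `h` of the class. It is finite exactly when there is a bounded `ζ`-Hölder
representative; if `m₁` has full support that representative is unique. -/
def aeHolderNorm [MetricSpace M] [MeasurableSpace M] (m₁ : Measure M) (ζ : ℝ≥0) (φ : M → ℝ) :
    ℝ≥0∞ :=
  ⨅ (h : M → ℝ) (_ : φ =ᵐ[m₁] h), fullHolderNorm ζ h

/-- The Wasserstein–Kantorovich-like distance `W_1^ζ` between two finite measures. -/
def wassDist [MetricSpace K] [MeasurableSpace K] (ζ : ℝ≥0) (μ ν : Measure K) : ℝ≥0∞ :=
  ⨆ (g : K → ℝ) (_ : HolderWith 1 ζ g) (_ : ∀ y, |g y| ≤ 1), ‖∫ y, g y ∂μ - ∫ y, g y ∂ν‖ₑ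

/-- The restriction `μ|_γ = φ_x(γ) μ_γ` of a positive finite measure `μ` on `M × K` to the fibre
over `γ`, seen as a measure on `K`: here `φ_x` is the density of the marginal of `μ` on `M` with
respect to `m₁` and `(μ_γ)` is the disintegration of `μ` into probabilities along the fibres. -/
def fiberRestriction [MeasurableSpace M] [MeasurableSpace K] [StandardBorelSpace K] [Nonempty K]
    (m₁ : Measure M) (μ : Measure (M × K)) [IsFiniteMeasure μ] (γ : M) : Measure K :=
  μ.fst.rnDeriv m₁ γ • μ.condKernel γ

/-- The marginal density `φ_x = dπ_{x*}μ⁺/dm₁ - dπ_{x*}μ⁻/dm₁` of a signed measure. -/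
def marginalDensity [MeasurableSpace M] [MeasurableSpace K] (m₁ : Measure M)
    (μ : SignedMeasure (M × K)) (γ : M) : ℝ :=
  (μ.toJordanDecomposition.posPart.fst.rnDeriv m₁ γ).toReal
    - (μ.toJordanDecomposition.negPart.fst.rnDeriv m₁ γ).toReal

/-- The weak norm `‖μ‖_∞ = ess sup_γ W_1^ζ(μ⁺|_γ, μ⁻|_γ)`. -/
def linftyNorm [MeasurableSpace M] [MetricSpace K] [MeasurableSpace K] [StandardBorelSpace K]
    [Nonempty K] (m₁ : Measure M) (ζ : ℝ≥0) (μ : SignedMeasure (M × K)) : ℝ≥0∞ :=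
  essSup (fun γ => wassDist ζ
    (fiberRestriction m₁ μ.toJordanDecomposition.posPart γ)
    (fiberRestriction m₁ μ.toJordanDecomposition.negPart γ)) m₁

/-- The strong norm `‖μ‖_{S^∞} = |φ_x|_ζ + ‖μ‖_∞`, possibly infinite. -/
def sinftyENorm [MetricSpace M] [MeasurableSpace M] [MetricSpace K] [MeasurableSpace K]
    [StandardBorelSpace K] [Nonempty K] (m₁ : Measure M) (ζ : ℝ≥0)
    (μ : SignedMeasure (M × K)) : ℝ≥0∞ :=
  aeHolderNorm m₁ ζ (marginalDensity m₁ μ) + linftyNorm m₁ ζ μ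

/-- The class `AB`: the marginals of `μ⁺` and `μ⁻` on `M` are absolutely continuous. -/
def MarginalsAC [MeasurableSpace M] [MeasurableSpace K] (m₁ : Measure M)
    (μ : SignedMeasure (M × K)) : Prop :=
  μ.toJordanDecomposition.posPart.fst ≪ m₁ ∧ μ.toJordanDecomposition.negPart.fst ≪ m₁

end Norms

section Closure

variable {X M K : Type*}

theorem fullHolderNorm_add_le [MetricSpace X] (ζ : ℝ≥0) (h k : X → ℝ) :
    fullHolderNorm ζ (h + k) ≤ fullHolderNorm ζ h + fullHolderNorm ζ k := by
  unfold fullHolderNorm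
  have h1 : (⨆ x, ‖(h + k) x‖ₑ) ≤ (⨆ x, ‖h x‖ₑ) + ⨆ x, ‖k x‖ₑ :=
    iSup_le fun x => (enorm_add_le _ _).trans
      (add_le_add (le_iSup (fun x => ‖h x‖ₑ) x) (le_iSup (fun x => ‖k x‖ₑ) x))
  calc _ ≤ (eHolderNorm ζ h + eHolderNorm ζ k) + ((⨆ x, ‖h x‖ₑ) + ⨆ x, ‖k x‖ₑ) :=
        add_le_add eHolderNorm_add_le h1
    _ = _ := by ring

theorem fullHolderNorm_smul [MetricSpace X] (ζ : ℝ≥0) (c : ℝ) (h : X → ℝ) :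
    fullHolderNorm ζ (c • h) = ‖c‖ₑ * fullHolderNorm ζ h := by
  unfold fullHolderNorm
  rw [eHolderNorm_smul, mul_add, ENNReal.mul_iSup]
  simp [enorm_eq_nnnorm]

theorem aeHolderNorm_add_le [MetricSpace M] [MeasurableSpace M] (m₁ : Measure M) (ζ : ℝ≥0)
    {φ ψ χ : M → ℝ} (e : χ =ᵐ[m₁] φ + ψ) :
    aeHolderNorm m₁ ζ χ ≤ aeHolderNorm m₁ ζ φ + aeHolderNorm m₁ ζ ψ := by
  unfold aeHolderNorm
  simp only [ENNReal.iInf_add, ENNReal.add_iInf]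
  refine le_iInf fun k => le_iInf fun hk => le_iInf fun h => le_iInf fun hh => ?_
  exact (iInf₂_le (h + k) (e.trans (hh.add hk))).trans (fullHolderNorm_add_le ζ h k)

theorem aeHolderNorm_smul_lt_top [MetricSpace M] [MeasurableSpace M] (m₁ : Measure M) (ζ : ℝ≥0)
    (c : ℝ) {φ χ : M → ℝ} (e : χ =ᵐ[m₁] c • φ) (hφ : aeHolderNorm m₁ ζ φ < ⊤) :
    aeHolderNorm m₁ ζ χ < ⊤ := by
  unfold aeHolderNorm at *
  simp only [iInf_lt_iff] at hφ
  obtain ⟨h, hh, hlt⟩ := hφ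
  refine (iInf₂_le (c • h) (e.trans (hh.const_smul c))).trans_lt ?_
  rw [fullHolderNorm_smul]
  exact ENNReal.mul_lt_top (by simp) hlt

variable [MeasurableSpace M] [MeasurableSpace K] [StandardBorelSpace K] [Nonempty K]

theorem measurable_fiberRestriction (m₁ : Measure M) (μ : Measure (M × K)) [IsFiniteMeasure μ]
    {A : Set K} (hA : MeasurableSet A) : Measurable fun γ => fiberRestriction m₁ μ γ A := by
  simp only [fiberRestriction, Measure.smul_apply, smul_eq_mul]
  exact (Measure.measurable_rnDeriv _ _).mul (ProbabilityTheory.Kernel.measurable_coe _ hA)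

theorem setLIntegral_fiberRestriction (m₁ : Measure M) [IsFiniteMeasure m₁] (μ : Measure (M × K))
    [IsFiniteMeasure μ] (hμ : μ.fst ≪ m₁) {B : Set M} (hB : MeasurableSet B) {A : Set K}
    (hA : MeasurableSet A) :
    ∫⁻ γ in B, fiberRestriction m₁ μ γ A ∂m₁ = μ (B ×ˢ A) := by
  simp only [fiberRestriction, Measure.smul_apply, smul_eq_mul]
  rw [setLIntegral_rnDeriv_mul hμ (ProbabilityTheory.Kernel.measurable_coe _ hA).aemeasurable hB,
    ← Measure.compProd_apply_prod hB hA, μ.disintegrate μ.condKernel]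

theorem ae_isFiniteMeasure_fiberRestriction (m₁ : Measure M) [IsFiniteMeasure m₁]
    (μ : Measure (M × K)) [IsFiniteMeasure μ] :
    ∀ᵐ γ ∂m₁, IsFiniteMeasure (fiberRestriction m₁ μ γ) := by
  filter_upwards [Measure.rnDeriv_lt_top μ.fst m₁] with γ hγ
  exact ⟨by simpa [fiberRestriction] using hγ⟩

/-- Two measurable families of measures with the same integrals are almost everywhere equal. -/
theorem ae_eq_of_families (m₁ : Measure M) [IsFiniteMeasure m₁] {κ η : M → Measure K}
    (mκ : ∀ A, MeasurableSet A → Measurable fun γ => κ γ A)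
    (mη : ∀ A, MeasurableSet A → Measurable fun γ => η γ A)
    (fκ : ∀ᵐ γ ∂m₁, IsFiniteMeasure (κ γ))
    (h : ∀ B A, MeasurableSet B → MeasurableSet A →
      ∫⁻ γ in B, κ γ A ∂m₁ = ∫⁻ γ in B, η γ A ∂m₁) : ∀ᵐ γ ∂m₁, κ γ = η γ := by
  have key : ∀ A, MeasurableSet A → ∀ᵐ γ ∂m₁, κ γ A = η γ A := fun A hA =>
    ae_eq_of_forall_setLIntegral_eq_of_sigmaFinite (mκ A hA) (mη A hA)
      fun B hB _ => h B A hB hA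
  set C : Set (Set K) := generateSetAlgebra (MeasurableSpace.countableGeneratingSet K) with hC
  have hCc : C.Countable :=
    countable_generateSetAlgebra MeasurableSpace.countable_countableGeneratingSet
  have hgen : ‹MeasurableSpace K› = MeasurableSpace.generateFrom C := by
    rw [hC, generateFrom_generateSetAlgebra_eq,
      MeasurableSpace.generateFrom_countableGeneratingSet]
  have hCm : ∀ A ∈ C, MeasurableSet A := fun A hA => by
    rw [hgen]; exact MeasurableSpace.measurableSet_generateFrom hA
  have hpi : IsPiSystem C := fun s hs t ht _ =>
    isSetAlgebra_generateSetAlgebra.inter_mem hs ht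
  have h1 : ∀ᵐ γ ∂m₁, ∀ A ∈ C, κ γ A = η γ A :=
    (ae_ball_iff hCc).2 fun A hA => key A (hCm A hA)
  filter_upwards [h1, key Set.univ MeasurableSet.univ, fκ] with γ h1 h2 h3
  exact ext_of_generate_finite C hgen hpi h1 h2

theorem fiberRestriction_add (m₁ : Measure M) [IsFiniteMeasure m₁] (μ ν : Measure (M × K))
    [IsFiniteMeasure μ] [IsFiniteMeasure ν] (hμ : μ.fst ≪ m₁) (hν : ν.fst ≪ m₁) :
    ∀ᵐ γ ∂m₁, fiberRestriction m₁ (μ + ν) γ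
      = fiberRestriction m₁ μ γ + fiberRestriction m₁ ν γ := by
  refine ae_eq_of_families m₁ (fun A hA => measurable_fiberRestriction m₁ _ hA)
    (fun A hA => (measurable_fiberRestriction m₁ μ hA).add (measurable_fiberRestriction m₁ ν hA))
    (ae_isFiniteMeasure_fiberRestriction m₁ _) fun B A hB hA => ?_
  simp only [Measure.add_apply]
  rw [lintegral_add_left (measurable_fiberRestriction m₁ μ hA),
    setLIntegral_fiberRestriction m₁ μ hμ hB hA, setLIntegral_fiberRestriction m₁ ν hν hB hA,
    setLIntegral_fiberRestriction m₁ _ _ hB hA, Measure.add_apply]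
  rw [Measure.fst_add]
  exact hμ.add_left hν

theorem fiberRestriction_smul (m₁ : Measure M) [IsFiniteMeasure m₁] (c : ℝ≥0)
    (μ : Measure (M × K)) [IsFiniteMeasure μ] (hμ : μ.fst ≪ m₁) :
    ∀ᵐ γ ∂m₁, fiberRestriction m₁ (c • μ) γ = c • fiberRestriction m₁ μ γ := by
  have e : (c • μ).fst = c • μ.fst := by
    simp only [Measure.fst, Measure.map_smul]
  refine ae_eq_of_families m₁ (fun A hA => measurable_fiberRestriction m₁ _ hA)
    (fun A hA => (measurable_fiberRestriction m₁ μ hA).const_smul c)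
    (ae_isFiniteMeasure_fiberRestriction m₁ _) fun B A hB hA => ?_
  simp only [Measure.smul_apply]
  rw [setLIntegral_fiberRestriction m₁ _ _ hB hA]
  · change c • μ (B ×ˢ A) = ∫⁻ γ in B, (c : ℝ≥0∞) * fiberRestriction m₁ μ γ A ∂m₁
    rw [lintegral_const_mul _ (measurable_fiberRestriction m₁ μ hA),
      setLIntegral_fiberRestriction m₁ μ hμ hB hA]
    rfl
  · rw [e]
    exact hμ.smul_left c

/-- Absolute continuity of the marginals, in terms of the signed measure alone. -/
theorem marginalsAC_iff (m₁ : Measure M) (μ : SignedMeasure (M × K)) :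
    MarginalsAC m₁ μ ↔ ∀ B, MeasurableSet B → m₁ B = 0 →
      ∀ E, MeasurableSet E → E ⊆ Prod.fst ⁻¹' B → μ E = 0 := by
  constructor
  · rintro ⟨hp, hn⟩ B hB hB0 E hE hEB
    have h1 := hp hB0
    have h2 := hn hB0
    rw [Measure.fst_apply hB] at h1 h2
    rw [SignedMeasure.apply_eq_posPart_real_sub_negPart_real μ hE, measureReal_def,
      measureReal_def, measure_mono_null hEB h1, measure_mono_null hEB h2]
    simp
  · intro h
    obtain ⟨i, hi, hi2, hi3, hp, hn⟩ := μ.toJordanDecomposition_spec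
    refine ⟨Measure.AbsolutelyContinuous.mk fun B hB hB0 => ?_,
      Measure.AbsolutelyContinuous.mk fun B hB hB0 => ?_⟩
    · rw [Measure.fst_apply hB, hp, SignedMeasure.toMeasureOfZeroLE_apply _ hi2 hi (measurable_fst hB)]
      have := h B hB hB0 (i ∩ Prod.fst ⁻¹' B) (hi.inter (measurable_fst hB)) Set.inter_subset_right
      simp [this]
    · rw [Measure.fst_apply hB, hn, SignedMeasure.toMeasureOfLEZero_apply _ hi3 hi.compl
        (measurable_fst hB)]
      have := h B hB hB0 (iᶜ ∩ Prod.fst ⁻¹' B) (hi.compl.inter (measurable_fst hB))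
        Set.inter_subset_right
      simp [this]

theorem marginalsAC_add (m₁ : Measure M) {μ ν : SignedMeasure (M × K)} (hμ : MarginalsAC m₁ μ)
    (hν : MarginalsAC m₁ ν) : MarginalsAC m₁ (μ + ν) := by
  rw [marginalsAC_iff] at *
  intro B hB hB0 E hE hEB
  simp [hμ B hB hB0 E hE hEB, hν B hB hB0 E hE hEB]

theorem marginalsAC_smul (m₁ : Measure M) (c : ℝ) {μ : SignedMeasure (M × K)}
    (hμ : MarginalsAC m₁ μ) : MarginalsAC m₁ (c • μ) := by
  rw [marginalsAC_iff] at *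
  intro B hB hB0 E hE hEB
  simp [hμ B hB hB0 E hE hEB]

/-- The Jordan decompositions of `μ`, `ν` and `μ + ν` are related by an identity between positive
measures. -/
theorem jordan_add (μ ν : SignedMeasure (M × K)) :
    (μ + ν).toJordanDecomposition.posPart
        + (μ.toJordanDecomposition.negPart + ν.toJordanDecomposition.negPart)
      = (μ + ν).toJordanDecomposition.negPart
        + (μ.toJordanDecomposition.posPart + ν.toJordanDecomposition.posPart) := by
  ext E hE
  have h := SignedMeasure.apply_eq_posPart_real_sub_negPart_real (μ + ν) hE
  have h1 := SignedMeasure.apply_eq_posPart_real_sub_negPart_real μ hE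
  have h2 := SignedMeasure.apply_eq_posPart_real_sub_negPart_real ν hE
  rw [← ENNReal.toReal_eq_toReal_iff' (measure_ne_top _ _) (measure_ne_top _ _)]
  change Measure.real _ E = Measure.real _ E
  rw [measureReal_add_apply, measureReal_add_apply, measureReal_add_apply, measureReal_add_apply]
  rw [add_apply] at h
  linarith

theorem fiberRestriction_jordan_add (m₁ : Measure M) [IsFiniteMeasure m₁]
    {μ ν : SignedMeasure (M × K)} (hμ : MarginalsAC m₁ μ) (hν : MarginalsAC m₁ ν) :
    ∀ᵐ γ ∂m₁, fiberRestriction m₁ (μ + ν).toJordanDecomposition.posPart γ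
        + (fiberRestriction m₁ μ.toJordanDecomposition.negPart γ
          + fiberRestriction m₁ ν.toJordanDecomposition.negPart γ)
      = fiberRestriction m₁ (μ + ν).toJordanDecomposition.negPart γ
        + (fiberRestriction m₁ μ.toJordanDecomposition.posPart γ
          + fiberRestriction m₁ ν.toJordanDecomposition.posPart γ) := by
  have hs := marginalsAC_add m₁ hμ hν
  have a1 : (μ.toJordanDecomposition.negPart + ν.toJordanDecomposition.negPart).fst ≪ m₁ := by
    rw [Measure.fst_add]; exact hμ.2.add_left hν.2
  have a2 : (μ.toJordanDecomposition.posPart + ν.toJordanDecomposition.posPart).fst ≪ m₁ := by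
    rw [Measure.fst_add]; exact hμ.1.add_left hν.1
  filter_upwards [fiberRestriction_add m₁ _ _ hμ.1 hν.1, fiberRestriction_add m₁ _ _ hμ.2 hν.2,
    fiberRestriction_add m₁ _ _ hs.1 a1, fiberRestriction_add m₁ _ _ hs.2 a2] with γ h1 h2 h3 h4
  rw [← h1, ← h2, ← h3, ← h4]
  congr 1
  simp only [jordan_add]

theorem marginalDensity_add (m₁ : Measure M) [IsFiniteMeasure m₁]
    {μ ν : SignedMeasure (M × K)} (hμ : MarginalsAC m₁ μ) (hν : MarginalsAC m₁ ν) :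
    marginalDensity m₁ (μ + ν) =ᵐ[m₁] marginalDensity m₁ μ + marginalDensity m₁ ν := by
  filter_upwards [fiberRestriction_jordan_add m₁ hμ hν,
    Measure.rnDeriv_lt_top (μ + ν).toJordanDecomposition.posPart.fst m₁,
    Measure.rnDeriv_lt_top (μ + ν).toJordanDecomposition.negPart.fst m₁,
    Measure.rnDeriv_lt_top μ.toJordanDecomposition.posPart.fst m₁,
    Measure.rnDeriv_lt_top μ.toJordanDecomposition.negPart.fst m₁,
    Measure.rnDeriv_lt_top ν.toJordanDecomposition.posPart.fst m₁,
    Measure.rnDeriv_lt_top ν.toJordanDecomposition.negPart.fst m₁] with γ h h1 h2 h3 h4 h5 h6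
  have e := congrArg (fun m : Measure K => (m Set.univ).toReal) h
  simp only [fiberRestriction, Measure.add_apply, Measure.smul_apply, smul_eq_mul,
    measure_univ, mul_one] at e
  rw [ENNReal.toReal_add h1.ne (ENNReal.add_lt_top.2 ⟨h4, h6⟩).ne,
    ENNReal.toReal_add h2.ne (ENNReal.add_lt_top.2 ⟨h3, h5⟩).ne,
    ENNReal.toReal_add h4.ne h6.ne, ENNReal.toReal_add h3.ne h5.ne] at e
  simp only [marginalDensity, Pi.add_apply]
  linarith

theorem marginalDensity_neg (m₁ : Measure M) (μ : SignedMeasure (M × K)) :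
    marginalDensity m₁ (-μ) = (-1 : ℝ) • marginalDensity m₁ μ := by
  funext γ
  simp [marginalDensity, SignedMeasure.toJordanDecomposition_neg]

theorem marginalDensity_nnsmul (m₁ : Measure M) [IsFiniteMeasure m₁] (c : ℝ≥0)
    (μ : SignedMeasure (M × K)) :
    marginalDensity m₁ (c • μ) =ᵐ[m₁] (c : ℝ) • marginalDensity m₁ μ := by
  have e : ∀ ν : Measure (M × K), (c • ν).fst = c • ν.fst := fun ν => by
    simp only [Measure.fst, Measure.map_smul]
  filter_upwards [Measure.rnDeriv_smul_left_of_ne_top μ.toJordanDecomposition.posPart.fst m₁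
      (ENNReal.coe_ne_top (r := c)),
    Measure.rnDeriv_smul_left_of_ne_top μ.toJordanDecomposition.negPart.fst m₁
      (ENNReal.coe_ne_top (r := c))] with γ h1 h2
  simp only [marginalDensity, SignedMeasure.toJordanDecomposition_smul,
    JordanDecomposition.smul_posPart, JordanDecomposition.smul_negPart, e, Pi.smul_apply]
  have h1' : (c • μ.toJordanDecomposition.posPart.fst).rnDeriv m₁ γ
      = (c : ℝ≥0∞) * μ.toJordanDecomposition.posPart.fst.rnDeriv m₁ γ := h1
  have h2' : (c • μ.toJordanDecomposition.negPart.fst).rnDeriv m₁ γ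
      = (c : ℝ≥0∞) * μ.toJordanDecomposition.negPart.fst.rnDeriv m₁ γ := h2
  rw [h1', h2']
  simp [mul_sub]

end Closure

section Wasserstein

variable {M K : Type*} [MetricSpace K] [CompactSpace K] [MeasurableSpace K] [BorelSpace K]

theorem integrable_of_holder {ζ : ℝ≥0} (hζ : 0 < ζ) {C : ℝ≥0} {g : K → ℝ}
    (hg : HolderWith C ζ g) (μ : Measure K) [IsFiniteMeasure μ] : Integrable g μ :=
  (hg.continuous hζ).integrable_of_hasCompactSupport (HasCompactSupport.of_compactSpace g)

theorem wassDist_le_add {ζ : ℝ≥0} (hζ : 0 < ζ) {a b p p' n n' : Measure K} [IsFiniteMeasure a]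
    [IsFiniteMeasure b] [IsFiniteMeasure p] [IsFiniteMeasure p'] [IsFiniteMeasure n]
    [IsFiniteMeasure n'] (h : a + (n + n') = b + (p + p')) :
    wassDist ζ a b ≤ wassDist ζ p n + wassDist ζ p' n' := by
  refine iSup_le fun g => iSup_le fun hg => iSup_le fun hb => ?_
  have I : ∀ (m : Measure K) [IsFiniteMeasure m], Integrable g m := fun m _ =>
    integrable_of_holder hζ hg m
  have e : ∫ y, g y ∂a + (∫ y, g y ∂n + ∫ y, g y ∂n')
      = ∫ y, g y ∂b + (∫ y, g y ∂p + ∫ y, g y ∂p') := by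
    rw [← integral_add_measure (I _) (I _), ← integral_add_measure (I _) (I _), h,
      integral_add_measure (I _) (I _), integral_add_measure (I _) (I _)]
  have e2 : ∫ y, g y ∂a - ∫ y, g y ∂b
      = (∫ y, g y ∂p - ∫ y, g y ∂n) + (∫ y, g y ∂p' - ∫ y, g y ∂n') := by linarith
  rw [e2]
  refine (enorm_add_le _ _).trans (add_le_add ?_ ?_)
  · exact le_iSup_of_le g (le_iSup_of_le hg (le_iSup_of_le hb le_rfl))
  · exact le_iSup_of_le g (le_iSup_of_le hg (le_iSup_of_le hb le_rfl))

theorem wassDist_comm (ζ : ℝ≥0) (a b : Measure K) : wassDist ζ a b = wassDist ζ b a := by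
  unfold wassDist
  simp only [← edist_eq_enorm_sub]
  simp only [edist_comm]

theorem wassDist_smul_le (ζ : ℝ≥0) (c : ℝ≥0) (a b : Measure K) :
    wassDist ζ (c • a) (c • b) ≤ c * wassDist ζ a b := by
  refine iSup_le fun g => iSup_le fun hg => iSup_le fun hb => ?_
  rw [integral_smul_nnreal_measure, integral_smul_nnreal_measure, ← smul_sub]
  have : ‖c • (∫ y, g y ∂a - ∫ y, g y ∂b)‖ₑ = c * ‖∫ y, g y ∂a - ∫ y, g y ∂b‖ₑ := by
    rw [NNReal.smul_def, smul_eq_mul, enorm_mul]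
    simp
  rw [this]
  gcongr
  exact le_iSup_of_le g (le_iSup_of_le hg (le_iSup_of_le hb le_rfl))

variable [Nonempty K] [MeasurableSpace M]

theorem linftyNorm_add_le (m₁ : Measure M) [IsFiniteMeasure m₁] {ζ : ℝ≥0} (hζ : 0 < ζ)
    {μ ν : SignedMeasure (M × K)} (hμ : MarginalsAC m₁ μ) (hν : MarginalsAC m₁ ν) :
    linftyNorm m₁ ζ (μ + ν) ≤ linftyNorm m₁ ζ μ + linftyNorm m₁ ζ ν := by
  refine (essSup_mono_ae ?_).trans (ENNReal.essSup_add_le _ _)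
  filter_upwards [fiberRestriction_jordan_add m₁ hμ hν,
    ae_isFiniteMeasure_fiberRestriction m₁ (μ + ν).toJordanDecomposition.posPart,
    ae_isFiniteMeasure_fiberRestriction m₁ (μ + ν).toJordanDecomposition.negPart,
    ae_isFiniteMeasure_fiberRestriction m₁ μ.toJordanDecomposition.posPart,
    ae_isFiniteMeasure_fiberRestriction m₁ μ.toJordanDecomposition.negPart,
    ae_isFiniteMeasure_fiberRestriction m₁ ν.toJordanDecomposition.posPart,
    ae_isFiniteMeasure_fiberRestriction m₁ ν.toJordanDecomposition.negPart]
    with γ h h1 h2 h3 h4 h5 h6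
  exact wassDist_le_add hζ h

theorem linftyNorm_neg (m₁ : Measure M) (ζ : ℝ≥0) (μ : SignedMeasure (M × K)) :
    linftyNorm m₁ ζ (-μ) = linftyNorm m₁ ζ μ := by
  unfold linftyNorm
  simp only [SignedMeasure.toJordanDecomposition_neg, JordanDecomposition.neg_posPart,
    JordanDecomposition.neg_negPart]
  congr 1
  funext γ
  exact wassDist_comm ζ _ _

theorem linftyNorm_nnsmul_le (m₁ : Measure M) [IsFiniteMeasure m₁] (ζ c : ℝ≥0)
    {μ : SignedMeasure (M × K)} (hμ : MarginalsAC m₁ μ) :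
    linftyNorm m₁ ζ (c • μ) ≤ c * linftyNorm m₁ ζ μ := by
  unfold linftyNorm
  rw [← ENNReal.essSup_const_mul]
  refine essSup_mono_ae ?_
  filter_upwards [fiberRestriction_smul m₁ c _ hμ.1, fiberRestriction_smul m₁ c _ hμ.2]
    with γ h1 h2
  simp only [SignedMeasure.toJordanDecomposition_smul, JordanDecomposition.smul_posPart,
    JordanDecomposition.smul_negPart]
  rw [h1, h2]
  exact wassDist_smul_le ζ c _ _

variable [MetricSpace M]

/-- The space `S^∞` of signed measures on `M × K` whose marginals are absolutely continuous with
respect to `m₁`, whose weak norm is finite and whose marginal density is `ζ`-Hölder. -/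
def SInfty (m₁ : Measure M) [IsFiniteMeasure m₁] (ζ : ℝ≥0) (hζ : 0 < ζ) :
    Submodule ℝ (SignedMeasure (M × K)) where
  carrier := {μ | MarginalsAC m₁ μ ∧ sinftyENorm m₁ ζ μ < ⊤}
  zero_mem' := by
    have hz : MarginalsAC m₁ (0 : SignedMeasure (M × K)) := by
      rw [marginalsAC_iff]; intros; rfl
    have h0 : (0 : SignedMeasure (M × K)) = (0 : ℝ≥0) • 0 := by simp
    refine ⟨hz, ENNReal.add_lt_top.2 ⟨?_, ?_⟩⟩
    · refine (iInf₂_le (0 : M → ℝ) ?_).trans_lt ?_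
      · have := marginalDensity_nnsmul m₁ 0 (0 : SignedMeasure (M × K))
        rw [← h0] at this
        simpa using this
      · simp [fullHolderNorm]
    · rw [h0]
      exact (linftyNorm_nnsmul_le m₁ ζ 0 hz).trans_lt (by simp)
  add_mem' := by
    rintro μ ν ⟨hμ, hμ'⟩ ⟨hν, hν'⟩
    rw [sinftyENorm, ENNReal.add_lt_top] at hμ' hν'
    refine ⟨marginalsAC_add m₁ hμ hν, ENNReal.add_lt_top.2 ⟨?_, ?_⟩⟩
    · exact (aeHolderNorm_add_le m₁ ζ (marginalDensity_add m₁ hμ hν)).trans_lt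
        (ENNReal.add_lt_top.2 ⟨hμ'.1, hν'.1⟩)
    · exact (linftyNorm_add_le m₁ hζ hμ hν).trans_lt (ENNReal.add_lt_top.2 ⟨hμ'.2, hν'.2⟩)
  smul_mem' := by
    rintro c μ ⟨hμ, hμ'⟩
    rw [sinftyENorm, ENNReal.add_lt_top] at hμ'
    have key : ∀ r : ℝ≥0, aeHolderNorm m₁ ζ (marginalDensity m₁ (r • μ)) < ⊤ ∧
        linftyNorm m₁ ζ (r • μ) < ⊤ := fun r =>
      ⟨aeHolderNorm_smul_lt_top m₁ ζ r (marginalDensity_nnsmul m₁ r μ) hμ'.1,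
        (linftyNorm_nnsmul_le m₁ ζ r hμ).trans_lt (ENNReal.mul_lt_top (by simp) hμ'.2)⟩
    refine ⟨marginalsAC_smul m₁ c hμ, ?_⟩
    rcases le_total 0 c with hc | hc
    · lift c to ℝ≥0 using hc
      exact ENNReal.add_lt_top.2 (key c)
    · have e : c • μ = -((-c).toNNReal • μ) := by
        have h1 : ((-c).toNNReal • μ : SignedMeasure (M × K))
            = (((-c).toNNReal : ℝ≥0) : ℝ) • μ := rfl
        rw [h1, Real.coe_toNNReal _ (by linarith)]
        ext E _
        simp
      rw [e]
      refine ENNReal.add_lt_top.2 ⟨?_, ?_⟩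
      · rw [marginalDensity_neg]
        exact aeHolderNorm_smul_lt_top m₁ ζ (-1) Filter.EventuallyEq.rfl (key _).1
      · rw [linftyNorm_neg]
        exact (key _).2

/-- The norm of `S^∞`. -/
def sinftyNorm (m₁ : Measure M) (ζ : ℝ≥0) (μ : SignedMeasure (M × K)) : ℝ :=
  (sinftyENorm m₁ ζ μ).toReal

end Wasserstein

section Dynamics

variable {M K : Type*}

/-- The skew product `F(x, z) = (f(x), G(x, z))`. -/
def skewProduct (f : M → M) (G : M × K → K) (p : M × K) : M × K := (f p.1, G p)

/-- The degree of `f`: the number of preimages of a point (the same for all points when `f` is a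
local homeomorphism of a compact connected space). -/
def mapDegree (f : M → M) : ℕ := ⨆ x : M, (f ⁻¹' {x}).ncard

/-- `J > 0` is the Jacobian of `f` with respect to `m₁`. -/
structure IsJacobian [MeasurableSpace M] (m₁ : Measure M) (f : M → M) (J : M → ℝ) : Prop where
  measurable : Measurable J
  pos : ∀ x, 0 < J x
  measure_image : ∀ E, MeasurableSet E → Set.InjOn f E →
    m₁ (f '' E) = ∫⁻ x in E, ENNReal.ofReal (J x) ∂m₁

/-- The weight `ρ = 1 / |det f'|`, where `J = |det f'|` is the Jacobian of `f`. -/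
def weight (J : M → ℝ) (x : M) : ℝ := 1 / J x

/-- The hypotheses on the base map `f` and on its invariant probability `m₁` with Jacobian `J`.
`Λ` bounds the Lipschitz constants of the local inverse branches of `f`, `A` is the region where
`f` may fail to expand, and `q` is the number of domains of injectivity needed to cover `A`. -/
structure BaseHypotheses {d : ℕ} [MetricSpace M] [ChartedSpace (EuclideanSpace ℝ (Fin d)) M]
    [MeasurableSpace M] (ζ : ℝ≥0) (f : M → M) (m₁ : Measure M) (J Λ : M → ℝ) (A : Set M)
    (σ L ε : ℝ) (q : ℕ) : Prop where
  localDiffeo : IsLocalDiffeomorph (𝓡 d) (𝓡 d) 1 f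
  invariant : MeasurePreserving f m₁ m₁
  jacobian : IsJacobian m₁ f J
  continuous_bound : Continuous Λ
  inverse_branch : ∀ x, ∃ U ∈ nhds x, Set.InjOn f U ∧
    ∀ u ∈ U, ∀ v ∈ U, dist u v ≤ Λ x * dist (f u) (f v)
  isOpen_region : IsOpen A
  one_lt_sigma : 1 < σ
  one_le_L : 1 ≤ L
  L_le_two : L ≤ 2
  bound_on_region : ∀ x ∈ A, Λ x ≤ L
  bound_off_region : ∀ x ∉ A, Λ x < σ⁻¹
  covering : ∃ 𝒰 : Finset (Set M), (∀ U ∈ 𝒰, IsOpen U ∧ Set.InjOn f U) ∧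
    (⋃ U ∈ 𝒰, U) = Set.univ ∧ ∃ 𝒱 ⊆ 𝒰, 𝒱.card = q ∧ A ⊆ ⋃ V ∈ 𝒱, V
  q_lt_degree : q < mapDegree f
  eps_pos : 0 < ε
  osc_log_weight : (⨆ x, Real.log (weight J x)) - (⨅ x, Real.log (weight J x)) < ε
  holder_weight : eHolderNorm ζ (weight J) < ENNReal.ofReal (ε * ⨅ x, weight J x)
  smallness : Real.exp ε *
    ((((mapDegree f : ℝ) - q) * σ ^ (-(ζ : ℝ)) + q * L ^ (ζ : ℝ) * (1 + (L - 1) ^ (ζ : ℝ)))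
      / mapDegree f) < 1

/-- `G` contracts `m₁`-almost every fibre `{x} × K` with rate `α`. -/
def ContractsFibers [MeasurableSpace M] [MetricSpace K] (m₁ : Measure M) (G : M × K → K)
    (α : ℝ) : Prop :=
  ∀ᵐ x ∂m₁, ∀ z₁ z₂ : K, dist (G (x, z₁)) (G (x, z₂)) ≤ α * dist z₁ z₂

/-- A function on `M × K`, regarded as a function on the product with the metric `d₁ + d₂`. -/
def onSumMetric (g : M × K → ℝ) (p : WithLp 1 (M × K)) : ℝ := g (WithLp.ofLp p)

variable [MetricSpace M] [MeasurableSpace M] [MetricSpace K] [CompactSpace K] [Nonempty K]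
  [MeasurableSpace K] [BorelSpace K]

/-- `μ` is an `F`-invariant probability that belongs to `S^∞`. -/
def IsInvariantInSInfty (F : M × K → M × K) (m₁ : Measure M) [IsFiniteMeasure m₁] (ζ : ℝ≥0)
    (hζ : 0 < ζ) (μ : ProbabilityMeasure (M × K)) : Prop :=
  (μ : Measure (M × K)).map F = μ ∧ (μ : Measure (M × K)).toSignedMeasure ∈ SInfty m₁ ζ hζ

/-- The spectral gap of the transfer operator `F_*` on `S^∞`: `F_* = P + N` with `P` a projection
of rank one, `PN = NP = 0`, and `‖N^n μ‖ ≤ ‖μ‖ ξ^n C`. -/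
structure IsSpectralGap (F : M × K → M × K) (m₁ : Measure M) [IsFiniteMeasure m₁] (ζ : ℝ≥0)
    (hζ : 0 < ζ) (P N : Module.End ℝ (SInfty (K := K) m₁ ζ hζ)) (ξ C : ℝ) : Prop where
  decomposition : ∀ μ : SInfty (K := K) m₁ ζ hζ,
    (μ : SignedMeasure (M × K)).map F = (P μ : SignedMeasure (M × K)) + N μ
  projection : P * P = P
  rank_one : Module.finrank ℝ (LinearMap.range P) = 1
  xi_pos : 0 < ξ
  xi_lt_one : ξ < 1
  const_pos : 0 < C
  bound : ∀ n : ℕ, 1 ≤ n → ∀ μ : SInfty (K := K) m₁ ζ hζ,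
    sinftyNorm m₁ ζ ((N ^ n) μ : SignedMeasure (M × K))
      ≤ sinftyNorm m₁ ζ (μ : SignedMeasure (M × K)) * ξ ^ n * C
  proj_mul : P * N = 0
  mul_proj : N * P = 0

end Dynamics

end SkewGap

end

open SkewGap

/-!
Everything rests on one estimate: the iterates of `F_*` contract the measures of zero mass in `S^∞`
exponentially fast.

On the base, the weight `ρ` divided by its sums over the fibres of `f` is a Markov weight whose
transfer operator is dual to the composition with `f`. By the smallness condition a Lasota–Yorke
inequality bounds the local Hölder constant of the transferred function, where the factor
`L^ζ (1 + (L - 1)^ζ)` of a bad branch comes from cutting a geodesic longer than the scale of the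
local bound into two pieces. The same inequality for the weight `1 / deg f`, applied to the distance
to `f⁻ᵏ(x')`, shows that any two points have `k`-th preimages close to each other. A Doeblin
argument along these preimages contracts the oscillation as well, so functions of zero mean decay
exponentially in the Hölder norm.

On the fibres, a test function composed with `F` is, up to a function of the base point, `α^ζ` times
a test function. For a measure of zero mass the part on the base is governed by its marginal
density, which decays. Disintegrations are avoided by testing with functions on the whole product.

This decay makes `F_*ⁿ (m₁ × δ_z)` converge to an invariant probability `μ₀`, which it also shows to
be unique, and it gives the splitting `P μ = μ(Σ) μ₀`, `N = F_* (1 - P)`. For every splitting as in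
(ii), `P` must be this projection, so that the correlation in (iii) is the integral of `g` against
`Nⁿ (f₀ μ₀)`.
-/

noncomputable section

namespace SkewGap

section HolderBounds

/-- The oscillation `sup h - inf h` is at most `s`; unlike the difference of the extrema, this makes
sense before `h` is known to be bounded. -/
def OscBound {X : Type*} (s : ℝ) (h : X → ℝ) : Prop := ∀ x y, h x - h y ≤ s

theorem OscBound.mono {X : Type*} {s s' : ℝ} {h : X → ℝ} (hs : OscBound s h) (hss : s ≤ s') :
    OscBound s' h := fun x y => (hs x y).trans hss

theorem OscBound.abs_sub_le {X : Type*} {s : ℝ} {h : X → ℝ} (hs : OscBound s h) (x y : X) :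
    |h x - h y| ≤ s :=
  abs_sub_le_iff.2 ⟨hs x y, hs y x⟩

theorem OscBound.nonneg {X : Type*} [Nonempty X] {s : ℝ} {h : X → ℝ} (hs : OscBound s h) :
    0 ≤ s := by
  inhabit X
  simpa using hs default default

theorem OscBound.of_abs_le {X : Type*} {C : ℝ} {h : X → ℝ} (hC : ∀ x, |h x| ≤ C) :
    OscBound (2 * C) h := fun x y => by
  linarith [(abs_le.1 (hC x)).2, (abs_le.1 (hC y)).1]

variable {X : Type*} [PseudoMetricSpace X] {ζ δ C C' : ℝ} {h : X → ℝ}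

/-- The real-valued form of `HolderWith C ζ h`, convenient for estimates in which `C` is a real
expression. -/
def HolderBound (ζ C : ℝ) (h : X → ℝ) : Prop := ∀ x y, |h x - h y| ≤ C * dist x y ^ ζ

/-- `h` satisfies a `ζ`-Hölder bound with constant `C` at scales smaller than `δ`. -/
def LocalHolderBound (ζ δ C : ℝ) (h : X → ℝ) : Prop :=
  ∀ x y, dist x y < δ → |h x - h y| ≤ C * dist x y ^ ζ

/-- A metric version of the existence of minimizing geodesics: between any two points there is a
point dividing their distance in any given ratio. -/
def HasIntermediatePoints (X : Type*) [PseudoMetricSpace X] : Prop :=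
  ∀ (x y : X) (t : ℝ), 0 ≤ t → t ≤ 1 →
    ∃ z, dist x z ≤ t * dist x y ∧ dist z y ≤ (1 - t) * dist x y

theorem HolderBound.mono (hh : HolderBound ζ C h) (hC : C ≤ C') : HolderBound ζ C' h :=
  fun x y => (hh x y).trans (by gcongr)

theorem HolderBound.local (hh : HolderBound ζ C h) : LocalHolderBound ζ δ C h :=
  fun x y _ => hh x y

theorem LocalHolderBound.mono (hh : LocalHolderBound ζ δ C h) (hC : C ≤ C') :
    LocalHolderBound ζ δ C' h :=
  fun x y hxy => (hh x y hxy).trans (by gcongr)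

theorem LocalHolderBound.double (hX : HasIntermediatePoints X) (hζ : 0 ≤ ζ) (hC : 0 ≤ C)
    (hh : LocalHolderBound ζ δ C h) : LocalHolderBound ζ (2 * δ) (2 * C) h := by
  intro x y hxy
  obtain ⟨z, hxz, hzy⟩ := hX x y (1 / 2) (by norm_num) (by norm_num)
  have hd : 0 ≤ dist x y := dist_nonneg
  calc |h x - h y| ≤ |h x - h z| + |h z - h y| := abs_sub_le _ _ _
    _ ≤ C * dist x z ^ ζ + C * dist z y ^ ζ :=
        add_le_add (hh x z (by linarith)) (hh z y (by linarith))
    _ ≤ C * dist x y ^ ζ + C * dist x y ^ ζ := by gcongr <;> linarith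
    _ = 2 * C * dist x y ^ ζ := by ring

theorem LocalHolderBound.double_iterate (hX : HasIntermediatePoints X) (hζ : 0 ≤ ζ) (hC : 0 ≤ C)
    (hh : LocalHolderBound ζ δ C h) (k : ℕ) : LocalHolderBound ζ (2 ^ k * δ) (2 ^ k * C) h := by
  induction k with
  | zero => simpa using hh
  | succ k ih =>
    have := ih.double hX hζ (by positivity)
    rwa [pow_succ', mul_assoc, mul_assoc]

theorem exists_holderBound_of_localHolderBound (hX : HasIntermediatePoints X) {d : ℝ}
    (hd : ∀ x y : X, dist x y ≤ d) (hζ : 0 ≤ ζ) (hδ : 0 < δ) :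
    ∃ Q : ℝ, 1 ≤ Q ∧ ∀ (C : ℝ) (h : X → ℝ), 0 ≤ C → LocalHolderBound ζ δ C h →
      HolderBound ζ (Q * C) h := by
  obtain ⟨k, hk⟩ := pow_unbounded_of_one_lt (d / δ) (one_lt_two (α := ℝ))
  refine ⟨2 ^ k, one_le_pow₀ one_le_two, fun C h hC hh x y => ?_⟩
  exact hh.double_iterate hX hζ hC k x y ((hd x y).trans_lt ((div_lt_iff₀ hδ).1 hk))

theorem rpow_sub_rpow_le_rpow {a b t : ℝ} (ha : 0 ≤ a) (hb : 0 ≤ b) (ht : 0 ≤ t) (hζ : 0 ≤ ζ)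
    (hζ1 : ζ ≤ 1) (hab : a ≤ b + t) : a ^ ζ - b ^ ζ ≤ t ^ ζ :=
  sub_le_iff_le_add'.2
    ((Real.rpow_le_rpow ha hab hζ).trans (Real.rpow_add_le_add_rpow hb ht hζ hζ1))

theorem holderBound_infDist_rpow (hζ : 0 ≤ ζ) (hζ1 : ζ ≤ 1) (S : Set X) :
    HolderBound ζ 1 fun x => Metric.infDist x S ^ ζ := fun x y => by
  have half (u v : X) : Metric.infDist u S ^ ζ - Metric.infDist v S ^ ζ ≤ dist u v ^ ζ :=
    rpow_sub_rpow_le_rpow Metric.infDist_nonneg Metric.infDist_nonneg dist_nonneg hζ hζ1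
      Metric.infDist_le_infDist_add_dist
  rw [one_mul, abs_sub_le_iff]
  exact ⟨half x y, dist_comm x y ▸ half y x⟩

theorem oscBound_infDist_rpow (hX : ∀ x y : X, dist x y ≤ 1) (hζ : 0 ≤ ζ) {S : Set X}
    (hS : S.Nonempty) : OscBound 1 fun x => Metric.infDist x S ^ ζ := fun x y => by
  obtain ⟨z, hz⟩ := hS
  calc Metric.infDist x S ^ ζ - Metric.infDist y S ^ ζ ≤ Metric.infDist x S ^ ζ :=
        sub_le_self _ (Real.rpow_nonneg Metric.infDist_nonneg _)
    _ ≤ 1 := Real.rpow_le_one Metric.infDist_nonneg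
        ((Metric.infDist_le_dist_of_mem hz).trans (hX x z)) hζ

/-- The intermediate point at distance `t` from `y` leaves a remainder of length at most
`(L - 1) t < δ`, so the local bound applies to both pieces. -/
theorem LocalHolderBound.abs_sub_le_of_dist_le_mul (hX : HasIntermediatePoints X) (hζ : 0 ≤ ζ)
    (hC : 0 ≤ C) (hh : LocalHolderBound ζ δ C h) {L t : ℝ} (hL1 : 1 ≤ L) (hL2 : L ≤ 2)
    (ht0 : 0 ≤ t) (ht : t < δ) {y y' : X} (hy : dist y y' ≤ L * t) :
    |h y - h y'| ≤ C * (1 + (L - 1) ^ ζ) * t ^ ζ := by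
  have hL0 : 0 < L := by linarith
  have hL' : 0 ≤ L - 1 := by linarith
  obtain ⟨z, hyz, hzy'⟩ := hX y y' (1 / L) (by positivity) ((div_le_one hL0).2 hL1)
  have hyz' : dist y z ≤ t := hyz.trans (by rwa [one_div, inv_mul_le_iff₀ hL0])
  have hzy'' : dist z y' ≤ (L - 1) * t := by
    calc dist z y' ≤ (1 - 1 / L) * dist y y' := hzy'
      _ ≤ (1 - 1 / L) * (L * t) :=
          mul_le_mul_of_nonneg_left hy (sub_nonneg.2 ((div_le_one hL0).2 hL1))
      _ = (L - 1) * t := by field_simp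
  calc |h y - h y'| ≤ |h y - h z| + |h z - h y'| := abs_sub_le _ _ _
    _ ≤ C * dist y z ^ ζ + C * dist z y' ^ ζ :=
        add_le_add (hh y z (by linarith)) (hh z y' (by nlinarith))
    _ ≤ C * t ^ ζ + C * ((L - 1) * t) ^ ζ := by gcongr
    _ = C * (1 + (L - 1) ^ ζ) * t ^ ζ := by rw [Real.mul_rpow hL' ht0]; ring

end HolderBounds

section MarkovWeights

variable {X : Type*} {f : X → X} {fib : X → Finset X} {p : X → ℝ}

/-- The transfer (Ruelle–Perron–Frobenius) operator with weight `p` of a map with finite fibres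
`fib`. -/
def transfer (fib : X → Finset X) (p : X → ℝ) : (X → ℝ) →ₗ[ℝ] (X → ℝ) where
  toFun h x := ∑ y ∈ fib x, p y * h y
  map_add' h k := by ext x; simp only [Pi.add_apply, mul_add, Finset.sum_add_distrib]
  map_smul' c h := by
    ext x
    simp only [Pi.smul_apply, smul_eq_mul, Finset.mul_sum, RingHom.id_apply, mul_left_comm]

theorem transfer_apply (fib : X → Finset X) (p h : X → ℝ) (x : X) :
    transfer fib p h x = ∑ y ∈ fib x, p y * h y := rfl

/-- `fib` lists the fibres of `f`. -/
def EnumeratesFibers (f : X → X) (fib : X → Finset X) : Prop := ∀ x y, y ∈ fib x ↔ f y = x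

/-- The weight `p` is a probability on each fibre, so that its transfer operator is the operator of
a Markov chain moving along backward orbits. -/
structure IsMarkovWeight (fib : X → Finset X) (p : X → ℝ) : Prop where
  nonneg : ∀ y, 0 ≤ p y
  sum_eq_one : ∀ x, ∑ y ∈ fib x, p y = 1

namespace IsMarkovWeight

theorem transfer_const (hp : IsMarkovWeight fib p) (a : ℝ) :
    transfer fib p (Function.const X a) = Function.const X a := by
  ext x
  simp only [transfer_apply, Function.const_apply, ← Finset.sum_mul, hp.sum_eq_one, one_mul]

theorem transfer_pow_const (hp : IsMarkovWeight fib p) (a : ℝ) (n : ℕ) :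
    (transfer fib p ^ n) (Function.const X a) = Function.const X a := by
  induction n with
  | zero => rfl
  | succ n ih => rw [pow_succ', Module.End.mul_apply, ih, hp.transfer_const]

theorem monotone_transfer (hp : IsMarkovWeight fib p) : Monotone (transfer fib p) :=
  fun _ _ hle _ => Finset.sum_le_sum fun y _ => mul_le_mul_of_nonneg_left (hle y) (hp.nonneg y)

theorem monotone_transfer_pow (hp : IsMarkovWeight fib p) (n : ℕ) :
    Monotone ⇑(transfer fib p ^ n) := by
  rw [Module.End.coe_pow]
  exact hp.monotone_transfer.iterate n

theorem transfer_pow_nonneg (hp : IsMarkovWeight fib p) {u : X → ℝ} (hu : 0 ≤ u) (n : ℕ) :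
    0 ≤ (transfer fib p ^ n) u := by
  simpa using hp.monotone_transfer_pow n hu

theorem exists_mem_le_transfer (hp : IsMarkovWeight fib p) (u : X → ℝ) (x : X) :
    ∃ y ∈ fib x, u y ≤ transfer fib p u x := by
  by_contra! hlt
  have hle : ∀ y ∈ fib x, p y * transfer fib p u x ≤ p y * u y := fun y hy =>
    mul_le_mul_of_nonneg_left (hlt y hy).le (hp.nonneg y)
  have heq := (Finset.sum_eq_sum_iff_of_le hle).1 <| by
    rw [← Finset.sum_mul, hp.sum_eq_one, one_mul, transfer_apply]
  have hzero : ∀ y ∈ fib x, p y = 0 := fun y hy =>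
    by_contra fun hpy => (hlt y hy).ne (mul_left_cancel₀ hpy (heq y hy))
  simpa [Finset.sum_eq_zero hzero] using hp.sum_eq_one x

theorem exists_iterate_eq_le_transfer_pow (hp : IsMarkovWeight fib p)
    (hfib : EnumeratesFibers f fib) (u : X → ℝ) (n : ℕ) (x : X) :
    ∃ y, f^[n] y = x ∧ u y ≤ (transfer fib p ^ n) u x := by
  induction n generalizing x with
  | zero => exact ⟨_, rfl, le_rfl⟩
  | succ n ih =>
    obtain ⟨z, hz, hzx⟩ := hp.exists_mem_le_transfer ((transfer fib p ^ n) u) x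
    obtain ⟨y, rfl, hy⟩ := ih z
    refine ⟨y, ?_, ?_⟩
    · rw [Function.iterate_succ_apply', (hfib _ _).1 hz]
    · rw [pow_succ', Module.End.mul_apply]
      exact hy.trans hzx

theorem pow_mul_le_transfer_pow (hp : IsMarkovWeight fib p) (hfib : EnumeratesFibers f fib)
    {β : ℝ} (hβ : 0 ≤ β) (hβp : ∀ y, β ≤ p y) {u : X → ℝ} (hu : 0 ≤ u) (n : ℕ) (y : X) :
    β ^ n * u y ≤ (transfer fib p ^ n) u (f^[n] y) := by
  induction n with
  | zero => simp
  | succ n ih =>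
    rw [Function.iterate_succ_apply', pow_succ' (transfer fib p), Module.End.mul_apply]
    have hmem : f^[n] y ∈ fib (f (f^[n] y)) := (hfib _ _).2 rfl
    calc β ^ (n + 1) * u y = β * (β ^ n * u y) := by ring
      _ ≤ p (f^[n] y) * (transfer fib p ^ n) u (f^[n] y) :=
          mul_le_mul (hβp _) ih (mul_nonneg (pow_nonneg hβ n) (hu y)) (hp.nonneg _)
      _ ≤ transfer fib p ((transfer fib p ^ n) u) (f (f^[n] y)) :=
          Finset.single_le_sum (f := fun z => p z * (transfer fib p ^ n) u z)
            (fun z _ => mul_nonneg (hp.nonneg z) (hp.transfer_pow_nonneg hu n z)) hmem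

theorem oscBound_transfer (hp : IsMarkovWeight fib p) {h : X → ℝ} {s : ℝ} (hs : OscBound s h) :
    OscBound s (transfer fib p h) := by
  intro x x'
  have upper (y' : X) : transfer fib p h x ≤ h y' + s := by
    simpa [hp.transfer_const] using hp.monotone_transfer
      (show h ≤ Function.const X (h y' + s) from fun y => by
        simp only [Function.const_apply]; linarith [hs y y']) x
  have lower : transfer fib p h x - s ≤ transfer fib p h x' := by
    simpa [hp.transfer_const] using hp.monotone_transfer
      (show Function.const X (transfer fib p h x - s) ≤ h from fun y' => by
        simp only [Function.const_apply]; linarith [upper y']) x'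
  linarith

theorem oscBound_transfer_pow (hp : IsMarkovWeight fib p) {h : X → ℝ} {s : ℝ}
    (hs : OscBound s h) (n : ℕ) : OscBound s ((transfer fib p ^ n) h) := by
  induction n with
  | zero => exact hs
  | succ n ih =>
    rw [pow_succ', Module.End.mul_apply]
    exact hp.oscBound_transfer ih

/-- Doeblin's argument: the mass `β ^ k` carried by one backward orbit from each of two points
contributes only `ε` to the difference. -/
theorem oscBound_transfer_pow_of_preimages (hp : IsMarkovWeight fib p)
    (hfib : EnumeratesFibers f fib) {β : ℝ} (hβ : 0 ≤ β) (hβp : ∀ y, β ≤ p y) {g : X → ℝ}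
    {s ε : ℝ} (hs : OscBound s g) (k : ℕ)
    (hk : ∀ x x', ∃ y y', f^[k] y = x ∧ f^[k] y' = x' ∧ g y - g y' ≤ ε) :
    OscBound ((1 - β ^ k) * s + β ^ k * ε) ((transfer fib p ^ k) g) := by
  intro x x'
  obtain ⟨y, y', rfl, rfl, hε⟩ := hk x x'
  have hbdd : BddAbove (Set.range g) := ⟨g y + s, by rintro _ ⟨z, rfl⟩; linarith [hs z y]⟩
  set S := ⨆ z, g z
  have hle : 0 ≤ Function.const X S - g := fun z => sub_nonneg.2 (le_ciSup hbdd z)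
  have hge : 0 ≤ g - Function.const X (S - s) := fun z => sub_nonneg.2 <| by
    have : Nonempty X := ⟨y⟩
    have : S ≤ g z + s := ciSup_le fun w => by linarith [hs w z]
    simp only [Function.const_apply]
    linarith
  have hy := hp.pow_mul_le_transfer_pow hfib hβ hβp hle k y
  have hy' := hp.pow_mul_le_transfer_pow hfib hβ hβp hge k y'
  simp only [map_sub, hp.transfer_pow_const, Pi.sub_apply, Function.const_apply] at hy hy'
  have hβε : β ^ k * (g y - g y') ≤ β ^ k * ε := mul_le_mul_of_nonneg_left hε (pow_nonneg hβ k)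
  linarith

end IsMarkovWeight

theorem transfer_pow_eq_zero (hfib : EnumeratesFibers f fib) {u : X → ℝ} (n : ℕ) (x : X)
    (hu : ∀ y, f^[n] y = x → u y = 0) : (transfer fib p ^ n) u x = 0 := by
  induction n generalizing x with
  | zero => exact hu x rfl
  | succ n ih =>
    rw [pow_succ', Module.End.mul_apply, transfer_apply]
    refine Finset.sum_eq_zero fun z hz => ?_
    rw [ih z fun y hy => hu y ?_, mul_zero]
    rw [Function.iterate_succ_apply', hy, (hfib _ _).1 hz]

/-- Matching the fibres over `x` and `x'` by `e` separates the variation of `h` along matched points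
from that of the weight; the constant `a` is free because both weights have total mass one. -/
theorem transfer_sub_transfer_eq (hp : IsMarkovWeight fib p) {x x' : X} {e : X → X}
    (he : Set.BijOn e (fib x) (fib x')) (h : X → ℝ) (a : ℝ) :
    transfer fib p h x - transfer fib p h x' =
      ∑ y ∈ fib x, p y * (h y - h (e y)) + ∑ y ∈ fib x, (p y - p (e y)) * (h (e y) - a) := by
  have reindex (u : X → ℝ) : ∑ y ∈ fib x, u (e y) = ∑ y ∈ fib x', u y :=
    Finset.sum_nbij e he.mapsTo he.injOn he.surjOn fun _ _ => rfl
  have hmass : ∑ y ∈ fib x, (p y - p (e y)) * a = 0 := by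
    rw [← Finset.sum_mul, Finset.sum_sub_distrib, reindex, hp.sum_eq_one, hp.sum_eq_one, sub_self,
      zero_mul]
  calc transfer fib p h x - transfer fib p h x'
      = ∑ y ∈ fib x, (p y * h y - p (e y) * h (e y)) := by
        rw [Finset.sum_sub_distrib, reindex fun y => p y * h y, transfer_apply, transfer_apply]
    _ = ∑ y ∈ fib x, (p y * (h y - h (e y)) + (p y - p (e y)) * (h (e y) - a)
          + (p y - p (e y)) * a) := Finset.sum_congr rfl fun y _ => by ring
    _ = _ := by rw [Finset.sum_add_distrib, Finset.sum_add_distrib, hmass, add_zero]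

end MarkovWeights

section LasotaYorke

variable {M : Type*} [MetricSpace M] {f : M → M} {fib : M → Finset M} {A : Set M} {D q : ℕ}
  {L τ δ ζ : ℝ} {p : M → ℝ} {c β B : ℝ}

/-- The inverse branches of a map `f` with fibres `fib`, at scale `δ`: nearby fibres are matched so
that matched points are at most `L` times as far from each other as the base points, and at most `τ`
times if the first one is outside the region `A`, which holds at most `q` of the `D` points. -/
structure Branches (f : M → M) (fib : M → Finset M) (A : Set M) (D q : ℕ) (L τ δ : ℝ) : Prop where
  enumeratesFibers : EnumeratesFibers f fib
  card_fib : ∀ x, (fib x).card = D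
  card_region : ∀ x, ∀ t ⊆ fib x, (∀ y ∈ t, y ∈ A) → t.card ≤ q
  q_le : q ≤ D
  D_pos : 0 < D
  one_le_L : 1 ≤ L
  L_le_two : L ≤ 2
  tau_pos : 0 < τ
  tau_le_one : τ ≤ 1
  delta_pos : 0 < δ
  pairing : ∀ x x', dist x x' < δ → ∃ e : M → M, Set.BijOn e (fib x) (fib x') ∧
    ∀ y ∈ fib x, dist y (e y) ≤ L * dist x x' ∧ (y ∉ A → dist y (e y) ≤ τ * dist x x')

/-- Markov weights with values in `[β, c]` that vary in a Hölder way along matched points. -/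
structure BranchWeight (fib : M → Finset M) (L δ ζ : ℝ) (p : M → ℝ) (c β B : ℝ) : Prop
    extends IsMarkovWeight fib p where
  beta_pos : 0 < β
  beta_le : ∀ y, β ≤ p y
  le_c : ∀ y, p y ≤ c
  B_nonneg : 0 ≤ B
  variation : ∀ x x', dist x x' < δ → ∀ y ∈ fib x, ∀ y' ∈ fib x', dist y y' ≤ L * dist x x' →
    |p y - p y'| ≤ B * dist x x' ^ ζ

open Classical in
/-- The factor by which the local `ζ`-Hölder constant is multiplied along the inverse branch ending
at `y`. -/
def branchFactor (A : Set M) (L τ ζ : ℝ) (y : M) : ℝ :=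
  if y ∈ A then L ^ ζ * (1 + (L - 1) ^ ζ) else τ ^ ζ

/-- The contraction rate of the branches: `D - q` good branches and `q` bad ones. -/
def branchRate (D q : ℕ) (L τ ζ : ℝ) : ℝ :=
  ((D : ℝ) - q) * τ ^ ζ + q * (L ^ ζ * (1 + (L - 1) ^ ζ))

namespace Branches

theorem branchRate_nonneg (hb : Branches f fib A D q L τ δ) : 0 ≤ branchRate D q L τ ζ := by
  have hq : 0 ≤ (D : ℝ) - q := sub_nonneg.2 (Nat.cast_le.2 hb.q_le)
  have hL : 0 ≤ L - 1 := sub_nonneg.2 hb.one_le_L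
  have hL0 : 0 ≤ L := by linarith
  have hτ := hb.tau_pos
  unfold branchRate
  positivity

theorem sum_branchFactor_le (hb : Branches f fib A D q L τ δ) (hζ : 0 ≤ ζ) (x : M) :
    ∑ y ∈ fib x, branchFactor A L τ ζ y ≤ branchRate D q L τ ζ := by
  classical
  set a := τ ^ ζ
  set b := L ^ ζ * (1 + (L - 1) ^ ζ)
  have hab : a ≤ b := calc
    a ≤ 1 := Real.rpow_le_one hb.tau_pos.le hb.tau_le_one hζ
    _ ≤ L ^ ζ := Real.one_le_rpow hb.one_le_L hζ
    _ ≤ b := le_mul_of_one_le_right (Real.rpow_nonneg (by linarith [hb.one_le_L]) _)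
      (le_add_of_nonneg_right (Real.rpow_nonneg (sub_nonneg.2 hb.one_le_L) _))
  have hcard : (((fib x).filter (· ∈ A)).card : ℝ) ≤ q :=
    Nat.cast_le.2 <| hb.card_region x _ (Finset.filter_subset _ _)
      fun y hy => (Finset.mem_filter.1 hy).2
  calc ∑ y ∈ fib x, branchFactor A L τ ζ y
      = ∑ y ∈ fib x, (a + if y ∈ A then b - a else 0) :=
        Finset.sum_congr rfl fun y _ => by unfold branchFactor; split_ifs <;> ring
    _ = D * a + ((fib x).filter (· ∈ A)).card * (b - a) := by
        rw [Finset.sum_add_distrib, Finset.sum_const, ← Finset.sum_filter, Finset.sum_const,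
          hb.card_fib, nsmul_eq_mul, nsmul_eq_mul]
    _ ≤ D * a + q * (b - a) := by gcongr
    _ = branchRate D q L τ ζ := by unfold branchRate; ring

theorem abs_sub_le_branchFactor (hb : Branches f fib A D q L τ δ) (hM : HasIntermediatePoints M)
    (hζ : 0 ≤ ζ) {C : ℝ} (hC : 0 ≤ C) {h : M → ℝ} (hh : LocalHolderBound ζ δ C h) {t : ℝ}
    (ht0 : 0 ≤ t) (ht : t < δ) {y y' : M} (hL : dist y y' ≤ L * t)
    (hτ : y ∉ A → dist y y' ≤ τ * t) :
    |h y - h y'| ≤ C * branchFactor A L τ ζ y * t ^ ζ := by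
  have hL1 := hb.one_le_L
  have hL0 : 0 ≤ 1 + (L - 1) ^ ζ :=
    add_nonneg zero_le_one (Real.rpow_nonneg (sub_nonneg.2 hL1) ζ)
  unfold branchFactor
  split_ifs with hy
  · calc |h y - h y'| ≤ C * (1 + (L - 1) ^ ζ) * t ^ ζ :=
          hh.abs_sub_le_of_dist_le_mul hM hζ hC hL1 hb.L_le_two ht0 ht hL
      _ ≤ C * (L ^ ζ * (1 + (L - 1) ^ ζ)) * t ^ ζ := by
          gcongr
          exact le_mul_of_one_le_left hL0 (Real.one_le_rpow hL1 hζ)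
  · have hyy' := hτ hy
    have hδ : dist y y' < δ :=
      (hyy'.trans (mul_le_of_le_one_left ht0 hb.tau_le_one)).trans_lt ht
    calc |h y - h y'| ≤ C * dist y y' ^ ζ := hh y y' hδ
      _ ≤ C * (τ * t) ^ ζ := by gcongr
      _ = C * τ ^ ζ * t ^ ζ := by rw [Real.mul_rpow hb.tau_pos.le ht0, mul_assoc]

theorem branchWeight_uniform (hb : Branches f fib A D q L τ δ) :
    BranchWeight fib L δ ζ (fun _ => 1 / (D : ℝ)) (1 / D) (1 / D) 0 where
  nonneg _ := by positivity
  sum_eq_one x := by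
    rw [Finset.sum_const, hb.card_fib, nsmul_eq_mul,
      mul_one_div_cancel (Nat.cast_ne_zero.2 hb.D_pos.ne')]
  beta_pos := one_div_pos.2 (Nat.cast_pos.2 hb.D_pos)
  beta_le _ := le_rfl
  le_c _ := le_rfl
  B_nonneg := le_rfl
  variation := by simp

end Branches

namespace BranchWeight

theorem c_nonneg [Nonempty M] (hp : BranchWeight fib L δ ζ p c β B) : 0 ≤ c := by
  inhabit M
  exact (hp.nonneg default).trans (hp.le_c default)

theorem beta_le_one [Nonempty M] (hp : BranchWeight fib L δ ζ p c β B) : β ≤ 1 := by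
  inhabit M
  obtain ⟨y, hy, -⟩ := hp.exists_mem_le_transfer 0 default
  calc β ≤ p y := hp.beta_le y
    _ ≤ ∑ z ∈ fib default, p z := Finset.single_le_sum (fun z _ => hp.nonneg z) hy
    _ = 1 := hp.sum_eq_one _

theorem localHolderBound_transfer (hp : BranchWeight fib L δ ζ p c β B)
    (hb : Branches f fib A D q L τ δ) (hM : HasIntermediatePoints M) (hζ : 0 ≤ ζ) {C s : ℝ}
    (hC : 0 ≤ C) {h : M → ℝ} (hh : LocalHolderBound ζ δ C h) (hs : OscBound s h) :
    LocalHolderBound ζ δ (c * branchRate D q L τ ζ * C + D * B * s) (transfer fib p h) := by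
  intro x x' hxx'
  have : Nonempty M := ⟨x⟩
  have hc := hp.c_nonneg
  have hB := hp.B_nonneg
  obtain ⟨e, he, hdist⟩ := hb.pairing x x' hxx'
  set t := dist x x'
  have ht : 0 ≤ t ^ ζ := Real.rpow_nonneg dist_nonneg ζ
  have hvar_h : |∑ y ∈ fib x, p y * (h y - h (e y))| ≤ c * branchRate D q L τ ζ * C * t ^ ζ := by
    calc |∑ y ∈ fib x, p y * (h y - h (e y))|
        ≤ ∑ y ∈ fib x, |p y * (h y - h (e y))| := Finset.abs_sum_le_sum_abs _ _
      _ ≤ ∑ y ∈ fib x, c * (C * branchFactor A L τ ζ y * t ^ ζ) := by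
          refine Finset.sum_le_sum fun y hy => ?_
          rw [abs_mul, abs_of_nonneg (hp.nonneg y)]
          exact mul_le_mul (hp.le_c y) (hb.abs_sub_le_branchFactor hM hζ hC hh dist_nonneg hxx'
            (hdist y hy).1 (hdist y hy).2) (abs_nonneg _) hc
      _ = c * C * t ^ ζ * ∑ y ∈ fib x, branchFactor A L τ ζ y := by
          rw [Finset.mul_sum]
          exact Finset.sum_congr rfl fun y _ => by ring
      _ ≤ c * C * t ^ ζ * branchRate D q L τ ζ := by
          gcongr
          exact hb.sum_branchFactor_le hζ x
      _ = c * branchRate D q L τ ζ * C * t ^ ζ := by ring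
  have hvar_p : |∑ y ∈ fib x, (p y - p (e y)) * (h (e y) - h x)| ≤ D * B * s * t ^ ζ := by
    calc |∑ y ∈ fib x, (p y - p (e y)) * (h (e y) - h x)|
        ≤ ∑ y ∈ fib x, |(p y - p (e y)) * (h (e y) - h x)| := Finset.abs_sum_le_sum_abs _ _
      _ ≤ ∑ _y ∈ fib x, B * t ^ ζ * s := by
          refine Finset.sum_le_sum fun y hy => ?_
          rw [abs_mul]
          exact mul_le_mul (hp.variation x x' hxx' y hy (e y) (he.mapsTo hy) (hdist y hy).1)
            (hs.abs_sub_le _ _) (abs_nonneg _) (mul_nonneg hB ht)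
      _ = D * B * s * t ^ ζ := by
          rw [Finset.sum_const, hb.card_fib, nsmul_eq_mul]
          ring
  rw [transfer_sub_transfer_eq hp.toIsMarkovWeight he h (h x), add_mul]
  exact (abs_add_le _ _).trans (add_le_add hvar_h hvar_p)

theorem localHolderBound_transfer_pow [Nonempty M] (hp : BranchWeight fib L δ ζ p c β B)
    (hb : Branches f fib A D q L τ δ) (hM : HasIntermediatePoints M) (hζ : 0 ≤ ζ) {θ : ℝ}
    (hθ : c * branchRate D q L τ ζ = θ) (hθ1 : θ < 1) {C s : ℝ} (hC : 0 ≤ C) {h : M → ℝ}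
    (hh : LocalHolderBound ζ δ C h) (hs : OscBound s h) (n : ℕ) :
    LocalHolderBound ζ δ (θ ^ n * C + D * B / (1 - θ) * s) ((transfer fib p ^ n) h) := by
  have hθ0 : 0 ≤ θ := hθ ▸ mul_nonneg hp.c_nonneg hb.branchRate_nonneg
  have hθ' : 0 < 1 - θ := sub_pos.2 hθ1
  have hB := hp.B_nonneg
  have hs0 := hs.nonneg
  induction n with
  | zero => exact hh.mono (by rw [pow_zero, one_mul, le_add_iff_nonneg_right]; positivity)
  | succ n ih =>
    rw [pow_succ' (transfer fib p), Module.End.mul_apply]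
    refine (hp.localHolderBound_transfer hb hM hζ (by positivity) ih
      (hp.oscBound_transfer_pow hs n)).mono (le_of_eq ?_)
    rw [hθ]
    field_simp
    ring

end BranchWeight

end LasotaYorke

section Decay

variable {M : Type*} [MetricSpace M] [Nonempty M] {f : M → M} {fib : M → Finset M} {A : Set M}
  {D q : ℕ} {L τ δ ζ : ℝ} {p : M → ℝ} {c β B : ℝ}

/-- The uniform Markov weight contracts the Hölder constant of the distance to `f^{-k}(x')`; its
transfer vanishes at `x'`, hence is small at `x`, and some preimage of `x` does at least as well as
the average. -/
theorem Branches.exists_close_preimages (hb : Branches f fib A D q L τ δ)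
    (hM : HasIntermediatePoints M) (hdiam : ∀ x y : M, dist x y ≤ 1) (hζ : 0 < ζ) (hζ1 : ζ ≤ 1)
    (hθ1 : 1 / (D : ℝ) * branchRate D q L τ ζ < 1) {r : ℝ} (hr : 0 < r) :
    ∃ k, ∀ x x', ∃ y y', f^[k] y = x ∧ f^[k] y' = x' ∧ dist y y' < r := by
  have hfib := hb.enumeratesFibers
  obtain ⟨Q, hQ1, hQ⟩ := exists_holderBound_of_localHolderBound hM hdiam hζ.le hb.delta_pos
  obtain ⟨p, hp⟩ : ∃ p, BranchWeight fib L δ ζ p (1 / D) (1 / D) 0 := ⟨_, hb.branchWeight_uniform⟩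
  obtain ⟨θ, hθ⟩ : ∃ θ, 1 / (D : ℝ) * branchRate D q L τ ζ = θ := ⟨_, rfl⟩
  have hθ0 : 0 ≤ θ := hθ ▸ mul_nonneg hp.c_nonneg hb.branchRate_nonneg
  rw [hθ] at hθ1
  obtain ⟨k, hk⟩ := exists_pow_lt_of_lt_one
    (div_pos (Real.rpow_pos_of_pos hr ζ) (one_pos.trans_le hQ1)) hθ1
  refine ⟨k, fun x x' => ?_⟩
  set Y : Set M := {y | f^[k] y = x'}
  obtain ⟨y₀, hy₀, -⟩ := hp.exists_iterate_eq_le_transfer_pow hfib 0 k x'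
  have hY : Y.Nonempty := ⟨y₀, hy₀⟩
  set h : M → ℝ := fun z => Metric.infDist z Y ^ ζ
  have hosc : OscBound 1 h := oscBound_infDist_rpow hdiam hζ.le hY
  have hloc : LocalHolderBound ζ δ 1 h := (holderBound_infDist_rpow hζ.le hζ1 Y).local
  have hT : LocalHolderBound ζ δ (θ ^ k) ((transfer fib p ^ k) h) := by
    have hLY := hp.localHolderBound_transfer_pow hb hM hζ.le hθ hθ1 zero_le_one hloc hosc k
    rwa [mul_one, mul_zero, zero_div, zero_mul, add_zero] at hLY
  have hzero : (transfer fib p ^ k) h x' = 0 :=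
    transfer_pow_eq_zero hfib k x' fun y hy => by
      have hyY : Metric.infDist y Y = 0 := Metric.infDist_zero_of_mem hy
      rw [show h y = Metric.infDist y Y ^ ζ from rfl, hyY, Real.zero_rpow hζ.ne']
  obtain ⟨y, hy, hyT⟩ := hp.exists_iterate_eq_le_transfer_pow hfib h k x
  have hlt : Metric.infDist y Y ^ ζ < r ^ ζ := by
    calc h y ≤ (transfer fib p ^ k) h x - (transfer fib p ^ k) h x' := by rwa [hzero, sub_zero]
      _ ≤ Q * θ ^ k * dist x x' ^ ζ := (le_abs_self _).trans (hQ _ _ (by positivity) hT x x')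
      _ ≤ Q * θ ^ k * 1 := by
          gcongr
          exact Real.rpow_le_one dist_nonneg (hdiam _ _) hζ.le
      _ < r ^ ζ := by rwa [mul_one, ← lt_div_iff₀' (one_pos.trans_le hQ1)]
  obtain ⟨y', hy', hyy'⟩ := (Metric.infDist_lt_iff hY).1 ((Real.rpow_lt_rpow_iff
    Metric.infDist_nonneg hr.le hζ).1 hlt)
  exact ⟨y, y', hy, hy', hyy'⟩

/-- A bound by `a` on the mixed norm `C + W s` of a function with local Hölder constant `C` and
oscillation `s`. The transfer operator contracts it once `W` is large. -/
def MixedBound (ζ δ W a : ℝ) (h : M → ℝ) : Prop :=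
  ∃ C s, 0 ≤ C ∧ C + W * s ≤ a ∧ LocalHolderBound ζ δ C h ∧ OscBound s h

theorem exists_pos_mul_rpow_le (b : ℝ) {ε : ℝ} (hε : 0 < ε) (hζ : 0 < ζ) (hδ : 0 < δ) :
    ∃ r, 0 < r ∧ r ≤ δ ∧ b * r ^ ζ ≤ ε := by
  have hlim : Filter.Tendsto (fun r : ℝ => b * r ^ ζ) (nhdsWithin 0 (Set.Ioi 0)) (nhds 0) := by
    have := ((Real.continuousAt_rpow_const 0 ζ (Or.inr hζ.le)).tendsto.mono_left
      (nhdsWithin_le_nhds (s := Set.Ioi 0))).const_mul b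
    rwa [Real.zero_rpow hζ.ne', mul_zero] at this
  obtain ⟨r, hr, hrδ⟩ := ((hlim.eventually (eventually_le_nhds hε)).and
    (Ioc_mem_nhdsGT hδ)).exists
  exact ⟨r, hrδ.1, hrδ.2, hr⟩

namespace BranchWeight

theorem exists_oscBound_transfer_pow_le (hp : BranchWeight fib L δ ζ p c β B)
    (hb : Branches f fib A D q L τ δ) (hM : HasIntermediatePoints M)
    (hdiam : ∀ x y : M, dist x y ≤ 1) (hζ : 0 < ζ) (hζ1 : ζ ≤ 1)
    (hu : 1 / (D : ℝ) * branchRate D q L τ ζ < 1) {b : ℝ} (hb0 : 0 ≤ b) :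
    ∃ (k : ℕ) (a : ℝ), 0 < a ∧ a ≤ 1 ∧ ∀ (C s : ℝ) (h : M → ℝ), 0 ≤ C →
      LocalHolderBound ζ δ (C + b * s) h → OscBound s h →
        OscBound ((1 - a / 2) * s + C) ((transfer fib p ^ k) h) := by
  obtain ⟨r, hr0, hrδ, hrb⟩ := exists_pos_mul_rpow_le b one_half_pos hζ
    (lt_min hb.delta_pos one_pos)
  obtain ⟨k, hk⟩ := hb.exists_close_preimages hM hdiam hζ hζ1 hu hr0
  have hβk : β ^ k ≤ 1 := pow_le_one₀ hp.beta_pos.le hp.beta_le_one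
  refine ⟨k, β ^ k, pow_pos hp.beta_pos k, hβk, fun C s h hC hh hs => ?_⟩
  have hs0 := hs.nonneg
  have hclose (x x') : ∃ y y', f^[k] y = x ∧ f^[k] y' = x' ∧ h y - h y' ≤ C + s / 2 := by
    obtain ⟨y, y', hy, hy', hyy'⟩ := hk x x'
    have hr1 : r ^ ζ ≤ 1 := Real.rpow_le_one hr0.le (hrδ.trans (min_le_right _ _)) hζ.le
    refine ⟨y, y', hy, hy', ?_⟩
    calc h y - h y' ≤ |h y - h y'| := le_abs_self _
      _ ≤ (C + b * s) * dist y y' ^ ζ := hh y y' (hyy'.trans_le (hrδ.trans (min_le_left _ _)))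
      _ ≤ (C + b * s) * r ^ ζ := by gcongr
      _ = C * r ^ ζ + b * r ^ ζ * s := by ring
      _ ≤ C * 1 + 1 / 2 * s := by gcongr
      _ = C + s / 2 := by ring
  refine (hp.oscBound_transfer_pow_of_preimages hb.enumeratesFibers hp.beta_pos.le hp.beta_le hs k
    hclose).mono ?_
  linarith [mul_le_of_le_one_left hC hβk]

theorem exists_mixedBound_transfer_pow (hp : BranchWeight fib L δ ζ p c β B)
    (hb : Branches f fib A D q L τ δ) (hM : HasIntermediatePoints M)
    (hdiam : ∀ x y : M, dist x y ≤ 1) (hζ : 0 < ζ) (hζ1 : ζ ≤ 1)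
    (hu : 1 / (D : ℝ) * branchRate D q L τ ζ < 1) {θ : ℝ} (hθ : c * branchRate D q L τ ζ = θ)
    (hθ1 : θ < 1) :
    ∃ (m : ℕ) (κ W : ℝ), 0 < m ∧ 0 < κ ∧ κ < 1 ∧ 1 ≤ W ∧ ∀ (a : ℝ) (h : M → ℝ),
      MixedBound ζ δ W a h → MixedBound ζ δ W (κ * a) ((transfer fib p ^ m) h) := by
  have hθ0 : 0 ≤ θ := hθ ▸ mul_nonneg hp.c_nonneg hb.branchRate_nonneg
  set b := D * B / (1 - θ)
  have hb0 : 0 ≤ b := div_nonneg (mul_nonneg (Nat.cast_nonneg D) hp.B_nonneg) (sub_nonneg.2 hθ1.le)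
  obtain ⟨k, a, ha0, ha1, hosc⟩ := hp.exists_oscBound_transfer_pow_le hb hM hdiam hζ hζ1 hu hb0
  set W := 4 * b / a + 1 with hW
  have hW1 : 1 ≤ W := le_add_of_nonneg_left (by positivity)
  have hWb : b ≤ W * (a / 4) := by
    rw [hW]
    field_simp
    linarith
  obtain ⟨n, hn⟩ := exists_pow_lt_of_lt_one (show 0 < 1 / (2 * (1 + W)) by positivity) hθ1
  have hθn : θ ^ (n + 1) * (1 + W) ≤ 1 / 2 := by
    rw [lt_div_iff₀ (by positivity)] at hn
    have : θ ^ (n + 1) ≤ θ ^ n := pow_le_pow_of_le_one hθ0 hθ1.le n.le_succ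
    nlinarith
  refine ⟨k + (n + 1), 1 - a / 4, W, by omega, by linarith, by linarith, hW1, ?_⟩
  rintro w h ⟨C, s, hC, hCs, hh, hs⟩
  have hs0 := hs.nonneg
  have hholder := hp.localHolderBound_transfer_pow hb hM hζ.le hθ hθ1 hC hh hs
  have hθk : θ ^ (k + (n + 1)) ≤ θ ^ (n + 1) := pow_le_pow_of_le_one hθ0 hθ1.le (by omega)
  have hosc' : OscBound ((1 - a / 2) * s + θ ^ (n + 1) * C)
      ((transfer fib p ^ (k + (n + 1))) h) := by
    rw [pow_add (transfer fib p), Module.End.mul_apply]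
    exact hosc _ s _ (by positivity) (hholder (n + 1)) (hp.oscBound_transfer_pow hs _)
  refine ⟨_, _, by positivity, ?_, hholder (k + (n + 1)), hosc'⟩
  calc θ ^ (k + (n + 1)) * C + b * s + W * ((1 - a / 2) * s + θ ^ (n + 1) * C)
      ≤ θ ^ (n + 1) * C + W * (a / 4) * s + W * ((1 - a / 2) * s + θ ^ (n + 1) * C) := by gcongr
    _ = θ ^ (n + 1) * (1 + W) * C + (1 - a / 4) * (W * s) := by ring
    _ ≤ (1 - a / 4) * C + (1 - a / 4) * (W * s) := by gcongr; linarith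
    _ ≤ (1 - a / 4) * w := by
        rw [← mul_add]
        exact mul_le_mul_of_nonneg_left hCs (by linarith)

theorem mixedBound_transfer_pow (hp : BranchWeight fib L δ ζ p c β B)
    (hb : Branches f fib A D q L τ δ) (hM : HasIntermediatePoints M) (hζ : 0 ≤ ζ) {θ : ℝ}
    (hθ : c * branchRate D q L τ ζ = θ) (hθ1 : θ < 1) {W a : ℝ} (hW : 1 ≤ W) {h : M → ℝ}
    (hh : MixedBound ζ δ W a h) (n : ℕ) :
    MixedBound ζ δ W ((1 + D * B / (1 - θ)) * a) ((transfer fib p ^ n) h) := by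
  obtain ⟨C, s, hC, hCs, hloc, hs⟩ := hh
  have hθ0 : 0 ≤ θ := hθ ▸ mul_nonneg hp.c_nonneg hb.branchRate_nonneg
  set b := D * B / (1 - θ)
  have hb0 : 0 ≤ b := div_nonneg (mul_nonneg (Nat.cast_nonneg D) hp.B_nonneg) (sub_nonneg.2 hθ1.le)
  have hs0 := hs.nonneg
  refine ⟨_, s, by positivity, ?_, hp.localHolderBound_transfer_pow hb hM hζ hθ hθ1 hC hloc hs n,
    hp.oscBound_transfer_pow hs n⟩
  calc θ ^ n * C + b * s + W * s ≤ 1 * C + b * (C + W * s) + W * s := by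
        gcongr
        · exact pow_le_one₀ hθ0 hθ1.le
        · nlinarith
    _ = (1 + b) * (C + W * s) := by ring
    _ ≤ (1 + b) * a := by gcongr

end BranchWeight

theorem exists_pow_div_le_mul_pow {κ : ℝ} (hκ0 : 0 < κ) (hκ1 : κ < 1) {m : ℕ} (hm : 0 < m) :
    ∃ κ', 0 < κ' ∧ κ' < 1 ∧ ∀ n, κ ^ (n / m) ≤ κ⁻¹ * κ' ^ n := by
  set κ' := κ ^ (m : ℝ)⁻¹
  have hκ'0 : 0 < κ' := Real.rpow_pos_of_pos hκ0 _
  have hκ'1 : κ' < 1 := Real.rpow_lt_one hκ0.le hκ1 (by positivity)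
  have hκ'm : κ' ^ m = κ := Real.rpow_inv_natCast_pow hκ0.le hm.ne'
  refine ⟨κ', hκ'0, hκ'1, fun n => ?_⟩
  have hmod : κ ≤ κ' ^ (n % m) :=
    hκ'm ▸ pow_le_pow_of_le_one hκ'0.le hκ'1.le (Nat.mod_lt n hm).le
  rw [le_inv_mul_iff₀ hκ0]
  calc κ * κ ^ (n / m) ≤ κ' ^ (n % m) * κ ^ (n / m) := by gcongr
    _ = κ' ^ n := by rw [← hκ'm, ← pow_mul, ← pow_add, Nat.mod_add_div]

theorem BranchWeight.exists_transfer_decay (hp : BranchWeight fib L δ ζ p c β B)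
    (hb : Branches f fib A D q L τ δ) (hM : HasIntermediatePoints M)
    (hdiam : ∀ x y : M, dist x y ≤ 1) (hζ : 0 < ζ) (hζ1 : ζ ≤ 1)
    (hu : 1 / (D : ℝ) * branchRate D q L τ ζ < 1) (hθ1 : c * branchRate D q L τ ζ < 1) :
    ∃ κ V : ℝ, 0 < κ ∧ κ < 1 ∧ 0 < V ∧ ∀ (C : ℝ) (h : M → ℝ), 0 ≤ C → HolderBound ζ C h →
      OscBound C h → ∀ n, HolderBound ζ (V * κ ^ n * C) ((transfer fib p ^ n) h) ∧
        OscBound (V * κ ^ n * C) ((transfer fib p ^ n) h) := by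
  obtain ⟨m, κ, W, hm, hκ0, hκ1, hW, hstep⟩ :=
    hp.exists_mixedBound_transfer_pow hb hM hdiam hζ hζ1 hu rfl hθ1
  obtain ⟨Q, hQ1, hQ⟩ := exists_holderBound_of_localHolderBound hM hdiam hζ.le hb.delta_pos
  obtain ⟨κ', hκ'0, hκ'1, hκ'⟩ := exists_pow_div_le_mul_pow hκ0 hκ1 hm
  set b := 1 + D * B / (1 - c * branchRate D q L τ ζ)
  have hb0 : 0 < b := add_pos_of_pos_of_nonneg one_pos
    (div_nonneg (mul_nonneg (Nat.cast_nonneg D) hp.B_nonneg) (sub_nonneg.2 hθ1.le))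
  refine ⟨κ', Q * b * (1 + W) * κ⁻¹, hκ'0, hκ'1, by positivity, fun C h hC hh hs n => ?_⟩
  have hmultiples (j : ℕ) :
      MixedBound ζ δ W (κ ^ j * (C + W * C)) ((transfer fib p ^ (m * j)) h) := by
    induction j with
    | zero => simpa using ⟨C, C, hC, le_rfl, hh.local, hs⟩
    | succ j ih =>
      rw [mul_add_one, add_comm (m * j), pow_add (transfer fib p), Module.End.mul_apply, pow_succ',
        mul_assoc]
      exact hstep _ _ ih
  have hall : MixedBound ζ δ W (b * (κ ^ (n / m) * (C + W * C))) ((transfer fib p ^ n) h) := by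
    rw [← Nat.mod_add_div n m, pow_add (transfer fib p), Module.End.mul_apply, Nat.mod_add_div]
    exact hp.mixedBound_transfer_pow hb hM hζ.le rfl hθ1 hW (hmultiples _) _
  obtain ⟨C', s', hC', hCs', hh', hs'⟩ := hall
  have hs0 := hs'.nonneg
  have hbound : Q * (C' + W * s') ≤ Q * b * (1 + W) * κ⁻¹ * κ' ^ n * C := by
    calc Q * (C' + W * s') ≤ Q * (b * (κ⁻¹ * κ' ^ n * (C + W * C))) := by
          gcongr
          exact hCs'.trans (by gcongr; exact hκ' n)
      _ = Q * b * (1 + W) * κ⁻¹ * κ' ^ n * C := by ring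
  refine ⟨(hQ _ _ hC' hh').mono (le_trans (by gcongr; nlinarith) hbound),
    hs'.mono (le_trans ?_ hbound)⟩
  nlinarith [mul_nonneg (sub_nonneg.2 hW) hs0]

end Decay

section IntermediatePoints

theorem HasIntermediatePoints.of_approximate {X : Type*} [PseudoMetricSpace X] [ProperSpace X]
    (happrox : ∀ (x y : X) (t : ℝ), 0 ≤ t → t ≤ 1 → ∀ η > 0,
      ∃ z, dist x z ≤ t * dist x y ∧ dist z y ≤ (1 - t) * dist x y + η) :
    HasIntermediatePoints X := by
  intro x y t ht0 ht1
  have hball : IsCompact {z | dist x z ≤ t * dist x y} := by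
    simpa only [Metric.closedBall, dist_comm] using isCompact_closedBall x (t * dist x y)
  obtain ⟨z₀, hz₀, -⟩ := happrox x y t ht0 ht1 1 one_pos
  obtain ⟨z, hz, hmin⟩ := hball.exists_isMinOn ⟨z₀, hz₀⟩
    (f := fun z => dist z y) (continuous_id.dist continuous_const).continuousOn
  refine ⟨z, hz, le_of_forall_pos_le_add fun η hη => ?_⟩
  obtain ⟨w, hw, hwy⟩ := happrox x y t ht0 ht1 η hη
  exact (hmin hw).trans hwy

variable (d : ℕ) {M : Type*} [MetricSpace M] [ChartedSpace (EuclideanSpace ℝ (Fin d)) M]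
  [RiemannianBundle (fun x : M => TangentSpace (𝓡 d) x)] [IsRiemannianManifold (𝓡 d) M]

include d

theorem exists_approximate_intermediate_point (x y : M) {t : ℝ} (ht0 : 0 ≤ t) (ht1 : t ≤ 1) {η : ℝ}
    (hη : 0 < η) : ∃ z, dist x z ≤ t * dist x y ∧ dist z y ≤ (1 - t) * dist x y + η := by
  have hd : 0 ≤ dist x y := dist_nonneg
  have hlt : riemannianEDist (𝓡 d) x y < ENNReal.ofReal (dist x y + η) := by
    rw [← IsRiemannianManifold.out (I := 𝓡 d) x y, edist_dist]
    exact (ENNReal.ofReal_lt_ofReal_iff (by linarith)).2 (by linarith)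
  obtain ⟨γ, h0, h1, hγ, hlen⟩ := exists_lt_of_riemannianEDist_lt hlt
  have hcont : ContinuousOn (fun s => dist x (γ s)) (Set.Icc 0 1) :=
    (continuous_const.dist continuous_id).comp_continuousOn hγ.continuousOn
  have hmem : t * dist x y ∈ Set.Icc (dist x (γ 0)) (dist x (γ 1)) := by
    rw [h0, h1, dist_self]
    exact ⟨by positivity, mul_le_of_le_one_left hd ht1⟩
  obtain ⟨s, hs, hxs⟩ := intermediate_value_Icc zero_le_one hcont hmem
  have hxs : dist x (γ s) = t * dist x y := hxs
  refine ⟨γ s, hxs.le, ?_⟩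
  have hleft : edist x (γ s) ≤ pathELength (𝓡 d) γ 0 s := by
    rw [IsRiemannianManifold.out (I := 𝓡 d) x (γ s)]
    exact riemannianEDist_le_pathELength (hγ.mono (Set.Icc_subset_Icc_right hs.2)) h0 rfl hs.1
  have hright : edist (γ s) y ≤ pathELength (𝓡 d) γ s 1 := by
    rw [IsRiemannianManifold.out (I := 𝓡 d) (γ s) y]
    exact riemannianEDist_le_pathELength (hγ.mono (Set.Icc_subset_Icc_left hs.1)) rfl h1 hs.2
  have hsum := (add_le_add hleft hright).trans_lt ((pathELength_add hs.1 hs.2).trans_lt hlen)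
  rw [edist_dist, edist_dist, ← ENNReal.ofReal_add dist_nonneg dist_nonneg,
    ENNReal.ofReal_lt_ofReal_iff (by linarith)] at hsum
  linarith

variable (M) in
theorem hasIntermediatePoints_of_isRiemannianManifold [ProperSpace M] : HasIntermediatePoints M :=
  .of_approximate fun x y _ ht0 ht1 _ hη =>
    exists_approximate_intermediate_point d x y ht0 ht1 hη

end IntermediatePoints

section UniformScale

variable {X Y : Type*} [PseudoMetricSpace X] [PseudoMetricSpace Y] {f : X → Y} {r δ L τ : ℝ}

/-- At scale `r`, the inverse branches of `f` ending in `s` are Lipschitz with constant `L`. -/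
def InverseLipschitzOn (f : X → Y) (r L : ℝ) (s : Set X) : Prop :=
  ∀ y ∈ s, ∀ y', dist y y' < r → dist y y' ≤ L * dist (f y) (f y')

theorem InverseLipschitzOn.mono_scale {r' : ℝ} {s : Set X} (h : InverseLipschitzOn f r L s)
    (hr : r' ≤ r) : InverseLipschitzOn f r' L s :=
  fun y hy y' hyy' => h y hy y' (hyy'.trans_le hr)

theorem exists_inverseLipschitzOn [CompactSpace X] {s : Set X}
    (hloc : ∀ x, ∃ U ∈ nhds x, ∀ u ∈ U ∩ s, ∀ v ∈ U, dist u v ≤ L * dist (f u) (f v)) :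
    ∃ r > 0, InverseLipschitzOn f r L s := by
  choose U hU hlip using hloc
  obtain ⟨r, hr, hball⟩ := lebesgue_number_lemma_of_metric (c := fun x => interior (U x))
    isCompact_univ (fun _ => isOpen_interior)
    (fun x _ => Set.mem_iUnion.2 ⟨x, mem_interior_iff_mem_nhds.2 (hU x)⟩)
  refine ⟨r, hr, fun y hy y' hyy' => ?_⟩
  obtain ⟨x, hx⟩ := hball y (Set.mem_univ y)
  exact hlip x y ⟨interior_subset (hx (Metric.mem_ball_self hr)), hy⟩ y'
    (interior_subset (hx (Metric.mem_ball'.2 hyy')))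

theorem exists_ball_subset_image_ball [CompactSpace X] (hc : Continuous f) (ho : IsOpenMap f)
    (hr : 0 < r) : ∃ δ > 0, ∀ y, Metric.ball (f y) δ ⊆ f '' Metric.ball y r := by
  have hopen (x : X) : ∃ δ > 0, Metric.ball (f x) δ ⊆ f '' Metric.ball x (r / 2) :=
    Metric.isOpen_iff.1 (ho _ Metric.isOpen_ball) _ ⟨x, Metric.mem_ball_self (half_pos hr), rfl⟩
  choose δ hδ hsub using hopen
  have hnhds (x : X) : Metric.ball x (r / 2) ∩ f ⁻¹' Metric.ball (f x) (δ x / 2) ∈ nhds x :=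
    Filter.inter_mem (Metric.ball_mem_nhds _ (half_pos hr))
      (hc.continuousAt.preimage_mem_nhds (Metric.ball_mem_nhds _ (half_pos (hδ x))))
  obtain ⟨t, ht⟩ := CompactSpace.elim_nhds_subcover _ hnhds
  have hmin : ∃ δ₀ > 0, ∀ x ∈ t, δ₀ ≤ δ x / 2 := by
    rcases t.eq_empty_or_nonempty with rfl | hne
    · exact ⟨1, one_pos, by simp⟩
    · obtain ⟨x₀, -, hx₀⟩ := t.exists_min_image (fun x => δ x / 2) hne
      exact ⟨δ x₀ / 2, half_pos (hδ x₀), hx₀⟩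
  obtain ⟨δ₀, hδ₀, hle⟩ := hmin
  refine ⟨δ₀, hδ₀, fun y w hw => ?_⟩
  obtain ⟨x, hxt, hyx, hfyx⟩ := Set.mem_iUnion₂.1 (ht.ge (Set.mem_univ y))
  have hwx : w ∈ Metric.ball (f x) (δ x) := calc
    dist w (f x) ≤ dist w (f y) + dist (f y) (f x) := dist_triangle _ _ _
    _ < δ x / 2 + δ x / 2 := add_lt_add (lt_of_lt_of_le hw (hle x hxt)) hfyx
    _ = δ x := add_halves _
  obtain ⟨z, hzx, rfl⟩ := hsub x hwx
  refine ⟨z, ?_, rfl⟩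
  calc dist z y ≤ dist z x + dist y x := dist_triangle_right _ _ _
    _ < r / 2 + r / 2 := add_lt_add hzx hyx
    _ = r := add_halves _

end UniformScale

section Fibers

theorem EnumeratesFibers.card_le_of_subset_iUnion {X : Type*} {f : X → X}
    {fib : X → Finset X} {A : Set X} (hfib : EnumeratesFibers f fib)
    {𝒱 : Finset (Set X)} (hinj : ∀ V ∈ 𝒱, Set.InjOn f V) (hcov : A ⊆ ⋃ V ∈ 𝒱, V) {x : X}
    {t : Finset X} (ht : t ⊆ fib x) (htA : ∀ y ∈ t, y ∈ A) : t.card ≤ 𝒱.card := by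
  have hmem (y : X) : ∃ V, y ∈ t → V ∈ 𝒱 ∧ y ∈ V := by
    by_cases hy : y ∈ t
    · obtain ⟨V, hV, hyV⟩ := Set.mem_iUnion₂.1 (hcov (htA y hy))
      exact ⟨V, fun _ => ⟨hV, hyV⟩⟩
    · exact ⟨∅, fun h => absurd h hy⟩
  choose v hv using hmem
  refine Finset.card_le_card_of_injOn v (fun y hy => (hv y hy).1) fun y hy z hz hyz => ?_
  have hyv := (hv y hy).2
  have hzv := (hv z hz).2
  rw [← hyz] at hzv
  refine hinj _ (hv y hy).1 hyv hzv ?_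
  rw [(hfib _ _).1 (ht hy), (hfib _ _).1 (ht hz)]

variable {M : Type*} [MetricSpace M] {f : M → M} {fib : M → Finset M} {A : Set M} {r δ L τ : ℝ}

theorem InverseLipschitzOn.eq_of_map_eq {s : Set M} (h : InverseLipschitzOn f r L s) {y y' : M}
    (hy : y ∈ s) (hd : dist y y' < r) (he : f y = f y') : y = y' := by
  have := h y hy y' hd
  rw [he, dist_self, mul_zero] at this
  exact dist_le_zero.1 this

theorem InverseLipschitzOn.exists_enumeratesFibers [CompactSpace M] (hc : Continuous f) (hr : 0 < r)
    (h : InverseLipschitzOn f r L Set.univ) : ∃ fib, EnumeratesFibers f fib := by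
  have hfin (x : M) : (f ⁻¹' {x}).Finite := by
    obtain ⟨t, -, htf, ht⟩ :=
      (isClosed_singleton.preimage hc).isCompact.finite_cover_balls (s := f ⁻¹' {x}) (half_pos hr)
    refine Set.Finite.subset (htf.biUnion (t := fun z => f ⁻¹' {x} ∩ Metric.ball z (r / 2))
      fun z _ => Set.Subsingleton.finite ?_) fun y hy => ?_
    · rintro a ⟨ha, haz⟩ b ⟨hb, hbz⟩
      refine h.eq_of_map_eq (Set.mem_univ a) ?_ (ha.trans hb.symm)
      calc dist a b ≤ dist a z + dist b z := dist_triangle_right _ _ _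
        _ < r / 2 + r / 2 := add_lt_add haz hbz
        _ = r := add_halves r
    · obtain ⟨z, hz, hyz⟩ := Set.mem_iUnion₂.1 (ht hy)
      exact Set.mem_iUnion₂.2 ⟨z, hz, hy, hyz⟩
  exact ⟨fun x => (hfin x).toFinset, fun x y => by simp⟩

theorem EnumeratesFibers.exists_injOn (hfib : EnumeratesFibers f fib)
    (hL : InverseLipschitzOn f r L Set.univ) (hτ : InverseLipschitzOn f r τ Aᶜ)
    (hδ : ∀ y, Metric.ball (f y) δ ⊆ f '' Metric.ball y (r / 2)) {x x' : M} (hx : dist x x' < δ) :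
    ∃ e : M → M, Set.MapsTo e (fib x) (fib x') ∧ Set.InjOn e (fib x) ∧
      ∀ y ∈ fib x, dist y (e y) ≤ L * dist x x' ∧ (y ∉ A → dist y (e y) ≤ τ * dist x x') := by
  have hlift (y : M) : ∃ y', f y = x → f y' = x' ∧ dist y' y < r / 2 := by
    by_cases hy : f y = x
    · obtain ⟨y', hd, hf⟩ := hδ y (show x' ∈ Metric.ball (f y) δ by rwa [hy, Metric.mem_ball'])
      exact ⟨y', fun _ => ⟨hf, hd⟩⟩
    · exact ⟨y, fun h => absurd h hy⟩
  choose e he using hlift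
  replace he (y : M) (hy : y ∈ fib x) : f y = x ∧ f (e y) = x' ∧ dist (e y) y < r / 2 :=
    have hfy := (hfib x y).1 hy
    ⟨hfy, he y hfy⟩
  refine ⟨e, fun y hy => (hfib _ _).2 (he y hy).2.1, fun y hy z hz hyz => ?_, fun y hy => ?_⟩
  · obtain ⟨hfy, -, hdy⟩ := he y hy
    obtain ⟨hfz, -, hdz⟩ := he z hz
    rw [← hyz] at hdz
    exact hL.eq_of_map_eq (Set.mem_univ y)
      ((dist_triangle_left y z (e y)).trans_lt (by linarith)) (hfy.trans hfz.symm)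
  · obtain ⟨hfy, hfe, hd⟩ := he y hy
    have hlt : dist y (e y) < r := by
      rw [dist_comm]
      linarith [dist_nonneg (x := e y) (y := y)]
    have hbound := hL y (Set.mem_univ y) (e y) hlt
    have hbound' (hyA : y ∉ A) := hτ y hyA (e y) hlt
    rw [hfy, hfe] at hbound hbound'
    exact ⟨hbound, hbound'⟩

theorem EnumeratesFibers.card_eq_mapDegree [PreconnectedSpace M] (hfib : EnumeratesFibers f fib)
    (hδ : 0 < δ) (hle : ∀ x x', dist x x' < δ → (fib x).card ≤ (fib x').card) (x : M) :
    (fib x).card = mapDegree f := by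
  have hlc : IsLocallyConstant fun x => (fib x).card :=
    (IsLocallyConstant.iff_exists_open _).2 fun x =>
      ⟨Metric.ball x δ, Metric.isOpen_ball, Metric.mem_ball_self hδ, fun x' hx' =>
        le_antisymm (hle _ _ hx') (hle _ _ (Metric.mem_ball'.1 hx'))⟩
  have hncard (x' : M) : (f ⁻¹' {x'}).ncard = (fib x).card := by
    rw [hlc.apply_eq_of_preconnectedSpace x x', ← Set.ncard_coe_finset]
    congr 1
    ext y
    exact (hfib x' y).symm
  have : Nonempty M := ⟨x⟩
  simp only [mapDegree, hncard, ciSup_const]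

theorem exists_branches [CompactSpace M] [PreconnectedSpace M] {q : ℕ}
    (hc : Continuous f) (ho : IsOpenMap f)
    (hlocL : ∀ x, ∃ U ∈ nhds x, ∀ u ∈ U, ∀ v ∈ U, dist u v ≤ L * dist (f u) (f v))
    (hlocτ : ∀ x, ∃ U ∈ nhds x, ∀ u ∈ U ∩ Aᶜ, ∀ v ∈ U, dist u v ≤ τ * dist (f u) (f v))
    (hL : 1 ≤ L) (hL2 : L ≤ 2) (hτ : 0 < τ) (hτ1 : τ ≤ 1) {𝒱 : Finset (Set M)}
    (hinj : ∀ V ∈ 𝒱, Set.InjOn f V) (hcov : A ⊆ ⋃ V ∈ 𝒱, V) (hcard : 𝒱.card = q)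
    (hq : q < mapDegree f) : ∃ fib δ, Branches f fib A (mapDegree f) q L τ δ := by
  obtain ⟨r₁, hr₁, hL₁⟩ := exists_inverseLipschitzOn (L := L) (s := Set.univ)
    fun x => (hlocL x).imp fun U hU => ⟨hU.1, fun u hu => hU.2 u hu.1⟩
  obtain ⟨r₂, hr₂, hτ₂⟩ := exists_inverseLipschitzOn hlocτ
  set r := min r₁ r₂
  have hr : 0 < r := lt_min hr₁ hr₂
  have hLr : InverseLipschitzOn f r L Set.univ := hL₁.mono_scale (min_le_left _ _)
  have hτr : InverseLipschitzOn f r τ Aᶜ := hτ₂.mono_scale (min_le_right _ _)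
  obtain ⟨fib, hfib⟩ := hLr.exists_enumeratesFibers hc hr
  obtain ⟨δ, hδ, hball⟩ := exists_ball_subset_image_ball hc ho (half_pos hr)
  have hdeg := hfib.card_eq_mapDegree hδ fun x x' hx => by
    obtain ⟨e, hmaps, hinj, -⟩ := hfib.exists_injOn hLr hτr hball hx
    exact Finset.card_le_card_of_injOn e hmaps hinj
  refine ⟨fib, δ, hfib, hdeg, fun x t ht htA => ?_, hq.le, by omega, hL, hL2, hτ, hτ1, hδ,
    fun x x' hx => ?_⟩
  · exact hcard ▸ hfib.card_le_of_subset_iUnion hinj hcov ht htA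
  · obtain ⟨e, hmaps, hinj, hd⟩ := hfib.exists_injOn hLr hτr hball hx
    exact ⟨e, ⟨hmaps, hinj, Finset.surjOn_of_injOn_of_card_le e hmaps hinj
      (by rw [hdeg, hdeg])⟩, hd⟩

end Fibers

section Normalization

/-- The sum of a weight over the fibres. -/
def fiberSum {X : Type*} (fib : X → Finset X) (ρ : X → ℝ) (x : X) : ℝ := ∑ y ∈ fib x, ρ y

variable {M : Type*} [MetricSpace M] {f : M → M} {fib : M → Finset M} {A : Set M} {D q : ℕ}
  {L τ δ ζ : ℝ} {ρ : M → ℝ} {a E H : ℝ}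

namespace Branches

theorem le_fiberSum (hb : Branches f fib A D q L τ δ) (hge : ∀ y, a ≤ ρ y) (x : M) :
    D * a ≤ fiberSum fib ρ x := by
  simpa only [hb.card_fib, nsmul_eq_mul, fiberSum] using
    Finset.card_nsmul_le_sum (fib x) ρ a fun y _ => hge y

theorem fiberSum_le (hb : Branches f fib A D q L τ δ) (hdist : ∀ y y', ρ y ≤ E * ρ y') (x y : M) :
    fiberSum fib ρ x ≤ D * (E * ρ y) := by
  simpa only [hb.card_fib, nsmul_eq_mul, fiberSum] using
    Finset.sum_le_card_nsmul (fib x) ρ (E * ρ y) fun z _ => hdist z y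

theorem mul_le_mul_fiberSum (hb : Branches f fib A D q L τ δ) (hdist : ∀ y y', ρ y ≤ E * ρ y')
    (x y : M) : D * ρ y ≤ E * fiberSum fib ρ x := by
  simpa only [hb.card_fib, nsmul_eq_mul, fiberSum, Finset.mul_sum] using
    Finset.card_nsmul_le_sum (fib x) (fun z => E * ρ z) (ρ y) fun z _ => hdist y z

theorem abs_fiberSum_sub_le (hb : Branches f fib A D q L τ δ) {x x' : M} (hx : dist x x' < δ)
    {b : ℝ} (hvar : ∀ y y', dist y y' ≤ L * dist x x' → |ρ y - ρ y'| ≤ b) :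
    |fiberSum fib ρ x' - fiberSum fib ρ x| ≤ D * b := by
  obtain ⟨e, he, hd⟩ := hb.pairing x x' hx
  have hsum : fiberSum fib ρ x' = ∑ y ∈ fib x, ρ (e y) :=
    (Finset.sum_nbij e (fun y hy => he.mapsTo hy) he.injOn he.surjOn fun _ _ => rfl).symm
  rw [hsum, fiberSum, ← Finset.sum_sub_distrib, ← nsmul_eq_mul, ← hb.card_fib x]
  refine (Finset.abs_sum_le_sum_abs _ _).trans (Finset.sum_le_card_nsmul _ _ _ fun y hy => ?_)
  rw [abs_sub_comm]
  exact hvar y (e y) (hd y hy).1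

theorem abs_div_fiberSum_sub_le (hb : Branches f fib A D q L τ δ) (ha : 0 < a)
    (hge : ∀ y, a ≤ ρ y) (hdist : ∀ y y', ρ y ≤ E * ρ y') {x x' y y' : M} (hx : dist x x' < δ)
    (hyy' : dist y y' ≤ L * dist x x') {b : ℝ}
    (hvar : ∀ y y', dist y y' ≤ L * dist x x' → |ρ y - ρ y'| ≤ b) :
    |ρ y / fiberSum fib ρ x - ρ y' / fiberSum fib ρ x'| ≤ (b + E * b) / (D * a) := by
  have hD : (0 : ℝ) < D := Nat.cast_pos.2 hb.D_pos
  have hDa : 0 < D * a := mul_pos hD ha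
  have hw : 0 < fiberSum fib ρ x := hDa.trans_le (hb.le_fiberSum hge x)
  have hw' : 0 < fiberSum fib ρ x' := hDa.trans_le (hb.le_fiberSum hge x')
  have hsplit : ρ y / fiberSum fib ρ x - ρ y' / fiberSum fib ρ x'
      = ((ρ y - ρ y') + ρ y' / fiberSum fib ρ x' * (fiberSum fib ρ x' - fiberSum fib ρ x))
        / fiberSum fib ρ x := by
    field_simp
    ring
  have hratio : ρ y' / fiberSum fib ρ x' ≤ E / D := by
    rw [div_le_div_iff₀ hw' hD]
    linarith [hb.mul_le_mul_fiberSum hdist x' y']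
  have hratio0 : 0 ≤ ρ y' / fiberSum fib ρ x' := div_nonneg (ha.le.trans (hge y')) hw'.le
  rw [hsplit, abs_div, abs_of_pos hw]
  refine div_le_div₀ ?_ ?_ hDa (hb.le_fiberSum hge x)
  · have hb0 : 0 ≤ b := (abs_nonneg _).trans (hvar y y' hyy')
    exact add_nonneg hb0 (mul_nonneg (by
      simpa [hD.ne'] using mul_nonneg (hratio0.trans hratio) hD.le) hb0)
  · calc |ρ y - ρ y' + ρ y' / fiberSum fib ρ x' * (fiberSum fib ρ x' - fiberSum fib ρ x)|
        ≤ |ρ y - ρ y'| + ρ y' / fiberSum fib ρ x' * |fiberSum fib ρ x' - fiberSum fib ρ x| := by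
          rw [← abs_of_nonneg hratio0, ← abs_mul, abs_of_nonneg hratio0]
          exact abs_add_le _ _
      _ ≤ b + E / D * (D * b) := add_le_add (hvar y y' hyy')
          (mul_le_mul hratio (hb.abs_fiberSum_sub_le hx hvar) (abs_nonneg _)
            (hratio0.trans hratio))
      _ = b + E * b := by field_simp

theorem branchWeight_div_fiberSum (hb : Branches f fib A D q L τ δ) (hζ : 0 ≤ ζ) (ha : 0 < a)
    (hE : 0 < E) (hH : 0 ≤ H) (hge : ∀ y, a ≤ ρ y) (hdist : ∀ y y', ρ y ≤ E * ρ y')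
    (hρ : HolderBound ζ H ρ) :
    BranchWeight fib L δ ζ (fun y => ρ y / fiberSum fib ρ (f y)) (E / D) (1 / (D * E))
      ((1 + E) * (H * L ^ ζ) / (D * a)) := by
  have hD : (0 : ℝ) < D := Nat.cast_pos.2 hb.D_pos
  have hL : 0 ≤ L := by linarith [hb.one_le_L]
  have hw (x : M) : 0 < fiberSum fib ρ x := (mul_pos hD ha).trans_le (hb.le_fiberSum hge x)
  refine
    { nonneg := fun y => div_nonneg (ha.le.trans (hge y)) (hw _).le
      sum_eq_one := fun x => ?_
      beta_pos := by positivity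
      beta_le := fun y => ?_
      le_c := fun y => ?_
      B_nonneg := by positivity
      variation := fun x x' hx y hy y' hy' hyy' => ?_ }
  · rw [Finset.sum_congr rfl fun y hy => by rw [(hb.enumeratesFibers x y).1 hy],
      ← Finset.sum_div]
    exact div_self (hw x).ne'
  · rw [div_le_div_iff₀ (by positivity) (hw _)]
    linarith [hb.fiberSum_le hdist (f y) y]
  · rw [div_le_div_iff₀ (hw _) hD]
    linarith [hb.mul_le_mul_fiberSum hdist (f y) y]
  · rw [(hb.enumeratesFibers x y).1 hy, (hb.enumeratesFibers x' y').1 hy']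
    refine (hb.abs_div_fiberSum_sub_le ha hge hdist hx hyy' (b := H * L ^ ζ * dist x x' ^ ζ)
      fun z z' hz => ?_).trans_eq (by ring)
    calc |ρ z - ρ z'| ≤ H * dist z z' ^ ζ := hρ z z'
      _ ≤ H * (L * dist x x') ^ ζ := by gcongr
      _ = H * L ^ ζ * dist x x' ^ ζ := by rw [Real.mul_rpow hL dist_nonneg, mul_assoc]

end Branches

end Normalization

section Duality

variable {M : Type*} {f : M → M} {fib : M → Finset M} {p u : M → ℝ} {E : Set M}

theorem EnumeratesFibers.transfer_indicator_apply_map (hfib : EnumeratesFibers f fib)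
    (hinj : Set.InjOn f E) {y : M} (hy : y ∈ E) :
    transfer fib p (E.indicator u) (f y) = p y * u y := by
  rw [transfer_apply, Finset.sum_eq_single y, Set.indicator_of_mem hy]
  · intro z hz hzy
    rw [Set.indicator_of_notMem fun hzE => hzy (hinj hzE hy ((hfib _ _).1 hz)), mul_zero]
  · exact fun h => absurd ((hfib _ _).2 rfl) h

theorem EnumeratesFibers.transfer_indicator_apply_of_notMem (hfib : EnumeratesFibers f fib) {x : M}
    (hx : x ∉ f '' E) : transfer fib p (E.indicator u) x = 0 :=
  Finset.sum_eq_zero fun y hy => by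
    rw [Set.indicator_of_notMem fun hyE => hx ⟨y, hyE, (hfib _ _).1 hy⟩, mul_zero]

theorem EnumeratesFibers.transfer_comp_mul (hfib : EnumeratesFibers f fib) (ψ h : M → ℝ) (x : M) :
    transfer fib p (fun y => ψ (f y) * h y) x = ψ x * transfer fib p h x := by
  simp only [transfer_apply, Finset.mul_sum]
  exact Finset.sum_congr rfl fun y hy => by rw [(hfib _ _).1 hy]; ring

theorem transfer_one (fib : M → Finset M) (p : M → ℝ) :
    transfer fib p (fun _ => 1) = fiberSum fib p := by
  ext x
  simp only [transfer_apply, fiberSum, mul_one]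

variable [MeasurableSpace M] {m₁ : Measure M} {J : M → ℝ}

namespace IsJacobian

theorem restrict_image (hJ : IsJacobian m₁ f J) (hf : Measurable f) (hE : MeasurableSet E)
    (hinj : Set.InjOn f E) : m₁.restrict (f '' E)
      = ((m₁.withDensity fun x => ENNReal.ofReal (J x)).comap ((↑) : E → M)).map
        (fun y : E => f y) := by
  ext B hB
  have hfE : Measurable fun y : E => f y := hf.comp measurable_subtype_coe
  have hEB : MeasurableSet (E ∩ f ⁻¹' B) := hE.inter (hf hB)
  rw [Measure.map_apply hfE hB, comap_subtype_coe_apply hE, Measure.restrict_apply hB,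
    show (fun y : E => f y) ⁻¹' B = (↑) ⁻¹' (f ⁻¹' B) from rfl, Subtype.image_preimage_coe,
    withDensity_apply _ hEB, ← hJ.measure_image _ hEB (hinj.mono Set.inter_subset_left),
    Set.image_inter_preimage, Set.inter_comm]

variable [StandardBorelSpace M]

theorem integrableOn_image_iff (hJ : IsJacobian m₁ f J) (hf : Measurable f) (hE : MeasurableSet E)
    (hinj : Set.InjOn f E) (g : M → ℝ) :
    IntegrableOn g (f '' E) m₁ ↔ IntegrableOn (fun y => J y * g (f y)) E m₁ := by
  have := hE.standardBorel
  have hemb : MeasurableEmbedding fun y : E => f y :=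
    (hf.comp measurable_subtype_coe).measurableEmbedding hinj.injective
  rw [IntegrableOn, hJ.restrict_image hf hE hinj, hemb.integrable_map_iff,
    show g ∘ (fun y : E => f y) = (g ∘ f) ∘ (↑) from rfl,
    ← (MeasurableEmbedding.subtype_coe hE).integrable_map_iff, map_comap_subtype_coe hE,
    restrict_withDensity hE, integrable_withDensity_iff_integrable_smul'
      hJ.measurable.ennreal_ofReal (.of_forall fun _ => ENNReal.ofReal_lt_top)]
  simp only [ENNReal.toReal_ofReal (hJ.pos _).le, smul_eq_mul, Function.comp_apply, IntegrableOn]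

theorem setIntegral_image (hJ : IsJacobian m₁ f J) (hf : Measurable f) (hE : MeasurableSet E)
    (hinj : Set.InjOn f E) (g : M → ℝ) :
    ∫ x in f '' E, g x ∂m₁ = ∫ y in E, J y * g (f y) ∂m₁ := by
  have := hE.standardBorel
  have hemb : MeasurableEmbedding fun y : E => f y :=
    (hf.comp measurable_subtype_coe).measurableEmbedding hinj.injective
  rw [hJ.restrict_image hf hE hinj, hemb.integral_map,
    ← (MeasurableEmbedding.subtype_coe hE).integral_map (fun y => g (f y)),
    map_comap_subtype_coe hE, restrict_withDensity hE,
    integral_withDensity_eq_integral_toReal_smul hJ.measurable.ennreal_ofReal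
      (.of_forall fun _ => ENNReal.ofReal_lt_top)]
  simp only [ENNReal.toReal_ofReal (hJ.pos _).le, smul_eq_mul]

theorem transfer_indicator (hJ : IsJacobian m₁ f J) (hf : Measurable f)
    (hfib : EnumeratesFibers f fib) (hu : Integrable u m₁) (hE : MeasurableSet E)
    (hinj : Set.InjOn f E) :
    Integrable (transfer fib (weight J) (E.indicator u)) m₁ ∧
      ∫ x, transfer fib (weight J) (E.indicator u) x ∂m₁ = ∫ x in E, u x ∂m₁ := by
  set v := transfer fib (weight J) (E.indicator u)
  have hv0 (x : M) (hx : x ∉ f '' E) : v x = 0 := hfib.transfer_indicator_apply_of_notMem hx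
  have hvE : Set.EqOn (fun y => J y * v (f y)) u E := fun y hy => by
    simp only [v, hfib.transfer_indicator_apply_map hinj hy, weight]
    rw [one_div, mul_inv_cancel_left₀ (hJ.pos y).ne']
  refine ⟨(integrableOn_iff_integrable_of_support_subset ?_).1
    ((hJ.integrableOn_image_iff hf hE hinj v).2 ?_), ?_⟩
  · exact fun x hx => by_contra fun hxE => hx (hv0 x hxE)
  · exact (integrableOn_congr_fun hvE hE).2 hu.integrableOn
  · rw [← setIntegral_eq_integral_of_forall_compl_eq_zero hv0, hJ.setIntegral_image hf hE hinj,
      setIntegral_congr_fun hE hvE]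

theorem transfer_indicator_of_subset_iUnion (hJ : IsJacobian m₁ f J) (hf : Measurable f)
    (hfib : EnumeratesFibers f fib) (hu : Integrable u m₁) {𝒰 : Finset (Set M)}
    (h𝒰 : ∀ U ∈ 𝒰, MeasurableSet U ∧ Set.InjOn f U) (hE : MeasurableSet E)
    (hcov : E ⊆ ⋃ U ∈ 𝒰, U) :
    Integrable (transfer fib (weight J) (E.indicator u)) m₁ ∧
      ∫ x, transfer fib (weight J) (E.indicator u) x ∂m₁ = ∫ x in E, u x ∂m₁ := by
  classical
  induction 𝒰 using Finset.induction_on generalizing E with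
  | empty =>
    obtain rfl : E = ∅ := by simpa using hcov
    exact hJ.transfer_indicator hf hfib hu hE (Set.injOn_empty f)
  | insert U 𝒰 _ ih =>
    obtain ⟨⟨hU, hUinj⟩, h𝒰⟩ := Finset.forall_mem_insert _ _ _ |>.1 h𝒰
    have hdiff : E \ U ⊆ ⋃ V ∈ 𝒰, V := by
      rw [Set.sdiff_subset_iff]
      simpa only [Finset.mem_insert, Set.iUnion_iUnion_eq_or_left] using hcov
    obtain ⟨hI₁, hint₁⟩ := hJ.transfer_indicator hf hfib hu (hE.inter hU)
      (hUinj.mono Set.inter_subset_right)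
    obtain ⟨hI₂, hint₂⟩ := ih h𝒰 (hE.diff hU) hdiff
    have hsplit : E.indicator u = (E ∩ U).indicator u + (E \ U).indicator u := by
      rw [← Set.inter_union_sdiff E U,
        Set.indicator_union_of_disjoint Set.disjoint_sdiff_inter.symm, Set.inter_union_sdiff]
      rfl
    simp only [hsplit, map_add, Pi.add_apply]
    exact ⟨hI₁.add hI₂, by
      rw [integral_add hI₁ hI₂, hint₁, hint₂, integral_inter_add_sdiff hU hu.integrableOn]⟩

variable {𝒰 : Finset (Set M)}

theorem transfer_weight (hJ : IsJacobian m₁ f J) (hf : Measurable f)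
    (hfib : EnumeratesFibers f fib) (h𝒰 : ∀ U ∈ 𝒰, MeasurableSet U ∧ Set.InjOn f U)
    (hcov : (⋃ U ∈ 𝒰, U) = Set.univ) (hu : Integrable u m₁) :
    Integrable (transfer fib (weight J) u) m₁ ∧
      ∫ x, transfer fib (weight J) u x ∂m₁ = ∫ x, u x ∂m₁ := by
  simpa only [Set.indicator_univ, setIntegral_univ] using
    hJ.transfer_indicator_of_subset_iUnion hf hfib hu h𝒰 .univ hcov.ge

theorem fiberSum_weight_ae_eq_one [IsFiniteMeasure m₁] (hJ : IsJacobian m₁ f J)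
    (hinv : MeasurePreserving f m₁ m₁) (hfib : EnumeratesFibers f fib)
    (h𝒰 : ∀ U ∈ 𝒰, MeasurableSet U ∧ Set.InjOn f U) (hcov : (⋃ U ∈ 𝒰, U) = Set.univ) :
    fiberSum fib (weight J) =ᵐ[m₁] fun _ => 1 := by
  have hI : Integrable (fiberSum fib (weight J)) m₁ :=
    transfer_one fib (weight J) ▸
      (hJ.transfer_weight hinv.measurable hfib h𝒰 hcov (integrable_const 1)).1
  refine hI.ae_eq_of_forall_setIntegral_eq _ _ (integrable_const 1) fun B hB _ => ?_
  have hBf : MeasurableSet (f ⁻¹' B) := hinv.measurable hB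
  have htransfer : transfer fib (weight J) ((f ⁻¹' B).indicator fun _ => 1)
      = B.indicator (fiberSum fib (weight J)) := by
    ext x
    have hcomp := hfib.transfer_comp_mul (p := weight J) (B.indicator 1) (fun _ => 1) x
    simp only [mul_one, transfer_one] at hcomp
    exact hcomp.trans (by by_cases hx : x ∈ B <;> simp [hx])
  calc ∫ x in B, fiberSum fib (weight J) x ∂m₁
      = ∫ x, transfer fib (weight J) ((f ⁻¹' B).indicator fun _ => 1) x ∂m₁ := by
        rw [htransfer, integral_indicator hB]
    _ = ∫ x, (f ⁻¹' B).indicator (fun _ => 1) x ∂m₁ :=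
        (hJ.transfer_weight hinv.measurable hfib h𝒰 hcov
          ((integrable_const 1).indicator hBf)).2
    _ = ∫ _ in B, 1 ∂m₁ := by
        rw [integral_indicator hBf, setIntegral_const, setIntegral_const, measureReal_def,
          measureReal_def, hinv.measure_preimage hB.nullMeasurableSet]

theorem integral_comp_mul [IsFiniteMeasure m₁] (hJ : IsJacobian m₁ f J)
    (hinv : MeasurePreserving f m₁ m₁) (hfib : EnumeratesFibers f fib)
    (h𝒰 : ∀ U ∈ 𝒰, MeasurableSet U ∧ Set.InjOn f U) (hcov : (⋃ U ∈ 𝒰, U) = Set.univ)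
    {ψ h : M → ℝ} (hI : Integrable (fun x => ψ (f x) * h x) m₁) :
    ∫ x, ψ (f x) * h x ∂m₁
      = ∫ x, ψ x * transfer fib (fun y => weight J y / fiberSum fib (weight J) (f y)) h x ∂m₁ := by
  rw [← (hJ.transfer_weight hinv.measurable hfib h𝒰 hcov hI).2]
  refine integral_congr_ae ?_
  filter_upwards [hJ.fiberSum_weight_ae_eq_one hinv hfib h𝒰 hcov] with x hx
  rw [hfib.transfer_comp_mul]
  congr 1
  exact Finset.sum_congr rfl fun y hy => by simp only [(hfib _ _).1 hy, hx, div_one]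

end IsJacobian

end Duality

section SignedIntegral

variable {X : Type*} [MeasurableSpace X] {μ : SignedMeasure X} {Φ : X → ℝ}

instance isFiniteMeasure_variation (μ : SignedMeasure X) : IsFiniteMeasure μ.variation := by
  rw [← SignedMeasure.totalVariation_eq_variation]
  infer_instance

theorem integrable_variation_iff :
    Integrable Φ μ.variation ↔ Integrable Φ μ.toJordanDecomposition.posPart ∧
      Integrable Φ μ.toJordanDecomposition.negPart := by
  rw [← SignedMeasure.totalVariation_eq_variation, SignedMeasure.totalVariation,
    integrable_add_measure]

theorem signedIntegral_toSignedMeasure_sub {a b : Measure X} [IsFiniteMeasure a]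
    [IsFiniteMeasure b] (ha : Integrable Φ a) (hb : Integrable Φ b) :
    ∫ᵛ x, Φ x ∂<•(a.toSignedMeasure - b.toSignedMeasure) = ∫ x, Φ x ∂a - ∫ x, Φ x ∂b := by
  rw [VectorMeasure.integral_sub_vectorMeasure, VectorMeasure.integral_toSignedMeasure,
    VectorMeasure.integral_toSignedMeasure]
  · rwa [VectorMeasure.Integrable, Measure.variation_toSignedMeasure]
  · rwa [VectorMeasure.Integrable, Measure.variation_toSignedMeasure]

theorem signedIntegral_eq_sub (hΦ : Integrable Φ μ.variation) :
    ∫ᵛ x, Φ x ∂<•μ = ∫ x, Φ x ∂μ.toJordanDecomposition.posPart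
      - ∫ x, Φ x ∂μ.toJordanDecomposition.negPart := by
  obtain ⟨hpos, hneg⟩ := integrable_variation_iff.1 hΦ
  nth_rw 1 [← μ.toSignedMeasure_toJordanDecomposition]
  exact signedIntegral_toSignedMeasure_sub hpos hneg

theorem signedSetIntegral_add {Ψ : X → ℝ} (hΦ : Integrable Φ μ.variation)
    (hΨ : Integrable Ψ μ.variation) (s : Set X) :
    ∫ᵛ x in s, (Φ x + Ψ x) ∂<•μ = ∫ᵛ x in s, Φ x ∂<•μ + ∫ᵛ x in s, Ψ x ∂<•μ :=
  VectorMeasure.integral_fun_add (VectorMeasure.Integrable.restrict hΦ)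
    (VectorMeasure.Integrable.restrict hΨ)

theorem signedIntegral_const_mul (μ : SignedMeasure X) (c : ℝ) (Φ : X → ℝ) :
    ∫ᵛ x, c * Φ x ∂<•μ = c * ∫ᵛ x, Φ x ∂<•μ :=
  VectorMeasure.integral_fun_smul μ _ c Φ

theorem signedIntegral_withDensity {m : Measure X} {h : X → ℝ} (hh : Integrable h m)
    (hΦ : Measurable Φ) {R : ℝ} (hR : ∀ x, |Φ x| ≤ R) :
    ∫ᵛ x, Φ x ∂<•(m.withDensityᵥ h) = ∫ x, Φ x * h x ∂m := by
  have hbdd : ∀ (m' : Measure X) [IsFiniteMeasure m'], Integrable Φ m' := fun m' _ =>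
    Integrable.of_bound hΦ.aestronglyMeasurable R (ae_of_all _ hR)
  have hΦh : ∀ k : X → ℝ, Integrable k m → Integrable (fun x => Φ x * k x) m := fun k hk =>
    hk.bdd_mul hΦ.aestronglyMeasurable (ae_of_all _ hR)
  have integral_part : ∀ k : X → ℝ, Integrable k m →
      ∫ x, Φ x ∂(m.withDensity fun x => ENNReal.ofReal (k x)) = ∫ x, Φ x * max (k x) 0 ∂m := by
    intro k hk
    rw [integral_withDensity_eq_integral_toReal_smul₀ hk.1.aemeasurable.ennreal_ofReal
      (ae_of_all _ fun _ => ENNReal.ofReal_lt_top)]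
    simp only [smul_eq_mul, ENNReal.toReal_ofReal', mul_comm]
  have := isFiniteMeasure_withDensity_ofReal hh.2
  have := isFiniteMeasure_withDensity_ofReal hh.neg.2
  rw [withDensityᵥ_eq_withDensity_pos_part_sub_withDensity_neg_part hh,
    signedIntegral_toSignedMeasure_sub (hbdd _) (hbdd _), integral_part h hh,
    integral_part (fun x => -h x) hh.neg,
    ← integral_sub (hΦh (fun x => max (h x) 0) hh.pos_part)
      (hΦh (fun x => max (-h x) 0) hh.neg_part)]
  refine integral_congr_ae (ae_of_all _ fun x => ?_)
  simp only [← mul_sub, max_zero_sub_eq_self]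

end SignedIntegral

section Fibers

variable {M K : Type*} [MeasurableSpace M] [MeasurableSpace K] {m₁ : Measure M}
  {μ : SignedMeasure (M × K)} {Φ : M × K → ℝ}

theorem MarginalsAC.ae_of_ae_fst (hμ : MarginalsAC m₁ μ) {p : M → Prop} (hp : ∀ᵐ x ∂m₁, p x) :
    ∀ᵐ q ∂μ.variation, p q.1 := by
  rw [← SignedMeasure.totalVariation_eq_variation, SignedMeasure.totalVariation,
    ae_add_measure_iff]
  exact ⟨ae_of_ae_map measurable_fst.aemeasurable (hμ.1.ae_le hp),
    ae_of_ae_map measurable_fst.aemeasurable (hμ.2.ae_le hp)⟩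

variable [StandardBorelSpace K] [Nonempty K]

/-- The integral of `Φ` over the fibre above `γ` against the signed measure `μ⁺|_γ - μ⁻|_γ`. -/
def fiberIntegral (m₁ : Measure M) (μ : SignedMeasure (M × K)) (Φ : M × K → ℝ) (γ : M) : ℝ :=
  ∫ z, Φ (γ, z) ∂fiberRestriction m₁ μ.toJordanDecomposition.posPart γ
    - ∫ z, Φ (γ, z) ∂fiberRestriction m₁ μ.toJordanDecomposition.negPart γ

theorem fiberIntegral_comp_fst (μ : SignedMeasure (M × K)) (ψ : M → ℝ) (γ : M) :
    fiberIntegral m₁ μ (fun p => ψ p.1) γ = ψ γ * marginalDensity m₁ μ γ := by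
  simp only [fiberIntegral, integral_const, marginalDensity, fiberRestriction, measureReal_def,
    Measure.smul_apply, measure_univ, smul_eq_mul, mul_one]
  ring

variable [IsFiniteMeasure m₁]

theorem integrable_integral_fiberRestriction {μ : Measure (M × K)} [IsFiniteMeasure μ]
    (hμ : μ.fst ≪ m₁) (hΦ : Integrable Φ μ) :
    Integrable (fun γ => ∫ z, Φ (γ, z) ∂fiberRestriction m₁ μ γ) m₁ := by
  simp only [fiberRestriction, integral_smul_measure]
  rw [integrable_rnDeriv_smul_iff hμ]
  rw [← μ.disintegrate μ.condKernel] at hΦ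
  exact hΦ.integral_compProd

theorem integral_integral_fiberRestriction {μ : Measure (M × K)} [IsFiniteMeasure μ]
    (hμ : μ.fst ≪ m₁) (hΦ : Integrable Φ μ) :
    ∫ γ, ∫ z, Φ (γ, z) ∂fiberRestriction m₁ μ γ ∂m₁ = ∫ p, Φ p ∂μ := by
  simp only [fiberRestriction, integral_smul_measure]
  rw [← μ.disintegrate μ.condKernel] at hΦ
  rw [integral_rnDeriv_smul hμ, ← Measure.integral_compProd hΦ, μ.disintegrate μ.condKernel]

theorem integrable_fiberIntegral (hμ : MarginalsAC m₁ μ) (hΦ : Integrable Φ μ.variation) :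
    Integrable (fiberIntegral m₁ μ Φ) m₁ :=
  (integrable_integral_fiberRestriction hμ.1 (integrable_variation_iff.1 hΦ).1).sub
    (integrable_integral_fiberRestriction hμ.2 (integrable_variation_iff.1 hΦ).2)

theorem integral_fiberIntegral (hμ : MarginalsAC m₁ μ) (hΦ : Integrable Φ μ.variation) :
    ∫ γ, fiberIntegral m₁ μ Φ γ ∂m₁ = ∫ᵛ p, Φ p ∂<•μ := by
  obtain ⟨hpos, hneg⟩ := integrable_variation_iff.1 hΦ
  simp only [fiberIntegral]
  rw [integral_sub (integrable_integral_fiberRestriction hμ.1 hpos)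
    (integrable_integral_fiberRestriction hμ.2 hneg),
    integral_integral_fiberRestriction hμ.1 hpos, integral_integral_fiberRestriction hμ.2 hneg,
    signedIntegral_eq_sub hΦ]

theorem setIntegral_fiberIntegral (hμ : MarginalsAC m₁ μ) (hΦ : Integrable Φ μ.variation)
    {B : Set M} (hB : MeasurableSet B) :
    ∫ γ in B, fiberIntegral m₁ μ Φ γ ∂m₁ = ∫ᵛ p in Prod.fst ⁻¹' B, Φ p ∂<•μ := by
  have hB' : MeasurableSet (Prod.fst ⁻¹' B : Set (M × K)) := measurable_fst hB
  rw [← VectorMeasure.integral_indicator hB', ← integral_fiberIntegral hμ (hΦ.indicator hB'),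
    ← integral_indicator hB]
  refine integral_congr_ae (ae_of_all _ fun γ => ?_)
  by_cases hγ : γ ∈ B <;> simp [fiberIntegral, Set.indicator, hγ]

theorem setIntegral_comp_fst (hμ : MarginalsAC m₁ μ) {ψ : M → ℝ}
    (hψ : Integrable (fun p : M × K => ψ p.1) μ.variation) {B : Set M} (hB : MeasurableSet B) :
    ∫ᵛ p in Prod.fst ⁻¹' B, ψ p.1 ∂<•μ = ∫ γ in B, ψ γ * marginalDensity m₁ μ γ ∂m₁ := by
  simp only [← setIntegral_fiberIntegral hμ hψ hB, fiberIntegral_comp_fst]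

theorem integrable_marginalDensity (hμ : MarginalsAC m₁ μ) :
    Integrable (marginalDensity m₁ μ) m₁ := by
  have h := integrable_fiberIntegral hμ (integrable_const (1 : ℝ))
  have heq : fiberIntegral m₁ μ (fun _ => 1) = marginalDensity m₁ μ :=
    funext fun γ => (fiberIntegral_comp_fst μ (fun _ => 1) γ).trans (one_mul _)
  rwa [heq] at h

theorem apply_preimage_fst_eq_setIntegral_marginalDensity (hμ : MarginalsAC m₁ μ) {B : Set M}
    (hB : MeasurableSet B) : μ (Prod.fst ⁻¹' B) = ∫ γ in B, marginalDensity m₁ μ γ ∂m₁ := by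
  simpa using setIntegral_comp_fst hμ (ψ := fun _ => 1) (integrable_const _) hB

theorem marginalDensity_ae_eq (hμ : MarginalsAC m₁ μ) {h : M → ℝ} (hh : Integrable h m₁)
    (hB : ∀ B, MeasurableSet B → μ (Prod.fst ⁻¹' B) = ∫ γ in B, h γ ∂m₁) :
    marginalDensity m₁ μ =ᵐ[m₁] h :=
  (integrable_marginalDensity hμ).ae_eq_of_forall_setIntegral_eq _ _ hh fun B hBm _ => by
    rw [← hB B hBm, apply_preimage_fst_eq_setIntegral_marginalDensity hμ hBm]

theorem marginalDensity_smul (hμ : MarginalsAC m₁ μ) (c : ℝ) :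
    marginalDensity m₁ (c • μ) =ᵐ[m₁] c • marginalDensity m₁ μ :=
  marginalDensity_ae_eq (marginalsAC_smul m₁ c hμ) ((integrable_marginalDensity hμ).smul c)
    fun B hB => by
      simp only [smul_apply, Pi.smul_apply, smul_eq_mul, integral_const_mul,
        apply_preimage_fst_eq_setIntegral_marginalDensity hμ hB]

theorem apply_univ_eq_integral (hμ : MarginalsAC m₁ μ) {k : M → ℝ}
    (hk : marginalDensity m₁ μ =ᵐ[m₁] k) : μ Set.univ = ∫ x, k x ∂m₁ := by
  have := apply_preimage_fst_eq_setIntegral_marginalDensity hμ MeasurableSet.univ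
  rw [Set.preimage_univ, setIntegral_univ] at this
  rw [this, integral_congr_ae hk]

end Fibers

section WeakBound

theorem holderWith_iff_holderBound {X : Type*} [MetricSpace X] {C ζ : ℝ≥0} {g : X → ℝ} :
    HolderWith C ζ g ↔ HolderBound ζ C g := by
  refine forall₂_congr fun x y => ?_
  rw [edist_dist, edist_dist, Real.dist_eq,
    ENNReal.ofReal_rpow_of_nonneg dist_nonneg ζ.coe_nonneg, ← ENNReal.ofReal_coe_nnreal,
    ← ENNReal.ofReal_mul C.coe_nonneg]
  exact ENNReal.ofReal_le_ofReal_iff (mul_nonneg C.coe_nonneg (Real.rpow_nonneg dist_nonneg _))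

theorem HolderBound.continuous {X : Type*} [MetricSpace X] {ζ C : ℝ} {g : X → ℝ}
    (hg : HolderBound ζ C g) (hζ : 0 < ζ) : Continuous g :=
  ((holderWith_iff_holderBound (C := C.toNNReal) (ζ := ⟨ζ, hζ.le⟩)).2
    (hg.mono (Real.le_coe_toNNReal C))).continuous hζ

variable {M K : Type*} [MeasurableSpace M] [MetricSpace K] [MeasurableSpace K]
  {m₁ : Measure M} {ζ : ℝ≥0} {R C : ℝ}

theorem continuous_integral_continuousMap {X : Type*} [TopologicalSpace X] [CompactSpace X]
    [MeasurableSpace X] [BorelSpace X] (a : Measure X) [IsFiniteMeasure a] :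
    Continuous fun g : C(X, ℝ) => ∫ y, g y ∂a := by
  have h := continuous_integral.comp (ContinuousMap.toLp (E := ℝ) 1 a ℝ).continuous
  exact h.congr fun g => integral_congr_ae (ContinuousMap.coeFn_toLp a g)

/-- Test functions on `M × K` which are `ζ`-Hölder with constant `1` along the fibres `{x} × K` and
bounded by `R`. -/
structure FiberTest (ζ R : ℝ) (Φ : M × K → ℝ) : Prop where
  measurable : Measurable Φ
  holder : ∀ x, HolderBound ζ 1 fun z => Φ (x, z)
  bound : ∀ p, |Φ p| ≤ R

theorem FiberTest.integrable {ζ R : ℝ} {Φ : M × K → ℝ} (hΦ : FiberTest ζ R Φ) (μ : Measure (M × K))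
    [IsFiniteMeasure μ] : Integrable Φ μ :=
  Integrable.of_bound hΦ.measurable.aestronglyMeasurable R (ae_of_all _ hΦ.bound)

/-- The bound `‖μ‖_∞ ≤ C` in dual form; allowing the test functions to reach the height `R` gives
room for the test functions produced by the contraction along the fibres. -/
def WeakBound (m₁ : Measure M) (ζ R C : ℝ) (μ : SignedMeasure (M × K)) : Prop :=
  ∀ (B : Set M) (Φ : M × K → ℝ), MeasurableSet B → FiberTest ζ R Φ →
    |∫ᵛ p in Prod.fst ⁻¹' B, Φ p ∂<•μ| ≤ C * m₁.real B

theorem wassDist_le_ofReal_iff {a b : Measure K} (hC : 0 ≤ C) :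
    wassDist ζ a b ≤ ENNReal.ofReal C ↔ ∀ g : K → ℝ, HolderBound ζ 1 g → (∀ y, |g y| ≤ 1) →
      |∫ y, g y ∂a - ∫ y, g y ∂b| ≤ C := by
  simp only [wassDist, iSup_le_iff, Real.enorm_eq_ofReal_abs, ENNReal.ofReal_le_ofReal_iff hC,
    holderWith_iff_holderBound, NNReal.coe_one]

variable [CompactSpace K] [Nonempty K] [BorelSpace K] [IsFiniteMeasure m₁]
  {μ : SignedMeasure (M × K)}

theorem weakBound_of_linftyNorm_le (hμ : MarginalsAC m₁ μ) (hC : 0 ≤ C)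
    (h : linftyNorm m₁ ζ μ ≤ ENNReal.ofReal C) : WeakBound m₁ ζ 1 C μ := by
  intro B Φ hB hΦ
  rw [← setIntegral_fiberIntegral hμ (hΦ.integrable _) hB, ← Real.norm_eq_abs, measureReal_def]
  refine norm_setIntegral_le_of_norm_le_const_ae (measure_lt_top _ _) ?_
  refine ae_restrict_of_ae ?_
  filter_upwards [ENNReal.ae_le_essSup (μ := m₁) (fun γ => wassDist ζ
    (fiberRestriction m₁ μ.toJordanDecomposition.posPart γ)
    (fiberRestriction m₁ μ.toJordanDecomposition.negPart γ))] with γ hγ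
  exact (wassDist_le_ofReal_iff hC).1 (hγ.trans h) _ (hΦ.holder γ) fun z => hΦ.bound (γ, z)

theorem WeakBound.ae_abs_fiberIntegral_le (h : WeakBound m₁ ζ R C μ) (hμ : MarginalsAC m₁ μ)
    {Φ : M × K → ℝ} (hΦ : FiberTest ζ R Φ) : ∀ᵐ γ ∂m₁, |fiberIntegral m₁ μ Φ γ| ≤ C := by
  have hI := integrable_fiberIntegral hμ (hΦ.integrable _)
  have hset : ∀ B, MeasurableSet B → |∫ γ in B, fiberIntegral m₁ μ Φ γ ∂m₁| ≤ C * m₁.real B :=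
    fun B hB => setIntegral_fiberIntegral hμ (hΦ.integrable _) hB ▸ h B Φ hB hΦ
  have hle : fiberIntegral m₁ μ Φ ≤ᵐ[m₁] fun _ => C :=
    ae_le_of_forall_setIntegral_le hI (integrable_const C) fun B hB _ => by
      rw [setIntegral_const, smul_eq_mul, mul_comm]
      exact (abs_le.1 (hset B hB)).2
  have hge : (fun _ => -C) ≤ᵐ[m₁] fiberIntegral m₁ μ Φ :=
    ae_le_of_forall_setIntegral_le (integrable_const _) hI fun B hB _ => by
      rw [setIntegral_const, smul_eq_mul, mul_neg, mul_comm]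
      exact (abs_le.1 (hset B hB)).1
  filter_upwards [hle, hge] with γ h1 h2 using abs_le.2 ⟨h2, h1⟩

theorem linftyNorm_le_of_weakBound (hζ : 0 < ζ) (hC : 0 ≤ C) (hμ : MarginalsAC m₁ μ)
    (h : WeakBound m₁ ζ 1 C μ) : linftyNorm m₁ ζ μ ≤ ENNReal.ofReal C := by
  let T : Set C(K, ℝ) := {g | HolderBound ζ 1 g ∧ ∀ y, |g y| ≤ 1}
  obtain ⟨S, hST, hScount, hSdense⟩ :=
    (TopologicalSpace.IsSeparable.of_separableSpace T).exists_countable_dense_subset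
  have htest : ∀ g ∈ S, FiberTest ζ 1 fun p : M × K => g p.2 := fun g hg =>
    ⟨g.continuous.measurable.comp measurable_snd, fun _ => (hST hg).1, fun p => (hST hg).2 p.2⟩
  refine essSup_le_of_ae_le _ ?_
  filter_upwards [(ae_ball_iff hScount).2 fun g hg => h.ae_abs_fiberIntegral_le hμ (htest g hg),
    ae_isFiniteMeasure_fiberRestriction m₁ μ.toJordanDecomposition.posPart,
    ae_isFiniteMeasure_fiberRestriction m₁ μ.toJordanDecomposition.negPart] with γ hγ _ _
  refine (wassDist_le_ofReal_iff hC).2 fun g hg hbound => ?_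
  have hclosed : IsClosed {g : C(K, ℝ) |
      |∫ y, g y ∂fiberRestriction m₁ μ.toJordanDecomposition.posPart γ
        - ∫ y, g y ∂fiberRestriction m₁ μ.toJordanDecomposition.negPart γ| ≤ C} :=
    isClosed_le ((continuous_integral_continuousMap _).sub
      (continuous_integral_continuousMap _)).abs continuous_const
  exact closure_minimal hγ hclosed (hSdense (show ⟨g, hg.continuous hζ⟩ ∈ T from ⟨hg, hbound⟩))

end WeakBound

section Push

theorem ContractsFibers.mono {M K : Type*} [MeasurableSpace M] [MetricSpace K] {m₁ : Measure M}
    {G : M × K → K} {α α' : ℝ} (h : ContractsFibers m₁ G α) (hα : α ≤ α') :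
    ContractsFibers m₁ G α' :=
  Filter.Eventually.mono h fun _ hx z z' => (hx z z').trans (by gcongr)

variable {M K : Type*} [MeasurableSpace M] [MeasurableSpace K] {m₁ : Measure M} {f : M → M}
  {G : M × K → K} {μ ν : SignedMeasure (M × K)} {ζ R C α : ℝ}

theorem measurable_skewProduct (hf : Measurable f) (hG : Measurable G) :
    Measurable (skewProduct f G) :=
  (hf.comp measurable_fst).prodMk hG

theorem map_iterate_succ {X : Type*} [MeasurableSpace X] {F : X → X} (hF : Measurable F)
    (μ : SignedMeasure X) (n : ℕ) : μ.map F^[n + 1] = (μ.map F^[n]).map F := by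
  ext E hE
  rw [VectorMeasure.map_apply _ (hF.iterate _) hE, VectorMeasure.map_apply _ hF hE,
    VectorMeasure.map_apply _ (hF.iterate _) (hF hE), Function.iterate_succ', Set.preimage_comp]

section Marginals

variable [StandardBorelSpace K] [Nonempty K]

theorem MarginalsAC.map (hμ : MarginalsAC m₁ μ) (hf : MeasurePreserving f m₁ m₁)
    (hG : Measurable G) : MarginalsAC m₁ (μ.map (skewProduct f G)) := by
  have hF := measurable_skewProduct hf.measurable hG
  rw [marginalsAC_iff] at *
  intro B hB hB0 E hE hEB
  rw [VectorMeasure.map_apply _ hF hE]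
  refine hμ (f ⁻¹' B) (hf.measurable hB) ?_ _ (hF hE) fun p hp => hEB hp
  rw [hf.measure_preimage hB.nullMeasurableSet, hB0]

theorem marginalDensity_map [IsFiniteMeasure m₁] (hμ : MarginalsAC m₁ μ)
    (hf : MeasurePreserving f m₁ m₁) (hG : Measurable G) {k k' : M → ℝ}
    (hk : marginalDensity m₁ μ =ᵐ[m₁] k) (hk' : Integrable k' m₁)
    (hdual : ∀ B, MeasurableSet B → ∫ x in f ⁻¹' B, k x ∂m₁ = ∫ x in B, k' x ∂m₁) :
    marginalDensity m₁ (μ.map (skewProduct f G)) =ᵐ[m₁] k' := by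
  refine marginalDensity_ae_eq (hμ.map hf hG) hk' fun B hB => ?_
  have hfst : skewProduct f G ⁻¹' (Prod.fst ⁻¹' B) = Prod.fst ⁻¹' (f ⁻¹' B) := rfl
  rw [VectorMeasure.map_apply _ (measurable_skewProduct hf.measurable hG) (measurable_fst hB), hfst,
    apply_preimage_fst_eq_setIntegral_marginalDensity hμ (hf.measurable hB), ← hdual B hB]
  exact setIntegral_congr_ae (hf.measurable hB) (hk.mono fun x hx _ => hx)

end Marginals

variable [MetricSpace K]

theorem FiberTest.mono {R' : ℝ} {Φ : M × K → ℝ} (hΦ : FiberTest ζ R Φ) (h : R ≤ R') :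
    FiberTest ζ R' Φ :=
  ⟨hΦ.measurable, hΦ.holder, fun p => (hΦ.bound p).trans h⟩

theorem FiberTest.inv_mul {Φ : M × K → ℝ} (hΦ : FiberTest ζ R Φ) (hR : 1 ≤ R) :
    FiberTest ζ 1 fun p => R⁻¹ * Φ p where
  measurable := hΦ.measurable.const_mul _
  holder x z z' := by
    rw [← mul_sub, abs_mul, abs_of_nonneg (inv_nonneg.2 (zero_le_one.trans hR))]
    exact (mul_le_of_le_one_left (abs_nonneg _) (inv_le_one_of_one_le₀ hR)).trans
      (hΦ.holder x z z')
  bound p := by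
    have hR0 : 0 < R := zero_lt_one.trans_le hR
    rw [abs_mul, abs_of_pos (inv_pos.2 hR0), inv_mul_le_one₀ hR0]
    exact hΦ.bound p

theorem WeakBound.mono {R' C' : ℝ} (h : WeakBound m₁ ζ R C μ) (hR : R' ≤ R) (hC : C ≤ C') :
    WeakBound m₁ ζ R' C' μ := fun B Φ hB hΦ =>
  (h B Φ hB (hΦ.mono hR)).trans (mul_le_mul_of_nonneg_right hC measureReal_nonneg)

theorem WeakBound.scale (h : WeakBound m₁ ζ 1 C μ) (hR : 1 ≤ R) : WeakBound m₁ ζ R (R * C) μ := by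
  intro B Φ hB hΦ
  have hR0 : 0 < R := zero_lt_one.trans_le hR
  have h1 := h B _ hB (hΦ.inv_mul hR)
  rw [signedIntegral_const_mul, abs_mul, abs_of_pos (inv_pos.2 hR0),
    inv_mul_le_iff₀ hR0] at h1
  rwa [mul_assoc]

theorem WeakBound.add {C' : ℝ} (h : WeakBound m₁ ζ R C μ) (h' : WeakBound m₁ ζ R C' ν) :
    WeakBound m₁ ζ R (C + C') (μ + ν) := by
  intro B Φ hB hΦ
  rw [VectorMeasure.restrict_add, VectorMeasure.integral_add_vectorMeasure
    (VectorMeasure.Integrable.restrict (hΦ.integrable _))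
    (VectorMeasure.Integrable.restrict (hΦ.integrable _)), add_mul]
  exact (abs_add_le _ _).trans (add_le_add (h B Φ hB hΦ) (h' B Φ hB hΦ))

theorem WeakBound.smul (h : WeakBound m₁ ζ R C μ) (c : ℝ) :
    WeakBound m₁ ζ R (|c| * C) (c • μ) := by
  intro B Φ hB hΦ
  rw [VectorMeasure.restrict_smul, VectorMeasure.integral_smul_vectorMeasure, smul_eq_mul,
    abs_mul, mul_assoc]
  exact mul_le_mul_of_nonneg_left (h B Φ hB hΦ) (abs_nonneg _)

/-- The test function `α ^ (-ζ) * (Φ ∘ F - Φ ∘ F (·, z₀))` over the base points in `X`; the factor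
`α ^ (-ζ)` is what the contraction along the fibres leaves room for. -/
def pulledTest (f : M → M) (G : M × K → K) (α ζ : ℝ) (X : Set M) (z₀ : K) (Φ : M × K → ℝ) :
    M × K → ℝ :=
  (Prod.fst ⁻¹' X).indicator fun p =>
    (α ^ ζ)⁻¹ * (Φ (skewProduct f G p) - Φ (skewProduct f G (p.1, z₀)))

theorem fiberTest_pulledTest (hf : Measurable f) (hG : Measurable G) (hα : 0 < α) (hζ : 0 ≤ ζ)
    {X : Set M} (hX : MeasurableSet X)
    (hXG : ∀ x ∈ X, ∀ z₁ z₂ : K, dist (G (x, z₁)) (G (x, z₂)) ≤ α * dist z₁ z₂)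
    (hdiam : ∀ z z' : K, dist z z' ^ ζ ≤ R) (z₀ : K) {Φ : M × K → ℝ} (hΦ : FiberTest ζ R Φ) :
    FiberTest ζ R (pulledTest f G α ζ X z₀ Φ) := by
  have hF := measurable_skewProduct hf hG
  have hα' : 0 < α ^ ζ := Real.rpow_pos_of_pos hα ζ
  have hvar : ∀ x ∈ X, ∀ z z', |(α ^ ζ)⁻¹ * (Φ (f x, G (x, z)) - Φ (f x, G (x, z')))|
      ≤ dist z z' ^ ζ := by
    intro x hx z z'
    rw [abs_mul, abs_of_pos (inv_pos.2 hα'), inv_mul_le_iff₀ hα', ← Real.mul_rpow hα.le dist_nonneg]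
    refine (hΦ.holder (f x) (G (x, z)) (G (x, z'))).trans ?_
    rw [one_mul]
    exact Real.rpow_le_rpow dist_nonneg (hXG x hx z z') hζ
  refine ⟨?_, fun x z z' => ?_, fun ⟨x, z⟩ => ?_⟩
  · have hbase : Measurable fun p : M × K => Φ (skewProduct f G (p.1, z₀)) :=
      hΦ.measurable.comp (hF.comp (measurable_fst.prodMk measurable_const))
    exact (((hΦ.measurable.comp hF).sub hbase).const_mul _).indicator (measurable_fst hX)
  · by_cases hx : x ∈ X
    · simp only [pulledTest, Set.indicator, Set.mem_preimage, hx, if_true, skewProduct]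
      rw [one_mul, ← mul_sub, sub_sub_sub_cancel_right]
      exact hvar x hx z z'
    · simp only [pulledTest, Set.indicator, Set.mem_preimage, hx, if_false, sub_self, abs_zero]
      exact mul_nonneg zero_le_one (Real.rpow_nonneg dist_nonneg _)
  · by_cases hx : x ∈ X
    · simp only [pulledTest, Set.indicator, Set.mem_preimage, hx, if_true, skewProduct]
      exact (hvar x hx z z₀).trans (hdiam z z₀)
    · simp only [pulledTest, Set.indicator, Set.mem_preimage, hx, if_false, abs_zero]
      exact (Real.rpow_nonneg dist_nonneg _).trans (hdiam z z₀)

variable [StandardBorelSpace K] [Nonempty K] [IsFiniteMeasure m₁]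

theorem setIntegral_map_skewProduct (hμ : MarginalsAC m₁ μ) (hf : MeasurePreserving f m₁ m₁)
    (hG : Measurable G) (hα : 0 < α) (hζ : 0 ≤ ζ) {X : Set M} (hX : MeasurableSet X)
    (hXm : ∀ᵐ x ∂m₁, x ∈ X)
    (hXG : ∀ x ∈ X, ∀ z₁ z₂ : K, dist (G (x, z₁)) (G (x, z₂)) ≤ α * dist z₁ z₂)
    (hdiam : ∀ z z' : K, dist z z' ^ ζ ≤ R) (z₀ : K) {Φ : M × K → ℝ} (hΦ : FiberTest ζ R Φ)
    {B : Set M} (hB : MeasurableSet B) :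
    ∫ᵛ p in Prod.fst ⁻¹' B, Φ p ∂<•(μ.map (skewProduct f G))
      = α ^ ζ * ∫ᵛ p in Prod.fst ⁻¹' (f ⁻¹' B), pulledTest f G α ζ X z₀ Φ p ∂<•μ
        + ∫ x in f ⁻¹' B, Φ (skewProduct f G (x, z₀)) * marginalDensity m₁ μ x ∂m₁ := by
  have hF := measurable_skewProduct hf.measurable hG
  have hbase : Integrable (fun p : M × K => Φ (skewProduct f G (p.1, z₀))) μ.variation :=
    Integrable.of_bound (hΦ.measurable.comp
      (hF.comp (measurable_fst.prodMk measurable_const))).aestronglyMeasurable R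
      (ae_of_all _ fun _ => hΦ.bound _)
  have hΨ := fiberTest_pulledTest hf.measurable hG hα hζ hX hXG hdiam z₀ hΦ
  have hΨ' : Integrable (fun p => α ^ ζ * pulledTest f G α ζ X z₀ Φ p) μ.variation :=
    (hΨ.integrable _).const_mul (α ^ ζ)
  have hsplit : ∀ᵐ p ∂μ.variation, Φ (skewProduct f G p)
      = α ^ ζ * pulledTest f G α ζ X z₀ Φ p + Φ (skewProduct f G (p.1, z₀)) := by
    filter_upwards [hμ.ae_of_ae_fst hXm] with p hp
    rw [pulledTest, Set.indicator_of_mem (by exact hp),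
      mul_inv_cancel_left₀ (Real.rpow_pos_of_pos hα ζ).ne', sub_add_cancel]
  have hcomp : Integrable (fun p => Φ (skewProduct f G p)) μ.variation :=
    Integrable.of_bound (hΦ.measurable.comp hF).aestronglyMeasurable R
      (ae_of_all _ fun _ => hΦ.bound _)
  calc ∫ᵛ p in Prod.fst ⁻¹' B, Φ p ∂<•(μ.map (skewProduct f G))
      = ∫ᵛ p in Prod.fst ⁻¹' (f ⁻¹' B), Φ (skewProduct f G p) ∂<•μ :=
        VectorMeasure.setIntegral_map hF (measurable_fst hB)
          hΦ.measurable.aestronglyMeasurable hcomp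
    _ = ∫ᵛ p in Prod.fst ⁻¹' (f ⁻¹' B), (α ^ ζ * pulledTest f G α ζ X z₀ Φ p
          + Φ (skewProduct f G (p.1, z₀))) ∂<•μ :=
        VectorMeasure.setIntegral_congr_ae (hsplit.mono fun p hp _ => hp)
    _ = _ := by
        rw [signedSetIntegral_add hΨ' hbase, signedIntegral_const_mul,
          setIntegral_comp_fst (ψ := fun x => Φ (skewProduct f G (x, z₀))) hμ hbase
            (hf.measurable hB)]

theorem WeakBound.map (h : WeakBound m₁ ζ R C μ) (hμ : MarginalsAC m₁ μ)
    (hf : MeasurePreserving f m₁ m₁) (hG : Measurable G) (hα : 0 < α) (hζ : 0 ≤ ζ)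
    (hcontr : ContractsFibers m₁ G α) (hdiam : ∀ z z' : K, dist z z' ^ ζ ≤ R) {s : ℝ}
    (hs : ∀ᵐ x ∂m₁, |marginalDensity m₁ μ x| ≤ s) :
    WeakBound m₁ ζ R (α ^ ζ * C + R * s) (μ.map (skewProduct f G)) := by
  intro B Φ hB hΦ
  obtain ⟨X, hXm, hX, hXG⟩ := hcontr.exists_measurable_mem
  let z₀ : K := Classical.arbitrary K
  have hmB : m₁.real (f ⁻¹' B) = m₁.real B := hf.measureReal_preimage hB.nullMeasurableSet
  have hcontracted := h (f ⁻¹' B) _ (hf.measurable hB)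
    (fiberTest_pulledTest hf.measurable hG hα hζ hX hXG hdiam z₀ hΦ)
  have hbase : |∫ x in f ⁻¹' B, Φ (skewProduct f G (x, z₀)) * marginalDensity m₁ μ x ∂m₁|
      ≤ R * s * m₁.real (f ⁻¹' B) := by
    rw [← Real.norm_eq_abs]
    refine norm_setIntegral_le_of_norm_le_const_ae (measure_lt_top m₁ _) (ae_restrict_of_ae ?_)
    filter_upwards [hs] with x hx
    rw [Real.norm_eq_abs, abs_mul]
    exact mul_le_mul (hΦ.bound _) hx (abs_nonneg _) ((abs_nonneg _).trans (hΦ.bound (x, z₀)))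
  rw [setIntegral_map_skewProduct hμ hf hG hα hζ hX hXm hXG hdiam z₀ hΦ hB, ← hmB, add_mul,
    mul_assoc]
  refine (abs_add_le _ _).trans (add_le_add ?_ hbase)
  rw [abs_mul, abs_of_pos (Real.rpow_pos_of_pos hα ζ)]
  exact mul_le_mul_of_nonneg_left hcontracted (Real.rpow_nonneg hα.le ζ)

/-- One step multiplies the weak bound by `α ^ ζ` and adds `R` times the bound `c * ξ ^ n` on the
marginal density; since `α ^ ζ < ξ`, the geometric rate `ξ` survives. -/
theorem WeakBound.map_iterate {α R c ξ K₀ : ℝ} (h : WeakBound m₁ ζ R (K₀ * C) μ)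
    (hf : MeasurePreserving f m₁ m₁) (hG : Measurable G) (hα : 0 < α) (hζ : 0 ≤ ζ)
    (hcontr : ContractsFibers m₁ G α) (hdiam : ∀ z z' : K, dist z z' ^ ζ ≤ R)
    (hac : ∀ n, MarginalsAC m₁ (μ.map (skewProduct f G)^[n]))
    (hdensity : ∀ n, ∀ᵐ x ∂m₁,
      |marginalDensity m₁ (μ.map (skewProduct f G)^[n]) x| ≤ c * ξ ^ n * C)
    (hξ : 0 ≤ ξ) (hC : 0 ≤ C) (hK₀ : R * c ≤ K₀ * (ξ - α ^ ζ)) (n : ℕ) :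
    WeakBound m₁ ζ R (K₀ * ξ ^ n * C) (μ.map (skewProduct f G)^[n]) := by
  induction n with
  | zero => simpa using h
  | succ n ih =>
    rw [map_iterate_succ (measurable_skewProduct hf.measurable hG)]
    refine (ih.map (hac n) hf hG hα hζ hcontr hdiam (hdensity n)).mono le_rfl ?_
    calc α ^ ζ * (K₀ * ξ ^ n * C) + R * (c * ξ ^ n * C)
        = α ^ ζ * (K₀ * ξ ^ n * C) + R * c * (ξ ^ n * C) := by ring
      _ ≤ α ^ ζ * (K₀ * ξ ^ n * C) + K₀ * (ξ - α ^ ζ) * (ξ ^ n * C) := by gcongr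
      _ = K₀ * ξ ^ (n + 1) * C := by ring

end Push

section Separation

variable {K : Type*} [MetricSpace K] {ζ : ℝ}

theorem exists_holderBound_one_mul (hζ0 : 0 ≤ ζ) (hζ1 : ζ ≤ 1) {g : K → ℝ} {L : ℝ≥0}
    (hL : LipschitzWith L g) (h0 : ∀ y, 0 ≤ g y) (h1 : ∀ y, g y ≤ 1) :
    ∃ c : ℝ, 0 < c ∧ HolderBound ζ 1 (fun y => c * g y) ∧ ∀ y, |c * g y| ≤ 1 := by
  have hc0 : 0 < (1 + (L : ℝ))⁻¹ := by positivity
  have hc1 : (1 + (L : ℝ))⁻¹ ≤ 1 := inv_le_one_of_one_le₀ (by simp)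
  refine ⟨(1 + L)⁻¹, hc0, fun x y => ?_, fun y => ?_⟩
  · rw [one_mul, ← mul_sub, abs_mul, abs_of_pos hc0, inv_mul_le_iff₀ (by positivity)]
    rcases le_total (dist x y) 1 with h | h
    · calc |g x - g y| ≤ L * dist x y := hL.dist_le_mul x y
        _ ≤ (1 + L) * dist x y ^ ζ := by
          gcongr
          · linarith
          · exact Real.self_le_rpow_of_le_one dist_nonneg h hζ1
    · calc |g x - g y| ≤ 1 := abs_le.2 ⟨by linarith [h0 x, h1 y], by linarith [h0 y, h1 x]⟩
        _ ≤ (1 + L) * dist x y ^ ζ :=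
          one_le_mul_of_one_le_of_one_le (by linarith) (Real.one_le_rpow h hζ0)
  · rw [abs_of_nonneg (mul_nonneg hc0.le (h0 y))]
    exact mul_le_one₀ hc1 (h0 y) (h1 y)

variable {M : Type*} [MeasurableSpace M] [MeasurableSpace K] [BorelSpace K]

theorem measure_eq_of_forall_holderBound (hζ0 : 0 ≤ ζ) (hζ1 : ζ ≤ 1) {a b : Measure K}
    [IsFiniteMeasure a] [IsFiniteMeasure b]
    (h : ∀ g : K → ℝ, Measurable g → HolderBound ζ 1 g → (∀ y, |g y| ≤ 1) →
      ∫ y, g y ∂a = ∫ y, g y ∂b) : a = b := by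
  have lipschitz : ∀ (g : K → ℝ) (L : ℝ≥0), LipschitzWith L g → (∀ y, 0 ≤ g y) →
      (∀ y, g y ≤ 1) → ∫ y, g y ∂a = ∫ y, g y ∂b := by
    intro g L hL h0 h1
    obtain ⟨c, hc, hH, hb⟩ := exists_holderBound_one_mul hζ0 hζ1 hL h0 h1
    have := h _ (hL.continuous.measurable.const_mul c) hH hb
    rw [integral_const_mul, integral_const_mul] at this
    exact mul_left_cancel₀ hc.ne' this
  have closed : ∀ A : Set K, IsClosed A → a A = b A := by
    intro A hA
    have hδ : ∀ n : ℕ, (0 : ℝ) < 1 / (n + 1) := fun n => by positivity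
    have hlim : ∀ (m : Measure K) [IsFiniteMeasure m], Filter.Tendsto
        (fun n => ∫ y, (thickenedIndicator (hδ n) A y : ℝ) ∂m) Filter.atTop (nhds (m.real A)) :=
      fun m _ => tendsto_integral_thickenedIndicator_of_isClosed m hA hδ
        tendsto_one_div_add_atTop_nhds_zero_nat
    refine (ENNReal.toReal_eq_toReal_iff' (measure_ne_top _ _) (measure_ne_top _ _)).1
      (tendsto_nhds_unique (hlim a) ((hlim b).congr fun n => ?_))
    exact (lipschitz _ _ (lipschitzWith_thickenedIndicator (hδ n) A) (fun _ => NNReal.coe_nonneg _)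
      fun y => by exact_mod_cast thickenedIndicator_le_one (hδ n) A y).symm
  refine ext_of_generate_finite _ ?_ isPiSystem_isClosed closed (closed _ isClosed_univ)
  rw [BorelSpace.measurable_eq (α := K), borel_eq_generateFrom_isClosed]

theorem measure_eq_of_forall_fiberTest (hζ0 : 0 ≤ ζ) (hζ1 : ζ ≤ 1) {a b : Measure (M × K)}
    [IsFiniteMeasure a] [IsFiniteMeasure b]
    (h : ∀ Φ : M × K → ℝ, FiberTest ζ 1 Φ → ∫ p, Φ p ∂a = ∫ p, Φ p ∂b) : a = b := by
  refine Measure.ext_prod fun {s t} hs ht => ?_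
  have hst : ∀ m : Measure (M × K), m (s ×ˢ t) = (m.restrict (Prod.fst ⁻¹' s)).map Prod.snd t :=
    fun m => by
      rw [Measure.map_apply measurable_snd ht, Measure.restrict_apply (measurable_snd ht),
        Set.inter_comm]
      rfl
  suffices hmarg : (a.restrict (Prod.fst ⁻¹' s)).map Prod.snd =
      (b.restrict (Prod.fst ⁻¹' s)).map Prod.snd by rw [hst, hst, hmarg]
  refine measure_eq_of_forall_holderBound hζ0 hζ1 fun g hgm hg hb => ?_
  rw [integral_map measurable_snd.aemeasurable hgm.aestronglyMeasurable,
    integral_map measurable_snd.aemeasurable hgm.aestronglyMeasurable,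
    ← integral_indicator (measurable_fst hs), ← integral_indicator (measurable_fst hs)]
  refine h _ ⟨(hgm.comp measurable_snd).indicator (measurable_fst hs), fun x => ?_, fun p => ?_⟩
  · by_cases hx : x ∈ s
    · simpa [Set.indicator, hx] using hg
    · intro z z'
      simpa [Set.indicator, hx] using Real.rpow_nonneg dist_nonneg ζ
  · exact (norm_indicator_le_norm_self (fun p : M × K => g p.2) p).trans (hb p.2)

theorem eq_zero_of_weakBound_zero (hζ0 : 0 ≤ ζ) (hζ1 : ζ ≤ 1) {m₁ : Measure M}
    {μ : SignedMeasure (M × K)} (h : WeakBound m₁ ζ 1 0 μ) : μ = 0 := by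
  have hparts : μ.toJordanDecomposition.posPart = μ.toJordanDecomposition.negPart :=
    measure_eq_of_forall_fiberTest hζ0 hζ1 fun Φ hΦ => by
      have := h Set.univ Φ MeasurableSet.univ hΦ
      rwa [Set.preimage_univ, VectorMeasure.restrict_univ, signedIntegral_eq_sub (hΦ.integrable _),
        zero_mul, abs_nonpos_iff, sub_eq_zero] at this
  rw [← μ.toSignedMeasure_toJordanDecomposition, JordanDecomposition.toSignedMeasure,
    Measure.toSignedMeasure_congr hparts, sub_self]

end Separation

section StableConvergence

open Filter Topology

section Sections

variable {M K : Type*} [MeasurableSpace M] [TopologicalSpace K] [CompactSpace K]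
  [MeasurableSpace K]

theorem abs_integral_sub_eval_le {Ψ u : M → C(K, ℝ)} {m : Measure (M × K)} {Φ v : M × K → ℝ}
    (hΦ : Integrable Φ m) (hv : Integrable v m) (hΨΦ : ∀ p : M × K, Ψ p.1 p.2 = Φ p)
    (huv : ∀ p : M × K, u p.1 p.2 = v p) (hI : Integrable (fun x => ‖Ψ x - u x‖) m.fst) :
    |∫ p, Φ p ∂m - ∫ p, v p ∂m| ≤ ∫ x, ‖Ψ x - u x‖ ∂m.fst := by
  rw [← integral_sub hΦ hv, ← Real.norm_eq_abs, Measure.fst,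
    integral_map measurable_fst.aemeasurable hI.1]
  refine norm_integral_le_of_norm_le (hI.comp_measurable measurable_fst) (ae_of_all _ fun p => ?_)
  rw [← hΨΦ, ← huv]
  exact ContinuousMap.norm_coe_le_norm (Ψ p.1 - u p.1) p.2

variable [TopologicalSpace.MetrizableSpace K]

theorem stronglyMeasurable_sections {Φ : M × K → ℝ} (hΦ : Measurable Φ)
    (hc : ∀ x, Continuous fun z => Φ (x, z)) :
    StronglyMeasurable fun x => (⟨fun z => Φ (x, z), hc x⟩ : C(K, ℝ)) := by
  rcases isEmpty_or_nonempty K with hK | hK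
  · exact stronglyMeasurable_const' fun _ _ => Subsingleton.elim _ _
  borelize C(K, ℝ)
  let eval : C(K, ℝ) → ℕ → ℝ := fun g n => g (TopologicalSpace.denseSeq K n)
  have heval : Measurable eval :=
    measurable_pi_lambda _ fun n => (continuous_eval_const _).measurable
  have hinj : Function.Injective eval := fun g g' h => ContinuousMap.coe_injective
    ((TopologicalSpace.denseRange_denseSeq K).equalizer g.continuous g'.continuous h)
  have hsection : Measurable fun x => (⟨fun z => Φ (x, z), hc x⟩ : C(K, ℝ)) :=
    (heval.measurableEmbedding hinj).measurable_comp_iff.1 (measurable_pi_lambda _ fun n =>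
      hΦ.comp (measurable_id.prodMk measurable_const))
  exact hsection.stronglyMeasurable

end Sections

variable {M K : Type*} [MetricSpace M] [MeasurableSpace M] [BorelSpace M] [MetricSpace K]
  [CompactSpace K] [MeasurableSpace K] [BorelSpace K] {m₁ : Measure M}

theorem fst_eq_of_tendsto {ι : Type*} {l : Filter ι} [l.NeBot] {ν : ι → ProbabilityMeasure (M × K)}
    {μ : ProbabilityMeasure (M × K)} (h : Tendsto ν l (𝓝 μ))
    (hν : ∀ i, (ν i : Measure (M × K)).fst = m₁) : (μ : Measure (M × K)).fst = m₁ := by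
  have hlim := ProbabilityMeasure.tendsto_map_of_tendsto_of_continuous ν μ h continuous_fst
  obtain ⟨i⟩ := l.nonempty_of_neBot
  have hconst : ∀ j, (ν j).map continuous_fst.measurable.aemeasurable
      = (ν i).map continuous_fst.measurable.aemeasurable := fun j =>
    ProbabilityMeasure.toMeasure_injective ((hν j).trans (hν i).symm)
  simp only [hconst] at hlim
  exact (congrArg ProbabilityMeasure.toMeasure
    (tendsto_nhds_unique hlim tendsto_const_nhds)).trans (hν i)

variable [CompactSpace M]

theorem tendsto_integral_of_fst_eq [IsFiniteMeasure m₁] {ι : Type*} {l : Filter ι}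
    {ν : ι → ProbabilityMeasure (M × K)} {μ : ProbabilityMeasure (M × K)} (h : Tendsto ν l (𝓝 μ))
    (hν : ∀ i, (ν i : Measure (M × K)).fst = m₁) (hμ : (μ : Measure (M × K)).fst = m₁)
    {Φ : M × K → ℝ} (hΦ : Measurable Φ) {R : ℝ} (hR : ∀ p, |Φ p| ≤ R)
    (hc : ∀ x, Continuous fun z => Φ (x, z)) :
    Tendsto (fun i => ∫ p, Φ p ∂(ν i : Measure (M × K))) l
      (𝓝 (∫ p, Φ p ∂(μ : Measure (M × K)))) := by
  let Ψ : M → C(K, ℝ) := fun x => ⟨fun z => Φ (x, z), hc x⟩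
  have hI : Integrable Ψ m₁ :=
    Integrable.of_bound (stronglyMeasurable_sections hΦ hc).aestronglyMeasurable |R|
      (Eventually.of_forall fun x => (ContinuousMap.norm_le _ (abs_nonneg R)).2 fun z =>
        (hR (x, z)).trans (le_abs_self R))
  have hΦI : ∀ m : ProbabilityMeasure (M × K), Integrable Φ (m : Measure (M × K)) := fun m =>
    Integrable.of_bound hΦ.aestronglyMeasurable R (ae_of_all _ hR)
  rw [Metric.tendsto_nhds]
  intro ε hε
  obtain ⟨u, hu, huI⟩ := hI.exists_boundedContinuous_integral_sub_le (ε := ε / 4) (by linarith)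
  have hvc : Continuous fun p : M × K => u p.1 p.2 :=
    ContinuousEval.continuous_eval.comp ((u.continuous.comp continuous_fst).prodMk continuous_snd)
  let v : BoundedContinuousFunction (M × K) ℝ := BoundedContinuousFunction.mkOfCompact ⟨_, hvc⟩
  have close : ∀ m : ProbabilityMeasure (M × K), (m : Measure (M × K)).fst = m₁ →
      |∫ p, Φ p ∂(m : Measure (M × K)) - ∫ p, v p ∂(m : Measure (M × K))| ≤ ε / 4 := by
    rintro m rfl
    exact (abs_integral_sub_eval_le (hΦI m) (v.integrable _) (fun _ => rfl) (fun _ => rfl)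
      (hI.sub huI).norm).trans hu
  filter_upwards [Metric.tendsto_nhds.1
    (ProbabilityMeasure.tendsto_iff_forall_integral_tendsto.1 h v) (ε / 4) (by linarith)] with i hi
  rw [Real.dist_eq] at hi ⊢
  obtain ⟨h1, h1'⟩ := abs_le.1 (close (ν i) (hν i))
  obtain ⟨h2, h2'⟩ := abs_le.1 (close μ hμ)
  obtain ⟨h3, h3'⟩ := abs_lt.1 hi
  exact abs_lt.2 ⟨by linarith, by linarith⟩

theorem tendsto_integral_of_fst_eq_of_ae_continuous [IsFiniteMeasure m₁] {ι : Type*}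
    {l : Filter ι} {ν : ι → ProbabilityMeasure (M × K)} {μ : ProbabilityMeasure (M × K)}
    (h : Tendsto ν l (𝓝 μ)) (hν : ∀ i, (ν i : Measure (M × K)).fst = m₁)
    (hμ : (μ : Measure (M × K)).fst = m₁) {Φ : M × K → ℝ} (hΦ : Measurable Φ) {R : ℝ}
    (hR : ∀ p, |Φ p| ≤ R) (hc : ∀ᵐ x ∂m₁, Continuous fun z => Φ (x, z)) :
    Tendsto (fun i => ∫ p, Φ p ∂(ν i : Measure (M × K))) l
      (𝓝 (∫ p, Φ p ∂(μ : Measure (M × K)))) := by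
  obtain ⟨X, hX, hXm, hXc⟩ := hc.exists_measurable_mem
  have hcont : ∀ x, Continuous fun z => (Prod.fst ⁻¹' X).indicator Φ (x, z) := by
    intro x
    by_cases hx : x ∈ X
    · simpa [Set.indicator, hx] using hXc x hx
    · simpa [Set.indicator, hx] using continuous_const
  have heq : ∀ m : Measure (M × K), m.fst = m₁ →
      ∫ p, (Prod.fst ⁻¹' X).indicator Φ p ∂m = ∫ p, Φ p ∂m := by
    rintro m rfl
    refine integral_congr_ae ?_
    filter_upwards [ae_of_ae_map measurable_fst.aemeasurable hX] with p hp
    exact Set.indicator_of_mem (by exact hp) Φ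
  have hlim := tendsto_integral_of_fst_eq h hν hμ (hΦ.indicator (measurable_fst hXm))
    (fun p => (norm_indicator_le_norm_self Φ p).trans (hR p)) hcont
  rw [heq _ hμ] at hlim
  exact hlim.congr fun i => heq _ (hν i)

theorem exists_invariant_of_tendsto_sub [IsFiniteMeasure m₁] {f : M → M} {G : M × K → K}
    {ζ α : ℝ} (hζ : 0 < ζ) (hζ1 : ζ ≤ 1) (hf : Measurable f) (hG : Measurable G)
    (hcontr : ContractsFibers m₁ G α) {ν : ℕ → ProbabilityMeasure (M × K)}
    (hν : ∀ n, (ν n : Measure (M × K)).fst = m₁)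
    (hstep : ∀ n, (ν (n + 1) : Measure (M × K)) = (ν n : Measure (M × K)).map (skewProduct f G))
    (hlim : ∀ Φ : M × K → ℝ, FiberTest ζ 1 Φ → Tendsto (fun n =>
      ∫ p, Φ p ∂(ν (n + 1) : Measure (M × K)) - ∫ p, Φ p ∂(ν n : Measure (M × K))) atTop (𝓝 0)) :
    ∃ μ₀ : ProbabilityMeasure (M × K), (μ₀ : Measure (M × K)).map (skewProduct f G) = μ₀ ∧
      (μ₀ : Measure (M × K)).fst = m₁ := by
  have hF := measurable_skewProduct hf hG
  obtain ⟨μ₀, -, hconv⟩ :=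
    isCompact_univ.ultrafilter_le_nhds ((hyperfilter ℕ).map ν) (by simp)
  have hfst : (μ₀ : Measure (M × K)).fst = m₁ := fst_eq_of_tendsto hconv hν
  refine ⟨μ₀, ?_, hfst⟩
  have := Measure.isProbabilityMeasure_map (μ := (μ₀ : Measure (M × K))) hF.aemeasurable
  refine measure_eq_of_forall_fiberTest hζ.le hζ1 fun Φ hΦ => ?_
  have hmap : ∀ m : Measure (M × K),
      ∫ p, Φ p ∂m.map (skewProduct f G) = ∫ p, Φ (skewProduct f G p) ∂m := fun m =>
    integral_map hF.aemeasurable hΦ.measurable.aestronglyMeasurable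
  have hcont : ∀ x, Continuous fun z => Φ (x, z) := fun x => (hΦ.holder x).continuous hζ
  have hlimF := tendsto_integral_of_fst_eq_of_ae_continuous hconv hν hfst
    (hΦ.measurable.comp hF) (fun _ => hΦ.bound _) (Eventually.mono hcontr fun x hx =>
      (hcont (f x)).comp (LipschitzWith.of_dist_le' hx).continuous)
  have hlimΦ := tendsto_integral_of_fst_eq hconv hν hfst hΦ.measurable hΦ.bound hcont
  have hshift := hlimΦ.add ((hlim Φ hΦ).mono_left Nat.hyperfilter_le_atTop)
  rw [add_zero] at hshift
  rw [hmap]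
  refine tendsto_nhds_unique hlimF (hshift.congr fun n => ?_)
  rw [hstep, hmap, add_sub_cancel]
  rfl

end StableConvergence

section SInftyBound

variable {M K : Type*} [MetricSpace M] [MeasurableSpace M] [MetricSpace K] [MeasurableSpace K]
  {m₁ : Measure M} {ζ C C' : ℝ} {μ ν : SignedMeasure (M × K)}

/-- A quantitative form of membership in `S^∞`, in which test functions on the product take the
place of the disintegrations of the Jordan parts. It is equivalent to a bound on the norm up to a
factor `3`, but it is manifestly stable under sums and push-forwards. -/
structure SInftyBound (m₁ : Measure M) (ζ C : ℝ) (μ : SignedMeasure (M × K)) : Prop where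
  ac : MarginalsAC m₁ μ
  weak : WeakBound m₁ ζ 1 C μ
  density : ∃ h : M → ℝ, marginalDensity m₁ μ =ᵐ[m₁] h ∧ (∀ x, |h x| ≤ C) ∧ HolderBound ζ C h

theorem SInftyBound.mono (h : SInftyBound m₁ ζ C μ) (hC : C ≤ C') : SInftyBound m₁ ζ C' μ :=
  let ⟨k, hk, hb, hd⟩ := h.density
  ⟨h.ac, h.weak.mono le_rfl hC, k, hk, fun x => (hb x).trans hC, hd.mono hC⟩

variable [IsProbabilityMeasure m₁]

theorem SInftyBound.nonneg (h : SInftyBound m₁ ζ C μ) : 0 ≤ C := by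
  obtain ⟨x⟩ := nonempty_of_isProbabilityMeasure m₁
  obtain ⟨k, -, hk, -⟩ := h.density
  exact (abs_nonneg _).trans (hk x)

variable [StandardBorelSpace K] [Nonempty K]

theorem SInftyBound.add (h : SInftyBound m₁ ζ C μ) (h' : SInftyBound m₁ ζ C' ν) :
    SInftyBound m₁ ζ (C + C') (μ + ν) := by
  obtain ⟨k, hk, hb, hd⟩ := h.density
  obtain ⟨k', hk', hb', hd'⟩ := h'.density
  refine ⟨marginalsAC_add m₁ h.ac h'.ac, h.weak.add h'.weak, k + k',
    (marginalDensity_add m₁ h.ac h'.ac).trans (hk.add hk'),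
    fun x => (abs_add_le _ _).trans (add_le_add (hb x) (hb' x)), fun x y => ?_⟩
  rw [Pi.add_apply, Pi.add_apply, add_sub_add_comm, add_mul]
  exact (abs_add_le _ _).trans (add_le_add (hd x y) (hd' x y))

theorem SInftyBound.smul (h : SInftyBound m₁ ζ C μ) (c : ℝ) :
    SInftyBound m₁ ζ (|c| * C) (c • μ) := by
  obtain ⟨k, hk, hb, hd⟩ := h.density
  refine ⟨marginalsAC_smul m₁ c h.ac, h.weak.smul c, c • k,
    (marginalDensity_smul h.ac c).trans (hk.const_smul c), fun x => ?_, fun x y => ?_⟩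
  · rw [Pi.smul_apply, smul_eq_mul, abs_mul]
    exact mul_le_mul_of_nonneg_left (hb x) (abs_nonneg _)
  · rw [Pi.smul_apply, Pi.smul_apply, smul_eq_mul, smul_eq_mul, ← mul_sub, abs_mul, mul_assoc]
    exact mul_le_mul_of_nonneg_left (hd x y) (abs_nonneg _)

theorem SInftyBound.sub (h : SInftyBound m₁ ζ C μ) (h' : SInftyBound m₁ ζ C' ν) :
    SInftyBound m₁ ζ (C + C') (μ - ν) := by
  have hneg : (-1 : ℝ) • ν = -ν := by
    ext E _
    simp
  simpa [hneg, sub_eq_add_neg] using h.add (h'.smul (-1))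

theorem SInftyBound.abs_univ_le (h : SInftyBound m₁ ζ C μ) : |μ Set.univ| ≤ C := by
  obtain ⟨k, hk, hb, -⟩ := h.density
  simpa [apply_univ_eq_integral h.ac hk] using
    norm_integral_le_of_norm_le_const (μ := m₁) (f := k) (ae_of_all _ hb)

end SInftyBound

section SInftyNorm

theorem fullHolderNorm_le_of_holderBound {X : Type*} [MetricSpace X] {ζ : ℝ≥0} {C : ℝ}
    (hC : 0 ≤ C) {h : X → ℝ} (hb : ∀ x, |h x| ≤ C) (hd : HolderBound ζ C h) :
    fullHolderNorm ζ h ≤ ENNReal.ofReal (2 * C) := by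
  rw [two_mul, ENNReal.ofReal_add hC hC]
  refine add_le_add ?_ (iSup_le fun x => ?_)
  · lift C to ℝ≥0 using hC
    rw [ENNReal.ofReal_coe_nnreal]
    exact (holderWith_iff_holderBound.2 hd).eHolderNorm_le
  · rw [Real.enorm_eq_ofReal_abs]
    exact ENNReal.ofReal_le_ofReal (hb x)

theorem holderBound_of_fullHolderNorm_le {X : Type*} [MetricSpace X] {ζ : ℝ≥0} {C : ℝ}
    (hC : 0 ≤ C) {h : X → ℝ} (hh : fullHolderNorm ζ h ≤ ENNReal.ofReal C) :
    (∀ x, |h x| ≤ C) ∧ HolderBound ζ C h := by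
  lift C to ℝ≥0 using hC
  rw [ENNReal.ofReal_coe_nnreal] at hh
  have hmem : MemHolder ζ h :=
    eHolderNorm_lt_top.1 ((le_self_add.trans hh).trans_lt ENNReal.coe_lt_top)
  refine ⟨fun x => ?_, holderWith_iff_holderBound.1 (hmem.holderWith.mono ?_)⟩
  · have := (le_iSup (fun x => ‖h x‖ₑ) x).trans (le_add_self.trans hh)
    rw [Real.enorm_eq_ofReal_abs, ← ENNReal.ofReal_coe_nnreal] at this
    exact (ENNReal.ofReal_le_ofReal_iff C.2).1 this
  · rw [← ENNReal.coe_le_coe, hmem.coe_nnHolderNorm_eq_eHolderNorm]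
    exact le_self_add.trans hh

variable {M K : Type*} [MetricSpace M] [MeasurableSpace M] [MetricSpace K] [MeasurableSpace K]
  [CompactSpace K] [Nonempty K] [BorelSpace K] {m₁ : Measure M} {ζ : ℝ≥0} {C : ℝ}
  {μ : SignedMeasure (M × K)}

theorem sInftyBound_of_lt [IsFiniteMeasure m₁] (hμ : MarginalsAC m₁ μ)
    (h : sinftyENorm m₁ ζ μ < ENNReal.ofReal C) : SInftyBound m₁ ζ C μ := by
  have hC : 0 < C := ENNReal.ofReal_pos.1 (zero_le.trans_lt h)
  have hdensity : aeHolderNorm m₁ ζ (marginalDensity m₁ μ) < ENNReal.ofReal C :=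
    le_self_add.trans_lt h
  simp only [aeHolderNorm, iInf_lt_iff] at hdensity
  obtain ⟨k, hk, hlt⟩ := hdensity
  exact ⟨hμ, weakBound_of_linftyNorm_le hμ hC.le (le_add_self.trans h.le), k, hk,
    holderBound_of_fullHolderNorm_le hC.le hlt.le⟩

theorem sInftyBound_of_mem [IsFiniteMeasure m₁] {hζ : 0 < ζ} (h : μ ∈ SInfty m₁ ζ hζ)
    (hC : sinftyNorm m₁ ζ μ < C) : SInftyBound m₁ ζ C μ :=
  sInftyBound_of_lt h.1 ((ENNReal.lt_ofReal_iff_toReal_lt h.2.ne).2 hC)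

theorem sInftyBound_of_fst_eq [IsFiniteMeasure m₁] {μ : Measure (M × K)}
    [IsFiniteMeasure μ] (h : μ.fst = m₁) : SInftyBound m₁ ζ 1 μ.toSignedMeasure := by
  have hreal : ∀ B, MeasurableSet B → μ.real (Prod.fst ⁻¹' B) = m₁.real B := fun B hB => by
    rw [measureReal_def, measureReal_def, ← Measure.fst_apply hB, h]
  have hac : MarginalsAC m₁ μ.toSignedMeasure := by
    refine (marginalsAC_iff _ _).2 fun B hB hB0 E hE hEB => ?_
    rw [Measure.toSignedMeasure_apply_measurable hE]
    refine measureReal_mono_null hEB ?_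
    rw [hreal B hB, measureReal_def, hB0, ENNReal.toReal_zero]
  refine ⟨hac, fun B Φ hB hΦ => ?_, fun _ => 1, ?_, by simp, fun x y => ?_⟩
  · rw [VectorMeasure.setIntegral_toSignedMeasure (hs := measurable_fst hB), one_mul, ← hreal B hB,
      ← Real.norm_eq_abs]
    simpa using norm_setIntegral_le_of_norm_le_const (f := Φ)
      (measure_lt_top μ (Prod.fst ⁻¹' B)) fun p _ => hΦ.bound p
  · refine marginalDensity_ae_eq hac (integrable_const 1) fun B hB => ?_
    rw [Measure.toSignedMeasure_apply_measurable (measurable_fst hB), hreal B hB,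
      setIntegral_const, smul_eq_mul, mul_one]
  · rw [sub_self, abs_zero, one_mul]
    exact Real.rpow_nonneg dist_nonneg _

variable [IsProbabilityMeasure m₁]

theorem SInftyBound.sinftyENorm_le (hζ : 0 < ζ) (h : SInftyBound m₁ ζ C μ) :
    sinftyENorm m₁ ζ μ ≤ ENNReal.ofReal (3 * C) := by
  have hC := h.nonneg
  obtain ⟨k, hk, hb, hd⟩ := h.density
  rw [show 3 * C = 2 * C + C by ring, ENNReal.ofReal_add (by positivity) hC]
  exact add_le_add ((iInf₂_le k hk).trans (fullHolderNorm_le_of_holderBound hC hb hd))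
    (linftyNorm_le_of_weakBound hζ hC h.ac h.weak)

theorem SInftyBound.sinftyNorm_le (hζ : 0 < ζ) (h : SInftyBound m₁ ζ C μ) :
    sinftyNorm m₁ ζ μ ≤ 3 * C :=
  ENNReal.toReal_le_of_le_ofReal (mul_nonneg (by norm_num) h.nonneg) (h.sinftyENorm_le hζ)

theorem SInftyBound.mem_sInfty (hζ : 0 < ζ) (h : SInftyBound m₁ ζ C μ) : μ ∈ SInfty m₁ ζ hζ :=
  ⟨h.ac, (h.sinftyENorm_le hζ).trans_lt ENNReal.ofReal_lt_top⟩

end SInftyNorm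

section FlatteningDual

/-- `T` is dual to the composition with `f`, and it flattens Hölder functions exponentially fast. -/
structure FlatteningDual {M : Type*} [PseudoMetricSpace M] [MeasurableSpace M] (m₁ : Measure M)
    (f : M → M) (ζ : ℝ) (T : (M → ℝ) →ₗ[ℝ] M → ℝ) (κ V : ℝ) : Prop where
  kappa_pos : 0 < κ
  kappa_lt_one : κ < 1
  V_pos : 0 < V
  dual : ∀ C h, HolderBound ζ C h → ∀ B, MeasurableSet B →
    ∫ x in f ⁻¹' B, h x ∂m₁ = ∫ x in B, T h x ∂m₁
  decay : ∀ C h, 0 ≤ C → HolderBound ζ C h → OscBound C h → ∀ n : ℕ,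
    HolderBound ζ (V * κ ^ n * C) ((T ^ n) h) ∧ OscBound (V * κ ^ n * C) ((T ^ n) h)

variable {M : Type*} [MetricSpace M] [MeasurableSpace M] {m₁ : Measure M} {f : M → M}
  {ζ κ V C : ℝ} {T : (M → ℝ) →ₗ[ℝ] M → ℝ} {h : M → ℝ}

theorem FlatteningDual.integral_pow_apply (hT : FlatteningDual m₁ f ζ T κ V) (hC : 0 ≤ C)
    (hh : HolderBound ζ C h) (hosc : OscBound C h) (n : ℕ) :
    ∫ x, (T ^ n) h x ∂m₁ = ∫ x, h x ∂m₁ := by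
  induction n with
  | zero => rfl
  | succ n ih =>
    have := hT.dual _ _ (hT.decay C h hC hh hosc n).1 Set.univ MeasurableSet.univ
    rw [Set.preimage_univ, setIntegral_univ, setIntegral_univ, ih] at this
    rw [pow_succ', Module.End.mul_apply, this]

variable [CompactSpace M] [BorelSpace M] [IsProbabilityMeasure m₁]

theorem HolderBound.integrable {m : Measure M} [IsFiniteMeasure m] (hh : HolderBound ζ C h)
    (hζ : 0 < ζ) : Integrable h m :=
  BoundedContinuousFunction.integrable m
    (BoundedContinuousFunction.mkOfCompact ⟨h, hh.continuous hζ⟩)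

theorem FlatteningDual.abs_pow_apply_le (hT : FlatteningDual m₁ f ζ T κ V) (hζ : 0 < ζ)
    (hC : 0 ≤ C) (hh : HolderBound ζ C h) (hosc : OscBound C h) (h0 : ∫ x, h x ∂m₁ = 0) (n : ℕ)
    (x : M) : |(T ^ n) h x| ≤ V * κ ^ n * C := by
  obtain ⟨hH, hO⟩ := hT.decay C h hC hh hosc n
  have hmean : (T ^ n) h x = ∫ y, ((T ^ n) h x - (T ^ n) h y) ∂m₁ := by
    rw [integral_sub (integrable_const _) (hH.integrable hζ),
      hT.integral_pow_apply hC hh hosc, h0]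
    simp
  rw [hmean, ← Real.norm_eq_abs]
  simpa using norm_integral_le_of_norm_le_const (μ := m₁)
    (f := fun y => (T ^ n) h x - (T ^ n) h y) (ae_of_all _ (hO.abs_sub_le x))

end FlatteningDual

section Decay

/-- The iterates of the push-forward by `F` contract the measures of zero mass in `S^∞` at the
rate `ξ`, up to the factor `Q`. -/
structure MassZeroDecay {M K : Type*} [MetricSpace M] [MeasurableSpace M] [MetricSpace K]
    [MeasurableSpace K] (m₁ : Measure M) (ζ : ℝ) (F : M × K → M × K) (ξ Q : ℝ) : Prop where
  xi_pos : 0 < ξ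
  xi_lt_one : ξ < 1
  const_pos : 0 < Q
  bound : ∀ C μ, SInftyBound m₁ ζ C μ → μ Set.univ = 0 → ∀ n : ℕ,
    SInftyBound m₁ ζ (Q * ξ ^ n * C) (μ.map F^[n])

theorem exists_rpow_dist_le (K : Type*) [PseudoMetricSpace K] [CompactSpace K] {ζ : ℝ}
    (hζ : 0 ≤ ζ) : ∃ R : ℝ, 1 ≤ R ∧ ∀ z z' : K, dist z z' ^ ζ ≤ R :=
  ⟨max 1 (Metric.diam (Set.univ : Set K) ^ ζ), le_max_left _ _, fun z z' =>
    le_max_of_le_right (Real.rpow_le_rpow dist_nonneg (Metric.dist_le_diam_of_mem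
      isCompact_univ.isBounded (Set.mem_univ z) (Set.mem_univ z')) hζ)⟩

variable {M K : Type*} [MetricSpace M] [CompactSpace M] [MeasurableSpace M] [BorelSpace M]
  [MeasurableSpace K] [StandardBorelSpace K] [Nonempty K] {m₁ : Measure M}
  [IsProbabilityMeasure m₁] {f : M → M} {G : M × K → K} {ζ κ V C : ℝ}
  {T : (M → ℝ) →ₗ[ℝ] M → ℝ} {h : M → ℝ} {μ : SignedMeasure (M × K)}

theorem FlatteningDual.marginalDensity_map_iterate (hT : FlatteningDual m₁ f ζ T κ V) (hζ : 0 < ζ)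
    (hf : MeasurePreserving f m₁ m₁) (hG : Measurable G) (hC : 0 ≤ C) (hh : HolderBound ζ C h)
    (hosc : OscBound C h) (hμ : MarginalsAC m₁ μ) (hμh : marginalDensity m₁ μ =ᵐ[m₁] h) (n : ℕ) :
    MarginalsAC m₁ (μ.map (skewProduct f G)^[n]) ∧
      marginalDensity m₁ (μ.map (skewProduct f G)^[n]) =ᵐ[m₁] (T ^ n) h := by
  induction n with
  | zero => simpa using ⟨hμ, hμh⟩
  | succ n ih =>
    rw [map_iterate_succ (measurable_skewProduct hf.measurable hG)]
    refine ⟨ih.1.map hf hG, marginalDensity_map ih.1 hf hG ih.2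
      ((hT.decay C h hC hh hosc (n + 1)).1.integrable hζ) fun B hB => ?_⟩
    rw [pow_succ', Module.End.mul_apply]
    exact hT.dual _ _ (hT.decay C h hC hh hosc n).1 B hB

end Decay

section SkewProductDecay

variable {M K : Type*} [MetricSpace M] [CompactSpace M] [MeasurableSpace M] [BorelSpace M]
  [MetricSpace K] [CompactSpace K] [Nonempty K] [MeasurableSpace K] [BorelSpace K]
  {m₁ : Measure M} [IsProbabilityMeasure m₁] {f : M → M} {G : M × K → K} {ζ κ V C α : ℝ}
  {T : (M → ℝ) →ₗ[ℝ] M → ℝ} {μ : SignedMeasure (M × K)}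

theorem FlatteningDual.sInftyBound_map_iterate {R ξ W : ℝ} (hT : FlatteningDual m₁ f ζ T κ V)
    (hζ : 0 < ζ) (hf : MeasurePreserving f m₁ m₁) (hG : Measurable G) (hα : 0 < α)
    (hcontr : ContractsFibers m₁ G α) (hR1 : 1 ≤ R) (hR : ∀ z z' : K, dist z z' ^ ζ ≤ R)
    (hκξ : κ ≤ ξ) (hRW : R ≤ W) (hW : R * (2 * V) ≤ W * (ξ - α ^ ζ))
    (hμ : SInftyBound m₁ ζ C μ) (h0 : μ Set.univ = 0) (n : ℕ) :
    SInftyBound m₁ ζ ((W + 2 * V) * ξ ^ n * C) (μ.map (skewProduct f G)^[n]) := by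
  have hC := hμ.nonneg
  have hκ0 := hT.kappa_pos
  have hξ0 : 0 < ξ := hκ0.trans_le hκξ
  have hV := hT.V_pos
  obtain ⟨h, hh, hb, hd⟩ := hμ.density
  have hosc : OscBound (2 * C) h := .of_abs_le hb
  replace hd : HolderBound ζ (2 * C) h := hd.mono (by linarith)
  have hrate : ∀ n, V * κ ^ n * (2 * C) ≤ 2 * V * ξ ^ n * C := fun n => by
    rw [← mul_assoc, mul_right_comm V, mul_comm V]
    gcongr
  have hdensity := hT.marginalDensity_map_iterate hζ hf hG (by positivity) hd hosc hμ.ac hh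
  have hsup : ∀ n x, |(T ^ n) h x| ≤ 2 * V * ξ ^ n * C := fun n x =>
    (hT.abs_pow_apply_le hζ (by positivity) hd hosc
      ((apply_univ_eq_integral hμ.ac hh).symm.trans h0) n x).trans (hrate n)
  have hweak := WeakBound.map_iterate ((hμ.weak.scale hR1).mono le_rfl (by gcongr)) hf hG hα
    hζ.le hcontr hR (fun n => (hdensity n).1)
    (fun n => (hdensity n).2.mono fun x hx => hx ▸ hsup n x) hξ0.le hC hW n
  have hle : 2 * V * ξ ^ n * C ≤ (W + 2 * V) * ξ ^ n * C := by
    gcongr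
    linarith
  refine ⟨(hdensity n).1, hweak.mono hR1 (by gcongr; linarith), (T ^ n) h, (hdensity n).2,
    fun x => (hsup n x).trans hle, ?_⟩
  exact (hT.decay _ h (by positivity) hd hosc n).1.mono ((hrate n).trans hle)

theorem FlatteningDual.exists_massZeroDecay (hT : FlatteningDual m₁ f ζ T κ V) (hζ : 0 < ζ)
    (hf : MeasurePreserving f m₁ m₁) (hG : Measurable G) (hα : α < 1)
    (hcontr : ContractsFibers m₁ G α) : ∃ ξ Q, MassZeroDecay m₁ ζ (skewProduct f G) ξ Q := by
  obtain ⟨α', hα', hα'1⟩ := exists_between (max_lt hα one_pos)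
  have hα'0 : 0 < α' := (le_max_right _ _).trans_lt hα'
  obtain ⟨R, hR1, hR⟩ := exists_rpow_dist_le K hζ.le
  obtain ⟨ξ, hξ, hξ1⟩ := exists_between (max_lt (Real.rpow_lt_one hα'0.le hα'1 hζ) hT.kappa_lt_one)
  have hgap : 0 < ξ - α' ^ ζ := sub_pos.2 ((le_max_left _ _).trans_lt hξ)
  have hκξ : κ < ξ := (le_max_right _ _).trans_lt hξ
  have hV := hT.V_pos
  have hRW : R ≤ R + R * (2 * V) / (ξ - α' ^ ζ) := le_add_of_nonneg_right (by positivity)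
  have hW : R * (2 * V) ≤ (R + R * (2 * V) / (ξ - α' ^ ζ)) * (ξ - α' ^ ζ) := by
    rw [add_mul, div_mul_cancel₀ _ hgap.ne']
    exact le_add_of_nonneg_left (by positivity)
  exact ⟨ξ, _, hT.kappa_pos.trans hκξ, hξ1, by positivity, fun _ _ hμ h0 n =>
    hT.sInftyBound_map_iterate hζ hf hG hα'0 (hcontr.mono ((le_max_left _ _).trans_lt hα').le) hR1
      hR hκξ.le hRW hW hμ h0 n⟩

end SkewProductDecay

section Base

/-- The hypotheses on the base map `f` and its invariant measure `m₁` on a metric space. The local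
inverse branches of `f` are `L`-Lipschitz, and they contract by `σ⁻¹` at the points outside `A`. -/
structure MetricBaseHypotheses {M : Type*} [PseudoMetricSpace M] [MeasurableSpace M] (ζ : ℝ≥0)
    (f : M → M) (m₁ : Measure M) (J : M → ℝ) (A : Set M) (σ L ε : ℝ) (q : ℕ) : Prop where
  continuous : Continuous f
  isOpenMap : IsOpenMap f
  invariant : MeasurePreserving f m₁ m₁
  jacobian : IsJacobian m₁ f J
  one_lt_sigma : 1 < σ
  one_le_L : 1 ≤ L
  L_le_two : L ≤ 2
  bound : ∀ x, ∃ U ∈ nhds x, ∀ u ∈ U, ∀ v ∈ U, dist u v ≤ L * dist (f u) (f v)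
  bound_off_region :
    ∀ x, ∃ U ∈ nhds x, ∀ u ∈ U ∩ Aᶜ, ∀ v ∈ U, dist u v ≤ σ⁻¹ * dist (f u) (f v)
  covering : ∃ 𝒰 : Finset (Set M), (∀ U ∈ 𝒰, MeasurableSet U ∧ Set.InjOn f U) ∧
    (⋃ U ∈ 𝒰, U) = Set.univ ∧ ∃ 𝒱 ⊆ 𝒰, 𝒱.card = q ∧ A ⊆ ⋃ V ∈ 𝒱, V
  q_lt_degree : q < mapDegree f
  eps_pos : 0 < ε
  osc_log_weight : (⨆ x, Real.log (weight J x)) - (⨅ x, Real.log (weight J x)) < ε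
  holder_weight : eHolderNorm ζ (weight J) < ENNReal.ofReal (ε * ⨅ x, weight J x)
  smallness : Real.exp ε *
    ((((mapDegree f : ℝ) - q) * σ ^ (-(ζ : ℝ)) + q * L ^ (ζ : ℝ) * (1 + (L - 1) ^ (ζ : ℝ)))
      / mapDegree f) < 1

theorem BaseHypotheses.metricBaseHypotheses {d : ℕ} {M : Type*} [MetricSpace M]
    [ChartedSpace (EuclideanSpace ℝ (Fin d)) M] [MeasurableSpace M] [BorelSpace M] {ζ : ℝ≥0}
    {f : M → M} {m₁ : Measure M} {J Λ : M → ℝ} {A : Set M} {σ L ε : ℝ} {q : ℕ}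
    (hf : BaseHypotheses (d := d) ζ f m₁ J Λ A σ L ε q) :
    MetricBaseHypotheses ζ f m₁ J A σ L ε q where
  __ := hf
  continuous := hf.localDiffeo.contMDiff.continuous
  isOpenMap := hf.localDiffeo.isOpenMap
  bound x := by
    obtain ⟨U, hU, -, hdist⟩ := hf.inverse_branch x
    have hΛ : Λ x ≤ L := by
      by_cases hx : x ∈ A
      · exact hf.bound_on_region x hx
      · exact ((hf.bound_off_region x hx).trans (inv_lt_one_of_one_lt₀ hf.one_lt_sigma)).le.trans
          hf.one_le_L
    exact ⟨U, hU, fun u hu v hv => (hdist u hu v hv).trans (by gcongr)⟩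
  bound_off_region x := by
    by_cases hx : x ∈ A
    · exact ⟨A, hf.isOpen_region.mem_nhds hx, fun u hu => absurd hu.1 hu.2⟩
    · obtain ⟨U, hU, -, hdist⟩ := hf.inverse_branch x
      refine ⟨U, hU, fun u hu v hv => (hdist u hu.1 v hv).trans ?_⟩
      gcongr
      exact (hf.bound_off_region x hx).le
  covering := by
    obtain ⟨𝒰, h𝒰, h⟩ := hf.covering
    exact ⟨𝒰, fun U hU => ⟨(h𝒰 U hU).1.measurableSet, (h𝒰 U hU).2⟩, h⟩

theorem le_exp_mul_of_osc_log_le {X : Type*} {ρ : X → ℝ} {ε : ℝ} (hpos : ∀ x, 0 < ρ x)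
    (habove : BddAbove (Set.range fun x => Real.log (ρ x)))
    (hbelow : BddBelow (Set.range fun x => Real.log (ρ x)))
    (hosc : (⨆ x, Real.log (ρ x)) - (⨅ x, Real.log (ρ x)) ≤ ε) (y y' : X) :
    ρ y ≤ Real.exp ε * ρ y' := by
  rw [← Real.exp_log (hpos y), ← Real.exp_log (hpos y'), ← Real.exp_add]
  gcongr
  linarith [le_ciSup habove y, ciInf_le hbelow y']

namespace MetricBaseHypotheses

variable {M : Type*} [MetricSpace M] [MeasurableSpace M] {m₁ : Measure M}
  {ζ : ℝ≥0} {f : M → M} {J : M → ℝ} {A : Set M} {σ L ε : ℝ} {q : ℕ}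

theorem exp_mul_branchRate_lt_one (hf : MetricBaseHypotheses ζ f m₁ J A σ L ε q) :
    Real.exp ε / (mapDegree f : ℝ) * branchRate (mapDegree f) q L σ⁻¹ ζ < 1 := by
  have h := hf.smallness
  have hσ : 0 ≤ σ := zero_le_one.trans hf.one_lt_sigma.le
  rw [Real.rpow_neg hσ, ← Real.inv_rpow hσ, mul_assoc (q : ℝ)] at h
  rwa [div_mul_eq_mul_div, mul_div_assoc]

variable [CompactSpace M]

theorem exists_branchWeight {fib : M → Finset M} {δ : ℝ}
    (hf : MetricBaseHypotheses ζ f m₁ J A σ L ε q) (hζ : 0 < ζ)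
    (hb : Branches f fib A (mapDegree f) q L σ⁻¹ δ) :
    ∃ β B, BranchWeight fib L δ ζ (fun y => weight J y / fiberSum fib (weight J) (f y))
      (Real.exp ε / mapDegree f) β B := by
  have hpos (x : M) : 0 < weight J x := one_div_pos.2 (hf.jacobian.pos x)
  have hinf : 0 < ⨅ x, weight J x :=
    pos_of_mul_pos_right (ENNReal.ofReal_pos.1 (zero_le.trans_lt hf.holder_weight)) hf.eps_pos.le
  have hbelow : BddBelow (Set.range (weight J)) := ⟨0, by rintro _ ⟨x, rfl⟩; exact (hpos x).le⟩
  have hholder : MemHolder ζ (weight J) :=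
    eHolderNorm_lt_top.1 (hf.holder_weight.trans ENNReal.ofReal_lt_top)
  have hlog : Continuous fun x => Real.log (weight J x) :=
    (hholder.holderWith.continuous hζ).log fun x => (hpos x).ne'
  exact ⟨_, _, hb.branchWeight_div_fiberSum ζ.coe_nonneg hinf (Real.exp_pos ε)
    (nnHolderNorm ζ (weight J)).coe_nonneg (ciInf_le hbelow)
    (le_exp_mul_of_osc_log_le hpos (isCompact_range hlog).bddAbove (isCompact_range hlog).bddBelow
      hf.osc_log_weight.le)
    (holderWith_iff_holderBound.1 hholder.holderWith)⟩

theorem exists_flatteningDual [BorelSpace M] [PreconnectedSpace M] [IsProbabilityMeasure m₁]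
    (hf : MetricBaseHypotheses ζ f m₁ J A σ L ε q) (hM : HasIntermediatePoints M)
    (hdiam : ∀ x y : M, dist x y ≤ 1) (hζ : 0 < ζ) (hζ1 : ζ ≤ 1) :
    ∃ T κ V, FlatteningDual m₁ f ζ T κ V := by
  have := nonempty_of_isProbabilityMeasure m₁
  obtain ⟨𝒰, h𝒰, hcov, 𝒱, h𝒱, hcard, hA⟩ := hf.covering
  obtain ⟨fib, δ, hb⟩ := exists_branches hf.continuous hf.isOpenMap hf.bound hf.bound_off_region
    hf.one_le_L hf.L_le_two (inv_pos.2 (one_pos.trans hf.one_lt_sigma))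
    (inv_le_one_of_one_le₀ hf.one_lt_sigma.le) (fun V hV => (h𝒰 V (h𝒱 hV)).2) hA hcard
    hf.q_lt_degree
  obtain ⟨β, B, hp⟩ := hf.exists_branchWeight hζ hb
  have hrate : 1 / (mapDegree f : ℝ) * branchRate (mapDegree f) q L σ⁻¹ ζ < 1 :=
    lt_of_le_of_lt (mul_le_mul_of_nonneg_right
      (by gcongr; exact Real.one_le_exp hf.eps_pos.le) hb.branchRate_nonneg)
      hf.exp_mul_branchRate_lt_one
  obtain ⟨κ, V, hκ0, hκ1, hV, hdecay⟩ :=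
    hp.exists_transfer_decay hb hM hdiam hζ (by exact_mod_cast hζ1) hrate
      hf.exp_mul_branchRate_lt_one
  refine ⟨_, κ, V, hκ0, hκ1, hV, fun C h hh B hB => ?_, hdecay⟩
  have hBf := hf.invariant.measurable hB
  have hmul (u : M → ℝ) (s : Set M) (x : M) : s.indicator 1 x * u x = s.indicator u x := by
    by_cases hx : x ∈ s <;> simp [hx]
  have hind (x : M) : B.indicator (1 : M → ℝ) (f x) * h x = (f ⁻¹' B).indicator h x :=
    hmul h (f ⁻¹' B) x
  have hint : Integrable (fun x => B.indicator (1 : M → ℝ) (f x) * h x) m₁ := by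
    simpa only [hind] using (hh.integrable hζ).indicator hBf
  simpa only [hind, hmul, integral_indicator hBf, integral_indicator hB] using
    hf.jacobian.integral_comp_mul hf.invariant hb.enumeratesFibers h𝒰 hcov hint

end MetricBaseHypotheses

end Base

section Invariant

open Filter Topology

theorem toSignedMeasure_map {X Y : Type*} [MeasurableSpace X] [MeasurableSpace Y] (μ : Measure X)
    [IsFiniteMeasure μ] {F : X → Y} (hF : Measurable F) :
    (μ.map F).toSignedMeasure = μ.toSignedMeasure.map F := by
  ext E hE
  rw [VectorMeasure.map_apply _ hF hE, Measure.toSignedMeasure_apply_measurable hE,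
    Measure.toSignedMeasure_apply_measurable (hF hE), map_measureReal_apply hF hE]

theorem toSignedMeasure_univ {X : Type*} [MeasurableSpace X] (μ : Measure X)
    [IsProbabilityMeasure μ] : μ.toSignedMeasure Set.univ = 1 := by
  rw [Measure.toSignedMeasure_apply_measurable MeasurableSet.univ, probReal_univ]

theorem fst_map_iterate_skewProduct {M K : Type*} [MeasurableSpace M] [MeasurableSpace K]
    {m₁ : Measure M} {f : M → M} {G : M × K → K} (hf : MeasurePreserving f m₁ m₁)
    (hG : Measurable G) {ν : Measure (M × K)} (hν : ν.fst = m₁) (n : ℕ) :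
    (ν.map (skewProduct f G)^[n]).fst = m₁ := by
  have hF := measurable_skewProduct hf.measurable hG
  induction n with
  | zero => simpa using hν
  | succ n ih =>
    rw [Function.iterate_succ', ← Measure.map_map hF (hF.iterate n), Measure.fst,
      Measure.map_map measurable_fst hF, show Prod.fst ∘ skewProduct f G = f ∘ Prod.fst from rfl,
      ← Measure.map_map hf.measurable measurable_fst, ← Measure.fst, ih, hf.map_eq]

variable {M K : Type*} [MetricSpace M] [MeasurableSpace M] [MetricSpace K] [MeasurableSpace K]
  {m₁ : Measure M} {ζ ξ Q C : ℝ} {F : M × K → M × K}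

theorem MassZeroDecay.tendsto_const (hdec : MassZeroDecay m₁ ζ F ξ Q) (C : ℝ) :
    Tendsto (fun n : ℕ => Q * ξ ^ n * C) atTop (𝓝 0) := by
  simpa using ((tendsto_pow_atTop_nhds_zero_of_lt_one hdec.xi_pos.le hdec.xi_lt_one).const_mul
    Q).mul_const C

theorem MassZeroDecay.eq_zero [BorelSpace K] (hdec : MassZeroDecay m₁ ζ F ξ Q) (hζ : 0 ≤ ζ)
    (hζ1 : ζ ≤ 1) (hF : Measurable F) {μ : SignedMeasure (M × K)} (hμ : SInftyBound m₁ ζ C μ)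
    (h0 : μ Set.univ = 0) (hinv : μ.map F = μ) : μ = 0 := by
  have hfix (n : ℕ) : μ.map F^[n] = μ := by
    induction n with
    | zero => exact VectorMeasure.map_id μ
    | succ n ih => rw [map_iterate_succ hF, ih, hinv]
  refine eq_zero_of_weakBound_zero (m₁ := m₁) hζ hζ1 fun B Φ hB hΦ => ?_
  refine ge_of_tendsto' ((hdec.tendsto_const C).mul_const (m₁.real B)) fun n => ?_
  simpa only [hfix] using (hdec.bound C μ hμ h0 n).weak B Φ hB hΦ

theorem MassZeroDecay.tendsto_integral_sub [BorelSpace M] [CompactSpace K] [Nonempty K]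
    [BorelSpace K] [IsProbabilityMeasure m₁] {ζ : ℝ≥0} (hdec : MassZeroDecay m₁ ζ F ξ Q)
    (hF : Measurable F) {a b : Measure (M × K)} [IsProbabilityMeasure a] [IsProbabilityMeasure b]
    (ha : a.fst = m₁) (hb : b.fst = m₁) {Φ : M × K → ℝ} (hΦ : FiberTest ζ 1 Φ) :
    Tendsto (fun n => ∫ p, Φ p ∂a.map F^[n] - ∫ p, Φ p ∂b.map F^[n]) atTop (𝓝 0) := by
  refine squeeze_zero_norm (fun n => ?_) (hdec.tendsto_const (1 + 1))
  have hmap : (a.toSignedMeasure - b.toSignedMeasure).map F^[n]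
      = (a.map F^[n]).toSignedMeasure - (b.map F^[n]).toSignedMeasure := by
    rw [toSignedMeasure_map _ (hF.iterate n), toSignedMeasure_map _ (hF.iterate n)]
    exact map_sub (VectorMeasure.mapₗ (R := ℝ) F^[n]) _ _
  have hweak := (hdec.bound _ _ ((sInftyBound_of_fst_eq ha).sub (sInftyBound_of_fst_eq hb))
    (by rw [sub_apply, toSignedMeasure_univ, toSignedMeasure_univ, sub_self]) n).weak
    Set.univ Φ MeasurableSet.univ hΦ
  rw [hmap, Set.preimage_univ, VectorMeasure.restrict_univ, probReal_univ, mul_one,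
    signedIntegral_toSignedMeasure_sub (hΦ.integrable _) (hΦ.integrable _)] at hweak
  exact hweak

variable [CompactSpace M] [BorelSpace M] [CompactSpace K] [Nonempty K] [BorelSpace K]
  [IsProbabilityMeasure m₁] {f : M → M} {G : M × K → K}

theorem MassZeroDecay.exists_invariant {ζ : ℝ≥0} (hdec : MassZeroDecay m₁ ζ (skewProduct f G) ξ Q)
    (hζ : 0 < ζ) (hζ1 : ζ ≤ 1) (hf : MeasurePreserving f m₁ m₁) (hG : Measurable G) {α : ℝ}
    (hcontr : ContractsFibers m₁ G α) :
    ∃ μ₀ : ProbabilityMeasure (M × K), (μ₀ : Measure (M × K)).map (skewProduct f G) = μ₀ ∧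
      (μ₀ : Measure (M × K)).fst = m₁ := by
  have hF := measurable_skewProduct hf.measurable hG
  let ν₀ : ProbabilityMeasure (M × K) :=
    ⟨m₁.prod (Measure.dirac (Classical.arbitrary K)), inferInstance⟩
  have hν₀ := fst_map_iterate_skewProduct hf hG (ν := ν₀) Measure.fst_prod
  refine exists_invariant_of_tendsto_sub (ν := fun n => ν₀.map (hF.iterate n).aemeasurable)
    (by exact_mod_cast hζ) (by exact_mod_cast hζ1) hf.measurable hG hcontr hν₀ (fun n => ?_)
    fun Φ hΦ => ?_
  · rw [ProbabilityMeasure.toMeasure_map, ProbabilityMeasure.toMeasure_map,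
      Measure.map_map hF (hF.iterate n), Function.iterate_succ']
  · have := Measure.isProbabilityMeasure_map (μ := (ν₀ : Measure (M × K))) hF.aemeasurable
    have h := hdec.tendsto_integral_sub hF
      (show ((ν₀ : Measure (M × K)).map (skewProduct f G)).fst = m₁ from hν₀ 1)
      (b := ν₀) Measure.fst_prod hΦ
    simpa only [ProbabilityMeasure.toMeasure_map, Measure.map_map (hF.iterate _) hF,
      ← Function.iterate_succ] using h

end Invariant

section Splitting

variable {X : Type*} [MeasurableSpace X] {F : X → X} {v : SignedMeasure X}

/-- The rank one map `μ ↦ μ(X) v`. -/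
def massProjection (v : SignedMeasure X) : Module.End ℝ (SignedMeasure X) where
  toFun μ := μ Set.univ • v
  map_add' μ ν := by rw [add_apply, add_smul]
  map_smul' c μ := by rw [smul_apply, smul_eq_mul, mul_smul, RingHom.id_apply]

/-- The push-forward by `F`, after the mass has been removed by subtracting a multiple of `v`. -/
def massZeroMap (F : X → X) (v : SignedMeasure X) : Module.End ℝ (SignedMeasure X) :=
  VectorMeasure.mapₗ F ∘ₗ (LinearMap.id - massProjection v)

theorem sub_massProjection_univ (hv : v Set.univ = 1) (μ : SignedMeasure X) :
    (μ - massProjection v μ) Set.univ = 0 := by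
  change (μ - μ Set.univ • v) Set.univ = 0
  rw [sub_apply, smul_apply, hv, smul_eq_mul, mul_one, sub_self]

theorem massProjection_of_univ_eq_zero {μ : SignedMeasure X} (h : μ Set.univ = 0) :
    massProjection v μ = 0 := by
  change μ Set.univ • v = 0
  rw [h, zero_smul]

theorem massProjection_self (hv : v Set.univ = 1) : massProjection v v = v := by
  change v Set.univ • v = v
  rw [hv, one_smul]

theorem massZeroMap_univ (hF : Measurable F) (hv : v Set.univ = 1) (μ : SignedMeasure X) :
    massZeroMap F v μ Set.univ = 0 := by
  change (μ - massProjection v μ).map F Set.univ = 0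
  rw [VectorMeasure.map_apply _ hF MeasurableSet.univ, Set.preimage_univ,
    sub_massProjection_univ hv]

theorem massZeroMap_smul_self (hv : v Set.univ = 1) (c : ℝ) : massZeroMap F v (c • v) = 0 := by
  rw [map_smul, massZeroMap, LinearMap.comp_apply, LinearMap.sub_apply, LinearMap.id_apply,
    massProjection_self hv, sub_self, map_zero, smul_zero]

theorem map_eq_massProjection_add (hinv : v.map F = v) (μ : SignedMeasure X) :
    μ.map F = massProjection v μ + massZeroMap F v μ := by
  have h : massZeroMap F v μ = μ.map F - μ Set.univ • v.map F := by
    rw [massZeroMap, LinearMap.comp_apply, LinearMap.sub_apply, map_sub]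
    exact congrArg _ (map_smul (VectorMeasure.mapₗ (R := ℝ) F) _ _)
  rw [h, hinv]
  exact (add_sub_cancel _ _).symm

theorem massZeroMap_of_univ_eq_zero {μ : SignedMeasure X} (h : μ Set.univ = 0) :
    massZeroMap F v μ = μ.map F := by
  rw [massZeroMap, LinearMap.comp_apply, LinearMap.sub_apply, massProjection_of_univ_eq_zero h,
    sub_zero]
  rfl

theorem massZeroMap_pow_succ (hF : Measurable F) (hv : v Set.univ = 1) (n : ℕ)
    (μ : SignedMeasure X) :
    (massZeroMap F v ^ (n + 1)) μ = (μ - massProjection v μ).map F^[n + 1] := by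
  induction n with
  | zero => rw [zero_add, pow_one, Function.iterate_one]; rfl
  | succ n ih =>
    have hmass : (μ - massProjection v μ).map F^[n + 1] Set.univ = 0 := by
      rw [VectorMeasure.map_apply _ (hF.iterate _) MeasurableSet.univ, Set.preimage_univ,
        sub_massProjection_univ hv]
    rw [pow_succ', Module.End.mul_apply, ih, massZeroMap_of_univ_eq_zero hmass,
      ← map_iterate_succ hF]

end Splitting

section SpectralGap

variable {M K : Type*} [MetricSpace M] [MeasurableSpace M] [MetricSpace K] [CompactSpace K]
  [Nonempty K] [MeasurableSpace K] [BorelSpace K] {m₁ : Measure M} [IsProbabilityMeasure m₁]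
  {ζ : ℝ≥0} {hζ : 0 < ζ} {F : M × K → M × K} {μ ν : SignedMeasure (M × K)} {ξ Q : ℝ}

/-- Subtraction on `S^∞`; instance search does not see that the additive monoid of signed measures
underlying the submodule comes from their additive group. -/
instance SInfty.addCommGroup (m₁ : Measure M) [IsFiniteMeasure m₁] (hζ : 0 < ζ) :
    AddCommGroup (SInfty (K := K) m₁ ζ hζ) :=
  Module.addCommMonoidToAddCommGroup ℝ

theorem sinftyNorm_le_of_forall (hμ : μ ∈ SInfty m₁ ζ hζ) {s : ℝ} (hs : 0 < s)
    (h : ∀ C, SInftyBound m₁ ζ C μ → SInftyBound m₁ ζ (s * C) ν) :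
    sinftyNorm m₁ ζ ν ≤ 3 * s * sinftyNorm m₁ ζ μ := by
  rw [← div_le_iff₀' (by positivity)]
  refine le_of_forall_gt_imp_ge_of_dense fun C hC => ?_
  rw [div_le_iff₀' (by positivity), mul_assoc]
  exact (h C (sInftyBound_of_mem hμ hC)).sinftyNorm_le hζ

theorem SInftyBound.sub_massProjection {C : ℝ} (h : SInftyBound m₁ ζ C μ)
    (hν : SInftyBound m₁ ζ 1 ν) : SInftyBound m₁ ζ (2 * C) (μ - massProjection ν μ) :=
  (h.sub (hν.smul (μ Set.univ))).mono (by linarith [h.abs_univ_le])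

theorem MassZeroDecay.massZeroMap_pow_succ {C : ℝ} (hdec : MassZeroDecay m₁ ζ F ξ Q)
    (hF : Measurable F) (hν : SInftyBound m₁ ζ 1 ν) (hν1 : ν Set.univ = 1)
    (h : SInftyBound m₁ ζ C μ) (n : ℕ) :
    SInftyBound m₁ ζ (2 * (Q * ξ ^ (n + 1)) * C) ((massZeroMap F ν ^ (n + 1)) μ) := by
  rw [SkewGap.massZeroMap_pow_succ hF hν1]
  exact (hdec.bound _ _ (h.sub_massProjection hν) (sub_massProjection_univ hν1 μ) (n + 1)).mono
    (le_of_eq (by ring))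

theorem finrank_range_massProjection_restrict (hν1 : ν Set.univ = 1) (hν : ν ∈ SInfty m₁ ζ hζ)
    (hP : ∀ μ ∈ SInfty (K := K) m₁ ζ hζ, massProjection ν μ ∈ SInfty (K := K) m₁ ζ hζ) :
    Module.finrank ℝ (LinearMap.range ((massProjection ν).restrict hP)) = 1 := by
  have hν0 : ν ≠ 0 := by
    rintro rfl
    exact zero_ne_one hν1
  let w : LinearMap.range ((massProjection ν).restrict hP) :=
    ⟨⟨ν, hν⟩, ⟨ν, hν⟩, Subtype.ext (massProjection_self hν1)⟩
  have hw : w ≠ 0 := fun h => hν0 (congrArg Subtype.val (congrArg Subtype.val h))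
  refine (finrank_eq_one_iff_of_nonzero' w hw).2 ?_
  rintro ⟨_, μ, rfl⟩
  exact ⟨(μ : SignedMeasure (M × K)) Set.univ, rfl⟩

theorem MassZeroDecay.exists_isSpectralGap (hdec : MassZeroDecay m₁ ζ F ξ Q) (hζ : 0 < ζ)
    (hF : Measurable F) (hν : SInftyBound m₁ ζ 1 ν) (hν1 : ν Set.univ = 1)
    (hinv : ν.map F = ν) :
    ∃ P N : Module.End ℝ (SInfty (K := K) m₁ ζ hζ), IsSpectralGap F m₁ ζ hζ P N ξ (6 * Q) := by
  have hmemν := hν.mem_sInfty hζ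
  have hP : ∀ μ ∈ SInfty (K := K) m₁ ζ hζ, massProjection ν μ ∈ SInfty (K := K) m₁ ζ hζ :=
    fun μ _ => Submodule.smul_mem _ _ hmemν
  have hN : ∀ μ ∈ SInfty (K := K) m₁ ζ hζ, massZeroMap F ν μ ∈ SInfty (K := K) m₁ ζ hζ :=
    fun μ hμ => by
      have h := sInftyBound_of_mem hμ (lt_add_one _)
      simpa only [zero_add, pow_one] using
        (hdec.massZeroMap_pow_succ hF hν hν1 h 0).mem_sInfty hζ
  have hξ := hdec.xi_pos
  have hQ := hdec.const_pos
  refine ⟨(massProjection ν).restrict hP, (massZeroMap F ν).restrict hN,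
    { decomposition := fun μ => map_eq_massProjection_add hinv μ
      projection := ?_
      rank_one := finrank_range_massProjection_restrict hν1 hmemν hP
      xi_pos := hξ
      xi_lt_one := hdec.xi_lt_one
      const_pos := by positivity
      bound := fun n hn μ => ?_
      proj_mul := ?_
      mul_proj := ?_ }⟩
  · ext1 μ
    refine Subtype.ext ((map_smul (massProjection ν) _ ν).trans ?_)
    rw [massProjection_self hν1]
    rfl
  · obtain ⟨k, rfl⟩ := Nat.exists_eq_add_of_le' hn
    rw [Module.End.pow_restrict]
    exact (sinftyNorm_le_of_forall μ.2 (by positivity) fun C hC =>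
      hdec.massZeroMap_pow_succ hF hν hν1 hC k).trans_eq (by ring)
  · ext1 μ
    exact Subtype.ext (massProjection_of_univ_eq_zero (massZeroMap_univ hF hν1 μ))
  · ext1 μ
    exact Subtype.ext (massZeroMap_smul_self hν1 _)

end SpectralGap

section Duality

variable {M K : Type*} [MetricSpace M] [MetricSpace K] {ζ : ℝ≥0} {g : M × K → ℝ}

theorem HolderBound.prodMk_of_onSumMetric {s : ℝ} (h : HolderBound ζ s (onSumMetric g)) (x : M) :
    HolderBound ζ s fun z => g (x, z) := fun z z' => by
  have hd : dist (WithLp.toLp 1 (x, z)) (WithLp.toLp 1 (x, z')) = dist z z' := by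
    rw [WithLp.prod_dist_eq_add (by simp)]
    simp
  exact hd ▸ h (WithLp.toLp 1 (x, z)) (WithLp.toLp 1 (x, z'))

theorem continuous_of_memHolder_onSumMetric (hζ : 0 < ζ) (hg : MemHolder ζ (onSumMetric g)) :
    Continuous g :=
  (hg.holderWith.continuous hζ).comp (WithLp.prod_continuous_toLp 1 M K)

theorem fullHolderNorm_onSumMetric_ne_top [CompactSpace M] [CompactSpace K] (hζ : 0 < ζ)
    (hg : MemHolder ζ (onSumMetric g)) : fullHolderNorm ζ (onSumMetric g) ≠ ⊤ := by
  obtain ⟨R, hR⟩ := isCompact_univ.exists_bound_of_continuousOn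
    (continuous_of_memHolder_onSumMetric hζ hg).continuousOn
  refine ENNReal.add_ne_top.2 ⟨eHolderNorm_ne_top.2 hg, ne_top_of_le_ne_top
    (ENNReal.ofReal_ne_top (r := R)) (iSup_le fun p => ?_)⟩
  rw [Real.enorm_eq_ofReal_abs]
  exact ENNReal.ofReal_le_ofReal (hR (WithLp.ofLp p) (Set.mem_univ _))

variable [MeasurableSpace M] [MeasurableSpace K]

theorem fiberTest_inv_mul {s : ℝ} (hs : 0 < s) (hg : Measurable g) (hgs : ∀ p, |g p| ≤ s)
    (hd : HolderBound ζ s (onSumMetric g)) : FiberTest ζ 1 fun p => s⁻¹ * g p where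
  measurable := hg.const_mul _
  holder x z z' := by
    rw [← mul_sub, abs_mul, abs_of_pos (inv_pos.2 hs), inv_mul_le_iff₀ hs, one_mul]
    exact hd.prodMk_of_onSumMetric x z z'
  bound p := by
    rw [abs_mul, abs_of_pos (inv_pos.2 hs), inv_mul_le_iff₀ hs, mul_one]
    exact hgs p

theorem abs_signedIntegral_le [CompactSpace M] [BorelSpace M] [CompactSpace K] [Nonempty K]
    [BorelSpace K] {m₁ : Measure M} [IsProbabilityMeasure m₁] {hζ : 0 < ζ}
    {μ : SignedMeasure (M × K)} (hμ : μ ∈ SInfty m₁ ζ hζ) (hg : MemHolder ζ (onSumMetric g)) :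
    |∫ᵛ p, g p ∂<•μ| ≤ (fullHolderNorm ζ (onSumMetric g)).toReal * sinftyNorm m₁ ζ μ := by
  refine le_mul_of_forall_lt₀ fun s hs C hC => ?_
  have hs0 : 0 < s := ENNReal.toReal_nonneg.trans_lt hs
  obtain ⟨hgs, hd⟩ := holderBound_of_fullHolderNorm_le hs0.le <|
    (ENNReal.le_ofReal_iff_toReal_le (fullHolderNorm_onSumMetric_ne_top hζ hg) hs0.le).2 hs.le
  have hweak := (sInftyBound_of_mem hμ hC).weak Set.univ _ MeasurableSet.univ <|
    fiberTest_inv_mul hs0 (continuous_of_memHolder_onSumMetric hζ hg).measurable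
      (fun p => hgs (WithLp.toLp 1 p)) hd
  rwa [Set.preimage_univ, VectorMeasure.restrict_univ, signedIntegral_const_mul, abs_mul,
    abs_of_pos (inv_pos.2 hs0), inv_mul_le_iff₀ hs0, probReal_univ, mul_one] at hweak

end Duality

section Correlations

variable {M K : Type*} [MetricSpace M] [MeasurableSpace M] [MetricSpace K] [CompactSpace K]
  [Nonempty K] [MeasurableSpace K] [BorelSpace K] {m₁ : Measure M} [IsProbabilityMeasure m₁]
  {ζ : ℝ≥0} {hζ : 0 < ζ} {μ : SignedMeasure (M × K)}

theorem SInfty.eq_zero_of_sinftyNorm_le_zero (hζ1 : ζ ≤ 1) (hμ : μ ∈ SInfty m₁ ζ hζ)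
    (h : sinftyNorm m₁ ζ μ ≤ 0) : μ = 0 := by
  refine eq_zero_of_weakBound_zero (m₁ := m₁) ζ.coe_nonneg hζ1 fun B Φ hB hΦ => ?_
  rw [zero_mul]
  refine le_of_forall_gt_imp_ge_of_dense fun C hC => ?_
  exact ((sInftyBound_of_mem hμ (h.trans_lt hC)).weak B Φ hB hΦ).trans
    (mul_le_of_le_one_right hC.le measureReal_le_one)

theorem SInfty.abs_univ_le (hμ : μ ∈ SInfty m₁ ζ hζ) : |μ Set.univ| ≤ sinftyNorm m₁ ζ μ :=
  le_of_forall_gt_imp_ge_of_dense fun _ hC => (sInftyBound_of_mem hμ hC).abs_univ_le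

variable {F : M × K → M × K} {P N : Module.End ℝ (SInfty (K := K) m₁ ζ hζ)} {ξ C : ℝ}
  {v : SInfty (K := K) m₁ ζ hζ}

theorem IsSpectralGap.map_iterate (h : IsSpectralGap F m₁ ζ hζ P N ξ C) (hF : Measurable F)
    (μ : SInfty (K := K) m₁ ζ hζ) (n : ℕ) :
    (μ : SignedMeasure (M × K)).map F^[n + 1]
      = (P μ : SignedMeasure (M × K)) + (N ^ (n + 1)) μ := by
  induction n with
  | zero => exact h.decomposition μ
  | succ n ih =>
    have hPP : P (P μ) = P μ := LinearMap.congr_fun h.projection μ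
    have hNP : N (P μ) = 0 := LinearMap.congr_fun h.mul_proj μ
    have hPN : P ((N ^ (n + 1)) μ) = 0 := by
      rw [pow_succ', Module.End.mul_apply]
      exact LinearMap.congr_fun h.proj_mul _
    rw [map_iterate_succ hF, ih, ← Submodule.coe_add, h.decomposition, map_add, map_add, hPP, hNP,
      hPN, add_zero, zero_add, ← Module.End.mul_apply, ← pow_succ']

theorem IsSpectralGap.tendsto_bound (h : IsSpectralGap F m₁ ζ hζ P N ξ C) (a : ℝ) :
    Filter.Tendsto (fun n : ℕ => a * ξ ^ (n + 1) * C) Filter.atTop (nhds 0) := by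
  have hpow := (tendsto_pow_atTop_nhds_zero_of_lt_one h.xi_pos.le h.xi_lt_one).comp
    (Filter.tendsto_add_atTop_nat 1)
  simpa using (hpow.const_mul a).mul_const C

theorem IsSpectralGap.proj_univ (h : IsSpectralGap F m₁ ζ hζ P N ξ C) (hF : Measurable F)
    (μ : SInfty (K := K) m₁ ζ hζ) :
    (P μ : SignedMeasure (M × K)) Set.univ = (μ : SignedMeasure (M × K)) Set.univ := by
  refine (sub_eq_zero.1 (abs_nonpos_iff.1 (ge_of_tendsto'
    (h.tendsto_bound (sinftyNorm m₁ ζ (μ : SignedMeasure (M × K)))) fun n => ?_))).symm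
  have hmass := congrArg (fun ν : SignedMeasure (M × K) => ν Set.univ) (h.map_iterate hF μ n)
  simp only [VectorMeasure.map_apply _ (hF.iterate _) MeasurableSet.univ, Set.preimage_univ,
    add_apply] at hmass
  rw [hmass, add_sub_cancel_left]
  exact (SInfty.abs_univ_le ((N ^ (n + 1)) μ).2).trans (h.bound (n + 1) (by omega) μ)

theorem IsSpectralGap.proj_eq_self (h : IsSpectralGap F m₁ ζ hζ P N ξ C) (hζ1 : ζ ≤ 1)
    (hF : Measurable F) (hv : (v : SignedMeasure (M × K)).map F = v) : P v = v := by
  have hfix (n : ℕ) : (v : SignedMeasure (M × K)).map F^[n + 1] = v := by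
    induction n with
    | zero => exact hv
    | succ n ih => rw [map_iterate_succ hF, ih, hv]
  have hN (n : ℕ) : (N v : SignedMeasure (M × K)) = (N ^ (n + 1)) v :=
    add_left_cancel (((h.decomposition v).symm.trans hv).trans
      ((hfix n).symm.trans (h.map_iterate hF v n)))
  have hNv : (N v : SignedMeasure (M × K)) = 0 :=
    SInfty.eq_zero_of_sinftyNorm_le_zero hζ1 (N v).2 <|
      ge_of_tendsto' (h.tendsto_bound _) fun n => by
        rw [hN n]
        exact h.bound (n + 1) (by omega) v
  have hdecomp := h.decomposition v
  rw [hv, hNv, add_zero] at hdecomp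
  exact (Subtype.ext hdecomp).symm

theorem IsSpectralGap.proj_eq (h : IsSpectralGap F m₁ ζ hζ P N ξ C) (hζ1 : ζ ≤ 1)
    (hF : Measurable F) (hv : (v : SignedMeasure (M × K)).map F = v)
    (hv1 : (v : SignedMeasure (M × K)) Set.univ = 1) (μ : SInfty (K := K) m₁ ζ hζ) :
    P μ = (μ : SignedMeasure (M × K)) Set.univ • v := by
  let w : LinearMap.range P := ⟨v, v, h.proj_eq_self hζ1 hF hv⟩
  have hw : w ≠ 0 := fun h0 => by
    rw [show v = 0 from congrArg Subtype.val h0] at hv1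
    exact zero_ne_one hv1
  obtain ⟨c, hc⟩ := (finrank_eq_one_iff_of_nonzero' w hw).1 h.rank_one ⟨P μ, μ, rfl⟩
  have hPμ : c • v = P μ := congrArg Subtype.val hc
  have hmass := h.proj_univ hF μ
  rw [← hPμ, Submodule.coe_smul, smul_apply, hv1, smul_eq_mul, mul_one] at hmass
  rw [← hPμ, hmass]

variable [CompactSpace M] [BorelSpace M] {μ₀ : Measure (M × K)} [IsProbabilityMeasure μ₀]
  {g k : M × K → ℝ}

theorem IsSpectralGap.integral_iterate_mul_eq (h : IsSpectralGap F m₁ ζ hζ P N ξ C) (hζ1 : ζ ≤ 1)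
    (hF : Measurable F) (hinv : μ₀.map F = μ₀) (hmem : μ₀.toSignedMeasure ∈ SInfty m₁ ζ hζ)
    (hg : Continuous g) (hk : Integrable k μ₀) (hkS : μ₀.withDensityᵥ k ∈ SInfty m₁ ζ hζ) (n : ℕ) :
    ∫ p, g (F^[n + 1] p) * k p ∂μ₀ = (∫ p, g p ∂μ₀) * ∫ p, k p ∂μ₀
      + ∫ᵛ p, g p ∂<•((N ^ (n + 1)) ⟨μ₀.withDensityᵥ k, hkS⟩ : SInfty m₁ ζ hζ).1 := by
  obtain ⟨R, hR⟩ := isCompact_univ.exists_bound_of_continuousOn hg.continuousOn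
  have hint (μ : SignedMeasure (M × K)) (Φ : M × K → ℝ) (hΦ : Measurable Φ)
      (hΦR : ∀ p, |Φ p| ≤ R) : μ.Integrable Φ :=
    Integrable.of_bound hΦ.aestronglyMeasurable R (ae_of_all _ hΦR)
  have hgint (μ : SignedMeasure (M × K)) : μ.Integrable g :=
    hint μ g hg.measurable fun p => hR p (Set.mem_univ p)
  have hgF : Measurable (g ∘ F^[n + 1]) := hg.measurable.comp (hF.iterate _)
  have hgFR (p : M × K) : |(g ∘ F^[n + 1]) p| ≤ R := hR _ (Set.mem_univ _)
  have hmass : μ₀.withDensityᵥ k Set.univ = ∫ p, k p ∂μ₀ := by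
    rw [withDensityᵥ_apply hk MeasurableSet.univ, setIntegral_univ]
  have hPk := congrArg Subtype.val (h.proj_eq hζ1 hF (v := ⟨μ₀.toSignedMeasure, hmem⟩)
    ((toSignedMeasure_map μ₀ hF).symm.trans (Measure.toSignedMeasure_congr hinv))
    (toSignedMeasure_univ μ₀) ⟨μ₀.withDensityᵥ k, hkS⟩)
  calc ∫ p, g (F^[n + 1] p) * k p ∂μ₀
      = ∫ᵛ p, g p ∂<•((μ₀.withDensityᵥ k).map F^[n + 1]) := by
        rw [VectorMeasure.integral_map (hF.iterate _) hg.aestronglyMeasurable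
          (hint _ _ hgF hgFR)]
        exact (signedIntegral_withDensity hk hgF hgFR).symm
    _ = ∫ᵛ p, g p ∂<•((∫ p, k p ∂μ₀) • μ₀.toSignedMeasure)
          + ∫ᵛ p, g p ∂<•((N ^ (n + 1)) ⟨μ₀.withDensityᵥ k, hkS⟩ : SInfty m₁ ζ hζ).1 := by
        rw [← VectorMeasure.integral_add_vectorMeasure (hgint _) (hgint _), ← hmass]
        exact congrArg (fun μ => ∫ᵛ p, g p ∂<•μ) ((h.map_iterate hF _ n).trans
          (congrArg (· + _) hPk))
    _ = _ := by
        rw [VectorMeasure.integral_smul_vectorMeasure, VectorMeasure.integral_toSignedMeasure,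
          smul_eq_mul, mul_comm]

theorem IsSpectralGap.correlation_le (h : IsSpectralGap F m₁ ζ hζ P N ξ C) (hζ1 : ζ ≤ 1)
    (hF : Measurable F) (hinv : μ₀.map F = μ₀) (hmem : μ₀.toSignedMeasure ∈ SInfty m₁ ζ hζ)
    (hg : MemHolder ζ (onSumMetric g)) (hk : Integrable k μ₀)
    (hkS : μ₀.withDensityᵥ k ∈ SInfty m₁ ζ hζ) {n : ℕ} (hn : 1 ≤ n) :
    |∫ p, g (F^[n] p) * k p ∂μ₀ - (∫ p, g p ∂μ₀) * ∫ p, k p ∂μ₀|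
      ≤ sinftyNorm m₁ ζ (μ₀.withDensityᵥ k) * C * (fullHolderNorm ζ (onSumMetric g)).toReal
        * ξ ^ n := by
  obtain ⟨n, rfl⟩ := Nat.exists_eq_add_of_le' hn
  rw [h.integral_iterate_mul_eq hζ1 hF hinv hmem (continuous_of_memHolder_onSumMetric hζ hg) hk hkS,
    add_sub_cancel_left]
  calc _ ≤ (fullHolderNorm ζ (onSumMetric g)).toReal * _ :=
        abs_signedIntegral_le ((N ^ (n + 1)) ⟨_, hkS⟩).2 hg
    _ ≤ (fullHolderNorm ζ (onSumMetric g)).toReal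
          * (sinftyNorm m₁ ζ (μ₀.withDensityᵥ k) * ξ ^ (n + 1) * C) :=
        mul_le_mul_of_nonneg_left (h.bound (n + 1) hn ⟨_, hkS⟩) ENNReal.toReal_nonneg
    _ = _ := by ring

end Correlations

section Uniqueness

variable {M K : Type*} [MetricSpace M] [MeasurableSpace M] [MetricSpace K] [CompactSpace K]
  [Nonempty K] [MeasurableSpace K] [BorelSpace K] {m₁ : Measure M} [IsProbabilityMeasure m₁]
  {ζ : ℝ≥0} {hζ : 0 < ζ} {F : M × K → M × K} {ξ Q : ℝ} {μ ν : ProbabilityMeasure (M × K)}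

theorem MassZeroDecay.eq_of_isInvariantInSInfty (hdec : MassZeroDecay m₁ ζ F ξ Q) (hζ1 : ζ ≤ 1)
    (hF : Measurable F) (hμ : IsInvariantInSInfty F m₁ ζ hζ μ)
    (hν : IsInvariantInSInfty F m₁ ζ hζ ν) : μ = ν := by
  have hzero : (μ : Measure (M × K)).toSignedMeasure -
      (ν : Measure (M × K)).toSignedMeasure = 0 := by
    refine hdec.eq_zero ζ.coe_nonneg hζ1 hF ((sInftyBound_of_mem hμ.2 (lt_add_one _)).sub
      (sInftyBound_of_mem hν.2 (lt_add_one _))) ?_ ?_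
    · rw [sub_apply, toSignedMeasure_univ, toSignedMeasure_univ, sub_self]
    · refine (map_sub (VectorMeasure.mapₗ (R := ℝ) F) _ _).trans (congrArg₂ _ ?_ ?_)
      · exact (toSignedMeasure_map _ hF).symm.trans (Measure.toSignedMeasure_congr hμ.1)
      · exact (toSignedMeasure_map _ hF).symm.trans (Measure.toSignedMeasure_congr hν.1)
  have heq : (μ : Measure (M × K)) = ν :=
    Measure.toSignedMeasure_eq_toSignedMeasure_iff.1 (sub_eq_zero.1 hzero)
  exact Subtype.ext heq

end Uniqueness

end SkewGap

end

theorem theoremC_general {M K : Type*}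
    [MetricSpace M] [CompactSpace M] [PreconnectedSpace M] [MeasurableSpace M] [BorelSpace M]
    [MetricSpace K] [CompactSpace K] [Nonempty K] [MeasurableSpace K] [BorelSpace K]
    (hM : HasIntermediatePoints M) (hdiam : ∀ x y : M, dist x y ≤ 1)
    {ζ : ℝ≥0} (hζ : 0 < ζ) (hζ1 : ζ ≤ 1)
    {f : M → M} {m₁ : Measure M} [IsProbabilityMeasure m₁]
    {J : M → ℝ} {A : Set M} {σ L ε : ℝ} {q : ℕ} (hf : MetricBaseHypotheses ζ f m₁ J A σ L ε q)
    {G : M × K → K} (hG : Measurable G) {α : ℝ} (hα1 : α < 1) (hG1 : ContractsFibers m₁ G α) :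
    (∃! μ₀ : ProbabilityMeasure (M × K),
      IsInvariantInSInfty (skewProduct f G) m₁ ζ hζ μ₀) ∧
    (∃ (P N : Module.End ℝ (SInfty (K := K) m₁ ζ hζ)) (ξ C : ℝ),
      IsSpectralGap (skewProduct f G) m₁ ζ hζ P N ξ C) ∧
    ∀ μ₀ : ProbabilityMeasure (M × K), IsInvariantInSInfty (skewProduct f G) m₁ ζ hζ μ₀ →
    ∀ (P N : Module.End ℝ (SInfty (K := K) m₁ ζ hζ)) (ξ C : ℝ),
      IsSpectralGap (skewProduct f G) m₁ ζ hζ P N ξ C →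
    ∀ g : M × K → ℝ, MemHolder ζ (onSumMetric g) →
    ∀ h : M × K → ℝ, Integrable h (μ₀ : Measure (M × K)) →
      (μ₀ : Measure (M × K)).withDensityᵥ h ∈ SInfty m₁ ζ hζ →
    ∀ n : ℕ, 1 ≤ n →
      |∫ p, g ((skewProduct f G)^[n] p) * h p ∂(μ₀ : Measure (M × K))
          - (∫ p, g p ∂(μ₀ : Measure (M × K))) * ∫ p, h p ∂(μ₀ : Measure (M × K))|
        ≤ sinftyNorm m₁ ζ ((μ₀ : Measure (M × K)).withDensityᵥ h) * C
          * (fullHolderNorm ζ (onSumMetric g)).toReal * ξ ^ n := by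
  have hF := measurable_skewProduct hf.invariant.measurable hG
  obtain ⟨T, κ, V, hT⟩ := hf.exists_flatteningDual hM hdiam hζ hζ1
  obtain ⟨ξ, Q, hdec⟩ :=
    hT.exists_massZeroDecay (by exact_mod_cast hζ) hf.invariant hG hα1 hG1
  obtain ⟨μ₀, hinv, hfst⟩ := hdec.exists_invariant hζ hζ1 hf.invariant hG hG1
  have hS : SInftyBound m₁ ζ 1 (μ₀ : Measure (M × K)).toSignedMeasure := sInftyBound_of_fst_eq hfst
  refine ⟨⟨μ₀, ⟨hinv, hS.mem_sInfty hζ⟩, fun μ hμ =>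
    hdec.eq_of_isInvariantInSInfty hζ1 hF hμ ⟨hinv, hS.mem_sInfty hζ⟩⟩, ?_, ?_⟩
  · obtain ⟨P, N, hgap⟩ := hdec.exists_isSpectralGap hζ hF hS (toSignedMeasure_univ _)
      ((toSignedMeasure_map _ hF).symm.trans (Measure.toSignedMeasure_congr hinv))
    exact ⟨P, N, ξ, _, hgap⟩
  · exact fun μ hμ P N ξ C hgap g hg h hh hhS n hn =>
      hgap.correlation_le hζ1 hF hμ.1 hμ.2 hg hh hhS hn

theorem theoremC {d : ℕ} {M K : Type*}
    [MetricSpace M] [CompactSpace M] [ConnectedSpace M]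
    [ChartedSpace (EuclideanSpace ℝ (Fin d)) M] [IsManifold (𝓡 d) ∞ M]
    [RiemannianBundle (fun x : M => TangentSpace (𝓡 d) x)]
    [IsContMDiffRiemannianBundle (𝓡 d) ∞ (EuclideanSpace ℝ (Fin d))
      (fun x : M => TangentSpace (𝓡 d) x)]
    [IsRiemannianManifold (𝓡 d) M] [MeasurableSpace M] [BorelSpace M]
    [MetricSpace K] [CompactSpace K] [Nonempty K] [MeasurableSpace K] [BorelSpace K]
    (hdiam : Metric.diam (Set.univ : Set M) = 1)
    (ζ : ℝ≥0) (hζ : 0 < ζ) (hζ1 : ζ ≤ 1)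
    (f : M → M) (m₁ : Measure M) [IsProbabilityMeasure m₁]
    (J Λ : M → ℝ) (A : Set M) (σ L ε : ℝ) (q : ℕ)
    (hf : BaseHypotheses (d := d) ζ f m₁ J Λ A σ L ε q)
    (G : M × K → K) (hG : Measurable G) (α : ℝ) (hα0 : 0 < α) (hα1 : α < 1)
    (hG1 : ContractsFibers m₁ G α) :
    (∃! μ₀ : ProbabilityMeasure (M × K),
      IsInvariantInSInfty (skewProduct f G) m₁ ζ hζ μ₀) ∧
    (∃ (P N : Module.End ℝ (SInfty (K := K) m₁ ζ hζ)) (ξ C : ℝ),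
      IsSpectralGap (skewProduct f G) m₁ ζ hζ P N ξ C) ∧
    ∀ μ₀ : ProbabilityMeasure (M × K), IsInvariantInSInfty (skewProduct f G) m₁ ζ hζ μ₀ →
    ∀ (P N : Module.End ℝ (SInfty (K := K) m₁ ζ hζ)) (ξ C : ℝ),
      IsSpectralGap (skewProduct f G) m₁ ζ hζ P N ξ C →
    ∀ g : M × K → ℝ, MemHolder ζ (onSumMetric g) →
    ∀ h : M × K → ℝ, Integrable h (μ₀ : Measure (M × K)) →
      (μ₀ : Measure (M × K)).withDensityᵥ h ∈ SInfty m₁ ζ hζ →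
    ∀ n : ℕ, 1 ≤ n →
      |∫ p, g ((skewProduct f G)^[n] p) * h p ∂(μ₀ : Measure (M × K))
          - (∫ p, g p ∂(μ₀ : Measure (M × K))) * ∫ p, h p ∂(μ₀ : Measure (M × K))|
        ≤ sinftyNorm m₁ ζ ((μ₀ : Measure (M × K)).withDensityᵥ h) * C
          * (fullHolderNorm ζ (onSumMetric g)).toReal * ξ ^ n :=
  theoremC_general (hasIntermediatePoints_of_isRiemannianManifold d M)
    (fun x y => hdiam ▸ Metric.dist_le_diam_of_mem isCompact_univ.isBounded
      (Set.mem_univ x) (Set.mem_univ y)) hζ hζ1 hf.metricBaseHypotheses hG hα1 hG1
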